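/- Let $P\ge 2$, $N=2P-1$ and $\alpha\in\mathbb C\setminus\{0\}$. **Equations.** Let $\varphi:\mathbb C^{N+1}\to\mathbb C^{N+1}$, $(u_0,\dots,u_N)\mapsto(u_1,\dots,u_{N+1})$, be the birational map defined by $$u_{n+N+1}-u_n+\alpha\Big(\frac1{\prod_{j=1}^{N-1}u_{n+j}}-\frac1{\prod_{j=2}^{N}u_{n+j}}\Big)=0,\qquad(1)$$ and let $$\frac{v_n}{v_{n+P}}-\frac{v_{n-P}}{v_n}+\alpha^2\Big(\frac{v_{n+P-1}}{v_n}-\frac{v_n}{v_{n+1-P}}\Big)=0\qquad(2)$$ be the $(1,-P)$ periodic reduction of the discrete-time Toda equation. In terms of $\hat s_n=v_n/v_{n+1}$ it becomes $$\hat s_n\cdots\hat s_{n+P-1}-\hat s_{n-P}\cdots\hat s_{n-1}+\alpha^2\Big(\frac1{\hat s_n\cdots\hat s_{n+P-2}}-\frac1{\hat s_{n-P+1}\cdots\hat s_{n-1}}\Big)=0,\qquad(3)$$ which defines a map $\hat\chi:\mathbb C^N\to\mathbb C^N$, $(\hat s_0,\dots,\hat s_{N-1})\mapsto(\hat s_1,\dots,\hat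 s_N)$. Put $\gamma_n=\big(\prod_{j=0}^{N-1}u_{n+j}-\alpha\big)/\prod_{k=0}^{P-2}u_{n+2k+1}$, $\kappa(u)=\alpha^{-1}(1-\gamma_0\gamma_1)$, and let $\hat\pi_2:\mathbb C^{N+1}\to\mathbb C^N$, $\hat\pi_2(u)=(s_0,s_2,\dots,s_{2N-2})$ with $s_n=u_nu_{n+1}$, where the higher $u_n$ are obtained from (1). **Lax matrices.** With $p_n=\frac{\alpha v_n}{v_{n-P+1}}+\frac1\alpha\big(\frac{v_{n-P}}{v_n}-1\big)$ let $$L_n=\begin{pmatrix}p_n+\zeta&v_n\\-v_n^{-1}&0\end{pmatrix},\quad M_n=\begin{pmatrix}1-\alpha^2v_nv_{n-P+1}^{-1}-\alpha\zeta&-\alpha v_n\\ \alpha v_{n-P+1}^{-1}&1\end{pmatrix},\quad \mathcal M_n=(1-\alpha\zeta)M_n^{-1}L_{n-P+1}\cdots L_n .$$ For a second sequence $v'$, with matrices $L'_n,M'_n,\mathcal M'_n$, and a parameter $\kappa$ let $$G_n=\begin{pmatrix}\zeta+v'_n/v_{n+1}-\kappa&v'_n\\-v_{n+1}^{-1}&-1\end{pmatrix}.$$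 Nowhere zero sequences $v,v'$ are *related by $\mathrm{BT}_\kappa$* if $L_nG_n=G_{n-1}L'_n$ and $M_nG_n=G_{n-P}M'_n$ for all $n$ and $\zeta$. Points $s,s'\in\mathbb C^N$ are related by $\mathrm{BT}_\kappa$, with gauge variable $x$, if there are non-zero numbers $v_0,\dots,v_{2P}$ and $v'_0,\dots,v'_{2P-1}$ with $s_j=v_j/v_{j+1}$ and $s'_j=v'_j/v'_{j+1}$ for $0\le j<N$, such that (2) holds for $v$ at $n=P$, $L_nG_n=G_{n-1}L'_n$ for $P\le n\le 2P-1$, $M_{2P-1}G_{2P-1}=G_{P-1}M'_{2P-1}$, and $x=v'_{2P-1}/v_{2P}$. **Poisson structure** on $\mathbb C^N$: for $0\le i<j\le N-1$, $\{\hat s_i,\hat s_j\}$ is the sum of $\hat s_i\hat s_j$ if $j=i+1$, of $-2\hat s_i\hat s_j$ if $j=i+P-1$, of $2\hat s_i\hat s_j$ if $j=i+P$, and of $-\alpha^2/(\hat s_{i+1}\cdots\hat s_{i+N-2})$ if $j=i+N-1$ (zero if no case applies). **Theorem.** 1. *($\varphi$ is a Bäcklund transformation for (2).)* Let $u:\mathbb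 Z\to\mathbb C$ be a nowhere zero solution of (1), and $\tau$ nowhere zero with $u_n=\tau_{n+3}\tau_n/(\tau_{n+2}\tau_{n+1})$. Then $\gamma_{n+2}=\gamma_n$ for all $n$, and $v_n=\tau_{2n}/\tau_{2n+2}$ and $v'_n=\tau_{2n+1}/\tau_{2n+3}$ are solutions of (2) that are related by $\mathrm{BT}_{\kappa(u)}$. Conversely, if $v,v'$ are related by $\mathrm{BT}_\kappa$, then $u_{2n}=v_n/v'_n$, $u_{2n+1}=v'_n/v_{n+1}$ solves (1), $\kappa=\kappa(u)$, both $v$ and $v'$ solve (2), and for all $n$: $\mathcal M_nG_n=G_n\mathcal M'_n$, $\operatorname{tr}\mathcal M_n=\operatorname{tr}\mathcal M'_n$, and $(v_{n+1}^{-1},u_{2n+1})$ is a left eigenvector of $\mathcal M_n(\kappa)$ with an eigenvalue $\mu$ such that $\mu^2-\operatorname{tr}\mathcal M_n(\kappa)\,\mu+1-\alpha\kappa=0$. In finite dimension: $s,s'$ are related by $\mathrm{BT}_\kappa$ with gauge variable $x$ if and only if there is a point $u=(u_0,\dots,u_N)$ whose orbit under (1) satisfies $u_0,\dots,u_{2N+1}\ne0$,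 with $\kappa=\kappa(u)$, $x=u_{2N+1}$, $s=\hat\pi_2(u)$, $s'=\hat\pi_2(\varphi(u))$. 2. *(Correspondence between solutions of (3).)* If $s,s'$ are related by $\mathrm{BT}_\kappa$ and the entries of $\hat\chi(s')$ and $\hat\chi(\hat\chi(s))$ are non-zero, then $\hat\chi(s),\hat\chi(s')$ are related by $\mathrm{BT}_\kappa$. 3. *(2-valued.)* For $(\kappa,s)\in\mathbb C\times\mathbb C^N$ outside the zero set of some non-zero polynomial, there are a neighbourhood $W$ of $(\kappa,s)$ and holomorphic $x_1,x_2:W\to\mathbb C$, $\chi_1,\chi_2:W\to\mathbb C^N$ with $x_1\neq x_2$ and $\chi_1\ne\chi_2$ everywhere on $W$, such that for every $(\kappa,s)\in W$ the pairs $(x,s')$ with $s,s'$ related by $\mathrm{BT}_\kappa$ with gauge variable $x$ are exactly $(x_1,\chi_1)(\kappa,s)$ and $(x_2,\chi_2)(\kappa,s)$. 4. *(Poisson.)* For every fixed $\kappa$, every branch is a Poisson map: if $x$ is holomorphic on an open $U\subset\mathbb C^N$, and $s,\chi(s)$ are related by $\mathrm{BT}_\kappa$ with gauge variable $x(s)$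 for all $s\in U$, then $\chi$ is holomorphic and preserves the above bracket on $U$. 5. *(First integrals.)* If $s,s'$ are related by $\mathrm{BT}_\kappa$, then every coefficient of the polynomial $\operatorname{tr}\mathcal M_{2P-1}(\zeta)$, which is a function of $\hat s_0,\dots,\hat s_{N-1}$, takes the same value at $s$ and $s'$. 6. *(Commutative diagram.)* For $u_0\in\mathbb C^{N+1}$ outside the zero set of some non-zero polynomial, there are $W$ and branches as in 3 such that for all $u$ in a neighbourhood of $u_0$: $u$ is as at the end of 1, $(\kappa(u),\hat\pi_2(u))\in W$ and $\hat\pi_2(\varphi(u))=\chi_1(\kappa(u),\hat\pi_2(u))$; that is, $\hat\pi_2\circ\varphi=\chi_{BT}\circ\hat\pi_2$ for the branch $\chi_{BT}=\chi_1$. -/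

import Mathlib

open Polynomial Matrix
open scoped Topology

noncomputable section

namespace TodaBT

/-! ## Bi-infinite sequences: the two difference equations and the Lax matrices -/

/-- The equation of order `N + 1 = 2 P` satisfied by `u`, at position `n` (with `N = 2 P - 1`):
`u_{n+N+1} - u_n + α (1 / (u_{n+1} ⋯ u_{n+N-1}) - 1 / (u_{n+2} ⋯ u_{n+N})) = 0`. -/
def LiftedDTKQAt (α : ℂ) (P : ℕ) (u : ℤ → ℂ) (n : ℤ) : Prop :=
  u (n + 2 * P) - u n
    + α * (1 / (∏ j ∈ Finset.Icc 1 (2 * P - 2), u (n + (j : ℕ)))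
      - 1 / (∏ j ∈ Finset.Icc 2 (2 * P - 1), u (n + (j : ℕ)))) = 0

/-- The `(1, -P)` periodic reduction of the discrete time Toda equation, at position `n`. -/
def TodaAt (α : ℂ) (P : ℕ) (v : ℤ → ℂ) (n : ℤ) : Prop :=
  v n / v (n + P) - v (n - P) / v n
    + α ^ 2 * (v (n + P - 1) / v n - v n / v (n + 1 - P)) = 0

/-- The 2-periodic quantity
`γ_n = (u_n u_{n+1} ⋯ u_{n+N-1} - α) / (u_{n+1} u_{n+3} ⋯ u_{n+N-2})`, `N = 2 P - 1`. -/
def gam (α : ℂ) (P : ℕ) (u : ℤ → ℂ) (n : ℤ) : ℂ :=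
  ((∏ j ∈ Finset.range (2 * P - 1), u (n + (j : ℕ))) - α)
    / ∏ k ∈ Finset.range (P - 1), u (n + 2 * (k : ℕ) + 1)

/-- The Bäcklund parameter `κ = (1 - γ_0 γ_1) / α`. -/
def kappa (α : ℂ) (P : ℕ) (u : ℤ → ℂ) : ℂ :=
  (1 - gam α P u 0 * gam α P u 1) / α

/-- The entry `p_n` of the Lax matrix `L_n`. -/
def pCoef (α : ℂ) (P : ℕ) (v : ℤ → ℂ) (n : ℤ) : ℂ :=
  α * v n / v (n - P + 1) + (1 / α) * (v (n - P) / v n - 1)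

/-- The reduced Lax matrix `L_n`; the spectral parameter is the polynomial variable. -/
def laxL (α : ℂ) (P : ℕ) (v : ℤ → ℂ) (n : ℤ) : Matrix (Fin 2) (Fin 2) ℂ[X] :=
  !![C (pCoef α P v n) + X, C (v n); C (-(v n)⁻¹), 0]

/-- The reduced Lax matrix `M_n`. -/
def laxM (α : ℂ) (P : ℕ) (v : ℤ → ℂ) (n : ℤ) : Matrix (Fin 2) (Fin 2) ℂ[X] :=
  !![C (1 - α ^ 2 * v n * (v (n - P + 1))⁻¹) - C α * X, C (-(α * v n));
     C (α * (v (n - P + 1))⁻¹), 1]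

/-- `det M_n = 1 - α ζ`. -/
theorem det_laxM (α : ℂ) (P : ℕ) (v : ℤ → ℂ) (n : ℤ) :
    (laxM α P v n).det = 1 - C α * X := by
  simp only [laxM, Matrix.det_fin_two_of, map_sub, map_neg, map_mul, map_pow, map_one]
  ring

/-- The monodromy matrix `(1 - α ζ) M_n⁻¹ L_{n-P+1} ⋯ L_{n-1} L_n`. As `det M_n = 1 - α ζ`, the
factor `(1 - α ζ) M_n⁻¹` is the adjugate of `M_n`, which is polynomial in `ζ`. -/
def monodromy (α : ℂ) (P : ℕ) (v : ℤ → ℂ) (n : ℤ) : Matrix (Fin 2) (Fin 2) ℂ[X] :=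
  (laxM α P v n).adjugate
    * ((List.range P).map fun i : ℕ => laxL α P v (n - P + 1 + i)).prod

/-- The gauge matrix with parameter `κ` built from two sequences `v` ("even") and
`v'` ("odd"); here `v'_n / v_{n+1}` is the quantity `u_{2n+1}`. -/
def gauge (κ : ℂ) (v v' : ℤ → ℂ) (n : ℤ) : Matrix (Fin 2) (Fin 2) ℂ[X] :=
  !![X + C (v' n / v (n + 1) - κ), C (v' n); C (-(v (n + 1))⁻¹), -1]

/-- The gauge matrices intertwine the matrices `L_n` of `v` and `v'`. -/
def IntertwinesL (α : ℂ) (P : ℕ) (κ : ℂ) (v v' : ℤ → ℂ) (n : ℤ) : Prop :=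
  laxL α P v n * gauge κ v v' n = gauge κ v v' (n - 1) * laxL α P v' n

/-- The gauge matrices intertwine the matrices `M_n` of `v` and `v'`. -/
def IntertwinesM (α : ℂ) (P : ℕ) (κ : ℂ) (v v' : ℤ → ℂ) (n : ℤ) : Prop :=
  laxM α P v n * gauge κ v v' n = gauge κ v v' (n - P) * laxM α P v' n

/-- The Bäcklund transformation with parameter `κ` between bi-infinite sequences. -/
def SeqBT (α : ℂ) (P : ℕ) (κ : ℂ) (v v' : ℤ → ℂ) : Prop :=
  (∀ n, v n ≠ 0) ∧ (∀ n, v' n ≠ 0) ∧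
    ∀ n, IntertwinesL α P κ v v' n ∧ IntertwinesM α P κ v v' n

/-! ## The maps in finite dimension

A point of `ℂ^(N+1)` is a function on `Fin (2 * P)`, a point of `ℂ^N` a function on
`Fin (2 * P - 1)`. All maps are total; they have their meaning where no denominator vanishes. -/

/-- The `k`-th coordinate (and `0` out of range). -/
def coord {m : ℕ} (u : Fin m → ℂ) (k : ℕ) : ℂ := if h : k < m then u ⟨k, h⟩ else 0

/-- The map `φ : (u_0, …, u_N) ↦ (u_1, …, u_{N+1})`. -/
def phi (α : ℂ) (P : ℕ) (u : Fin (2 * P) → ℂ) : Fin (2 * P) → ℂ := fun j =>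
  if (j : ℕ) + 1 < 2 * P then coord u (j + 1)
  else coord u 0 - α * (1 / (∏ i ∈ Finset.Icc 1 (2 * P - 2), coord u i)
    - 1 / (∏ i ∈ Finset.Icc 2 (2 * P - 1), coord u i))

/-- The term `u_k` (`k ≥ 0`) of the orbit that starts from `u = (u_0, …, u_N)`. -/
def uTerm (α : ℂ) (P : ℕ) (u : Fin (2 * P) → ℂ) (k : ℕ) : ℂ := coord ((phi α P)^[k] u) 0

/-- The terms `u_0, …, u_{2N+1}` of the orbit do not vanish. -/
def Regular (α : ℂ) (P : ℕ) (u : Fin (2 * P) → ℂ) : Prop := ∀ k < 4 * P, uTerm α P u k ≠ 0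

/-- The value of the Bäcklund parameter `κ = (1 - γ_0 γ_1) / α` at a point of `ℂ^(N+1)`. -/
def kappaPt (α : ℂ) (P : ℕ) (u : Fin (2 * P) → ℂ) : ℂ :=
  kappa α P fun n : ℤ => uTerm α P u n.toNat

/-- The map `π̂₂ : ℂ^(N+1) → ℂ^N`, `u ↦ (s_0, s_2, …, s_{2N-2})` where `s_n = u_n u_{n+1}`.
(Its version for odd indices is `π̂₂ ∘ φ`.) -/
def piHat (α : ℂ) (P : ℕ) (u : Fin (2 * P) → ℂ) : Fin (2 * P - 1) → ℂ := fun j =>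
  uTerm α P u (2 * j) * uTerm α P u (2 * j + 1)

/-- The map `χ̂ : (s_0, …, s_{N-1}) ↦ (s_1, …, s_N)`, in which `s_N` is determined by
`s_P ⋯ s_{2P-1} - s_0 ⋯ s_{P-1} + α² (1 / (s_P ⋯ s_{2P-2}) - 1 / (s_1 ⋯ s_{P-1})) = 0`. -/
def chiHat (α : ℂ) (P : ℕ) (s : Fin (2 * P - 1) → ℂ) : Fin (2 * P - 1) → ℂ := fun j =>
  if (j : ℕ) + 1 < 2 * P - 1 then coord s (j + 1)
  else ((∏ i ∈ Finset.Icc 0 (P - 1), coord s i)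
      - α ^ 2 * (1 / (∏ i ∈ Finset.Icc P (2 * P - 2), coord s i)
        - 1 / (∏ i ∈ Finset.Icc 1 (P - 1), coord s i)))
    / ∏ i ∈ Finset.Icc P (2 * P - 2), coord s i

/-- Initial data `v_0 = 1, v_1, …, v_{2P-1}` with `v_j / v_{j+1} = s_j`. -/
def vOf {P : ℕ} (s : Fin (2 * P - 1) → ℂ) : ℤ → ℂ := fun n =>
  ∏ i ∈ Finset.range n.toNat, (coord s i)⁻¹

/-- The function of `s` that is the coefficient of `ζ^k` in the trace of the monodromy matrix.
The trace is unchanged when `v` is scaled, so the choice `v_0 = 1` does not matter. -/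
def traceIntegral (α : ℂ) (P : ℕ) (k : ℕ) (s : Fin (2 * P - 1) → ℂ) : ℂ :=
  (monodromy α P (vOf s) (2 * P - 1)).trace.coeff k

/-! ## The correspondence on `ℂ^N` and its branches -/

/-- The Bäcklund correspondence with parameter `κ` between points `s` and `s'` of `ℂ^N`.
There are initial data `v_0, …, v_{2P-1}` and `v'_0, …, v'_{2P-1}`, with ratios `s` and `s'`,
and `v_{2P}` given by the reduced Toda equation, which are related by the gauge matrices
`G_{P-1}, …, G_{2P-1}`. The number `x = v'_{2P-1} / v_{2P}` is the remaining entry `u_{4P-1}` of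
the gauge matrix, whose choice fixes `s'`. -/
def IsBT (α : ℂ) (P : ℕ) (κ x : ℂ) (s s' : Fin (2 * P - 1) → ℂ) : Prop :=
  ∃ v v' : ℤ → ℂ,
    (∀ n ∈ Set.Icc (0 : ℤ) (2 * P), v n ≠ 0) ∧
    (∀ n ∈ Set.Icc (0 : ℤ) (2 * P - 1), v' n ≠ 0) ∧
    (∀ j : Fin (2 * P - 1), s j = v (j : ℕ) / v ((j : ℕ) + 1)) ∧
    (∀ j : Fin (2 * P - 1), s' j = v' (j : ℕ) / v' ((j : ℕ) + 1)) ∧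
    TodaAt α P v P ∧
    (∀ n ∈ Set.Icc (P : ℤ) (2 * P - 1), IntertwinesL α P κ v v' n) ∧
    IntertwinesM α P κ v v' (2 * P - 1) ∧
    x = v' (2 * P - 1) / v (2 * P)

/-- On the open set `W` of pairs `(κ, s)` the correspondence is exactly two-valued: it consists of
two everywhere distinct branches `χ₁, χ₂`, that come from two everywhere distinct choices `x₁, x₂`
of the remaining entry of the gauge matrix; all these are holomorphic. -/
structure IsTwoValuedOn (α : ℂ) (P : ℕ) (W : Set (ℂ × (Fin (2 * P - 1) → ℂ)))
    (x₁ x₂ : ℂ × (Fin (2 * P - 1) → ℂ) → ℂ)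
    (χ₁ χ₂ : ℂ × (Fin (2 * P - 1) → ℂ) → Fin (2 * P - 1) → ℂ) : Prop where
  isOpen : IsOpen W
  holo_x₁ : DifferentiableOn ℂ x₁ W
  holo_x₂ : DifferentiableOn ℂ x₂ W
  holo_χ₁ : DifferentiableOn ℂ χ₁ W
  holo_χ₂ : DifferentiableOn ℂ χ₂ W
  x_ne : ∀ w ∈ W, x₁ w ≠ x₂ w
  χ_ne : ∀ w ∈ W, χ₁ w ≠ χ₂ w
  isBT_iff : ∀ w ∈ W, ∀ x s',
    IsBT α P w.1 x w.2 s' ↔ (x = x₁ w ∧ s' = χ₁ w) ∨ (x = x₂ w ∧ s' = χ₂ w)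

/-! ## The Poisson structure on `ℂ^N` -/

/-- The bracket `{s_i, s_j}` of coordinates for `i < j`: the sum of `s_i s_j` if `j = i + 1`, of
`-2 s_i s_j` if `j = i + P - 1`, of `2 s_i s_j` if `j = i + P`, and of
`-α² / (s_{i+1} ⋯ s_{i+N-2})` if `j = i + N - 1`. -/
def bracketUpper (α : ℂ) (P : ℕ) (s : Fin (2 * P - 1) → ℂ) (i j : Fin (2 * P - 1)) : ℂ :=
  (if (j : ℕ) = i + 1 then s i * s j else 0)
    + (if (j : ℕ) = i + (P - 1) then -2 * (s i * s j) else 0)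
    + (if (j : ℕ) = i + P then 2 * (s i * s j) else 0)
    + (if (j : ℕ) = i + (2 * P - 2) then
        -(α ^ 2 / ∏ k ∈ Finset.Icc ((i : ℕ) + 1) (i + (2 * P - 3)), coord s k) else 0)

/-- The Poisson tensor: the antisymmetric matrix of the brackets of the coordinates. -/
def poissonTensor (α : ℂ) (P : ℕ) (s : Fin (2 * P - 1) → ℂ) (i j : Fin (2 * P - 1)) : ℂ :=
  if i < j then bracketUpper α P s i j
  else if j < i then -bracketUpper α P s j i
  else 0

/-- The Poisson bracket `{f, g}` of two functions at the point `s`. -/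
def bracket (α : ℂ) (P : ℕ) (f g : (Fin (2 * P - 1) → ℂ) → ℂ) (s : Fin (2 * P - 1) → ℂ) : ℂ :=
  ∑ a, ∑ b, poissonTensor α P s a b
    * fderiv ℂ f s (Pi.single a 1) * fderiv ℂ g s (Pi.single b 1)

/-- `χ` is a Poisson map at `s`: it is differentiable there, and the pullback of the bracket of two
coordinates is the bracket of their pullbacks. -/
def IsPoissonAt (α : ℂ) (P : ℕ) (χ : (Fin (2 * P - 1) → ℂ) → Fin (2 * P - 1) → ℂ)
    (s : Fin (2 * P - 1) → ℂ) : Prop :=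
  DifferentiableAt ℂ χ s ∧
    ∀ i j, bracket α P (fun σ => χ σ i) (fun σ => χ σ j) s = poissonTensor α P (χ s) i j

end TodaBT

end

noncomputable section

namespace TodaBT

/-! ## Windows of consecutive terms and the basic relations between them -/

/-! Everything is reduced to one scalar recursion. Write `W_k` for the window `u_{k+1} ⋯
u_{k+2P-2}`. The product `γ_k γ_{k+1}` is an expression in `u_k`, `W_k`, `u_{k+2P-1}`, and `GamEq`
says that it equals `1 - α κ`. Adding `α` times equation (1) trades two terms of `GamEq` at `k` or
`k + 1` for two others and gives `LamEq` and `LatEq` at `k`. Since `u_{k+1} W_{k+1} = W_k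
u_{k+2P-1}`, the difference of `LatEq` and `GamEq` at `k`, and that of `LamEq` at `k` and `GamEq` at
`k + 1`, is again (1), cleared of denominators. So (1) propagates `GamEq` in both directions, and
conversely suitable pairs of relations force (1).

When `u` interlaces `v_n / v'_n` and `v'_n / v_{n+1}`, windows of even length telescope to ratios of
`v` or of `v'`. Intertwining of `L_n` then becomes two instances of `LamEq`, intertwining of `M_n`
one `GamEq` together with one equation (1) (`intertwinesL_iff_LamEq`, `intertwinesM_iff_GamEq`), and
the Toda equation is the difference of a `LamEq` and a `LatEq` (`todaAt_iff_of_LamEq`). This settles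
bi-infinite sequences. In finite dimension the same dictionary, with the descent
`lifted_and_GamEq_of_descent`, identifies the correspondence with stretches `w_0, …, w_{4P-1}` of
solutions of (1), called chains (`isBT_iff_exists_isChain`). Shifting a chain by two positions
realises `χ̂`. Conjugation of the monodromy by `G_n`, whose determinant is `κ - ζ`, gives the first
integrals; the rank drop at `ζ = κ` gives spectrality.

Two-valuedness: `κ` and `s` determine the products `w_{2n} w_{2n+1}` and the sums `w_{2n-1} +
w_{2n}`. Hence the odd terms obey a Riccati recursion starting from `x = w_{4P-1}`. Its
linearisation `linRec` is affine in `x`, and the remaining relation, `GamEq` at `2P - 1`, becomes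
the quadratic equation `quad` (`isBT_iff_quad`). All genericity conditions concern rational
functions, so they need only be verified at one point, `basePt`, where `linRec` has period two and
the quadratic is a multiple of `x² - 1`. Distinct `x` give distinct `s'` as soon as `s_0 ≠ s_1`
(`gauge_variable_unique`). For the commutative diagram the same argument is pulled back to the
alternating point `altPt`, and continuity of the gauge variable selects the branch.

Poisson property: pass to the logarithmic derivatives `t_n` of `v_0, …, v_{2P-1}`. The form `∑ d(A_k
+ B_k) ∧ d log v_{P+k}`, with `A_k`, `B_k` the quantities `aCoef`, `bCoef`, is nondegenerate there
(`eq_zero_of_symp`). A covector on the space of `s` is represented through it by a vector, and the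
Poisson tensor on two covectors is a second form, `rhoForm`, on the representing vectors
(`sum_poissonTensor_eq_rho`). Along a chain the sums `A_k + B_k` and the products `A_{k+1} B_k` are
expressed by even and odd terms of `w`, and the transformation only regroups the alternating
sequence of their differentials. Telescoping shows that both forms are preserved
(`FormData.omega_eq`, `FormData.rho_eq`), and therefore so is the tensor. -/

/-- The product `u_k u_{k+1} ⋯ u_{k+m-1}`. -/
def wprod (u : ℤ → ℂ) (k : ℤ) (m : ℕ) : ℂ := ∏ j ∈ Finset.range m, u (k + (j : ℕ))

@[simp] lemma wprod_zero (u : ℤ → ℂ) (k : ℤ) : wprod u k 0 = 1 := by simp [wprod]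

lemma wprod_succ (u : ℤ → ℂ) (k : ℤ) (m : ℕ) : wprod u k (m + 1) = wprod u k m * u (k + m) := by
  simp [wprod, Finset.prod_range_succ]

lemma wprod_succ' (u : ℤ → ℂ) (k : ℤ) (m : ℕ) :
    wprod u k (m + 1) = u k * wprod u (k + 1) m := by
  rw [wprod, Finset.prod_range_succ', mul_comm]
  simp only [wprod, Nat.cast_zero, add_zero]
  congr 1
  refine Finset.prod_congr rfl fun j _ => ?_
  congr 1; push_cast; ring

lemma wprod_ne_zero {u : ℤ → ℂ} {k : ℤ} {m : ℕ} (h : ∀ j, k ≤ j → j < k + m → u j ≠ 0) :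
    wprod u k m ≠ 0 :=
  Finset.prod_ne_zero_iff.2 fun j hj => h _ (by omega) (by have := Finset.mem_range.1 hj; omega)

lemma wprod_congr {u w : ℤ → ℂ} {k l : ℤ} {m : ℕ}
    (h : ∀ j : ℕ, j < m → u (k + j) = w (l + j)) : wprod u k m = wprod w l m :=
  Finset.prod_congr rfl fun j hj => h j (Finset.mem_range.1 hj)

lemma prod_Icc_eq_range {f : ℕ → ℂ} (a b : ℕ) :
    ∏ j ∈ Finset.Icc a b, f j = ∏ j ∈ Finset.range (b + 1 - a), f (a + j) := by
  have : Finset.Icc a b = Finset.Ico a (b + 1) := by ext; simp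
  rw [this, Finset.prod_Ico_eq_prod_range]

/-- The relation `γ_k γ_{k+1} = 1 - α κ`, expanded. -/
def GamEq (α : ℂ) (P : ℕ) (κ : ℂ) (u : ℤ → ℂ) (k : ℤ) : Prop :=
  1 - α * κ = u k * wprod u (k + 1) (2 * P - 2) * u (k + 2 * P - 1) - α * u k
    - α * u (k + 2 * P - 1) + α ^ 2 / wprod u (k + 1) (2 * P - 2)

/-- The relation between `u_k, …, u_{k+2P}` and `κ` encoded in the intertwining of `L`. -/
def LamEq (α : ℂ) (P : ℕ) (κ : ℂ) (u : ℤ → ℂ) (k : ℤ) : Prop :=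
  1 - α * κ = u k * wprod u (k + 1) (2 * P - 2) * u (k + 2 * P - 1) - α * u (k + 2 * P - 1)
    - α * u (k + 2 * P) + α ^ 2 / wprod u (k + 2) (2 * P - 2)

/-- The reflected version of `LamEq`. -/
def LatEq (α : ℂ) (P : ℕ) (κ : ℂ) (u : ℤ → ℂ) (k : ℤ) : Prop :=
  1 - α * κ = u (k + 1) * wprod u (k + 2) (2 * P - 2) * u (k + 2 * P) - α * u k
    - α * u (k + 1) + α ^ 2 / wprod u (k + 1) (2 * P - 2)

lemma lifted_iff {α : ℂ} {P : ℕ} (hP : 2 ≤ P) {u : ℤ → ℂ} {k : ℤ} :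
    LiftedDTKQAt α P u k ↔ u (k + 2 * P) - u k + α * (1 / wprod u (k + 1) (2 * P - 2)
      - 1 / wprod u (k + 2) (2 * P - 2)) = 0 := by
  unfold LiftedDTKQAt wprod
  rw [prod_Icc_eq_range, prod_Icc_eq_range]
  have h1 : 2 * P - 2 + 1 - 1 = 2 * P - 2 := by omega
  have h2 : 2 * P - 1 + 1 - 2 = 2 * P - 2 := by omega
  rw [h1, h2]
  push_cast
  simp only [add_assoc]

lemma wprod_swap {P : ℕ} (hP : 2 ≤ P) (u : ℤ → ℂ) (k : ℤ) :
    u (k + 1) * wprod u (k + 2) (2 * P - 2)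
      = wprod u (k + 1) (2 * P - 2) * u (k + 2 * P - 1) := by
  have h1 := wprod_succ u (k + 1) (2 * P - 2)
  have h2 := wprod_succ' u (k + 1) (2 * P - 2)
  rw [h1] at h2
  have e1 : k + 1 + ((2 * P - 2 : ℕ) : ℤ) = k + 2 * P - 1 := by omega
  have e2 : k + 1 + 1 = k + 2 := by ring
  rw [e1, e2] at h2
  exact h2.symm

/-! ### Three forms of the conserved quantity and their equivalence modulo equation (1) -/

section Relations

variable {α : ℂ} {P : ℕ} {κ : ℂ} {u : ℤ → ℂ} {k : ℤ}

/-- The products over the two windows of length `2 P - 2` that occur at position `k` are non-zero. -/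
def WinNe (P : ℕ) (u : ℤ → ℂ) (k : ℤ) : Prop := ∀ j, k < j → j < k + 2 * P → u j ≠ 0

lemma WinNe.left (h : WinNe P u k) (hP : 2 ≤ P) : wprod u (k + 1) (2 * P - 2) ≠ 0 :=
  wprod_ne_zero fun j h1 h2 => h j (by omega) (by omega)

lemma WinNe.right (h : WinNe P u k) (hP : 2 ≤ P) : wprod u (k + 2) (2 * P - 2) ≠ 0 :=
  wprod_ne_zero fun j h1 h2 => h j (by omega) (by omega)

lemma WinNe.fst (h : WinNe P u k) (hP : 2 ≤ P) : u (k + 1) ≠ 0 := h _ (by omega) (by omega)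

/-- The prefactor is the product of all `2P - 1` terms covered by the two windows, so each
reciprocal leaves a single end term. This turns (1) into its polynomial form. -/
lemma inv_sub_inv_window (h : WinNe P u k) (hP : 2 ≤ P) :
    u (k + 1) * wprod u (k + 2) (2 * P - 2)
      * (1 / wprod u (k + 1) (2 * P - 2) - 1 / wprod u (k + 2) (2 * P - 2))
      = u (k + 2 * P - 1) - u (k + 1) := by
  have h1 := h.left hP
  have h2 := h.right hP
  have e := wprod_swap hP u k
  rw [mul_sub, mul_one_div, mul_one_div]
  congr 1
  · rw [e]; field_simp
  · field_simp

lemma shift_GamEq :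
    GamEq α P κ u (k + 1) ↔ 1 - α * κ = u (k + 1) * wprod u (k + 2) (2 * P - 2) * u (k + 2 * P)
      - α * u (k + 1) - α * u (k + 2 * P) + α ^ 2 / wprod u (k + 2) (2 * P - 2) := by
  unfold GamEq
  have e1 : k + 1 + 1 = k + 2 := by ring
  have e2 : k + 1 + 2 * (P : ℤ) - 1 = k + 2 * P := by ring
  rw [e1, e2]

lemma LamEq_of_GamEq (hP : 2 ≤ P) (hE : LiftedDTKQAt α P u k) (hG : GamEq α P κ u k) :
    LamEq α P κ u k := by
  rw [lifted_iff hP] at hE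
  unfold GamEq at hG; unfold LamEq
  rw [hG]; linear_combination α * hE

lemma LatEq_of_GamEq (hP : 2 ≤ P) (hE : LiftedDTKQAt α P u k) (hG : GamEq α P κ u (k + 1)) :
    LatEq α P κ u k := by
  rw [lifted_iff hP] at hE
  rw [shift_GamEq] at hG; unfold LatEq
  rw [hG]; linear_combination -α * hE

lemma GamEq_of_LatEq (hP : 2 ≤ P) (hE : LiftedDTKQAt α P u k) (hG : LatEq α P κ u k) :
    GamEq α P κ u (k + 1) := by
  rw [lifted_iff hP] at hE
  rw [shift_GamEq]; unfold LatEq at hG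
  rw [hG]; linear_combination α * hE

/-- At the same position the two relations share `-α u_k` and `α² / W_k`; what remains of their
difference is (1) in polynomial form. -/
lemma LatEq_of_GamEq_of_lifted (hP : 2 ≤ P) (hk : WinNe P u k) (hE : LiftedDTKQAt α P u k)
    (hG : GamEq α P κ u k) : LatEq α P κ u k := by
  have h3 := inv_sub_inv_window hk hP
  rw [lifted_iff hP] at hE
  unfold GamEq at hG; unfold LatEq
  have e := wprod_swap hP u k
  linear_combination hG - (u (k + 1) * wprod u (k + 2) (2 * P - 2)) * hE
    - u k * e + α * h3

lemma GamEq_succ (hP : 2 ≤ P) (hk : WinNe P u k) (hE : LiftedDTKQAt α P u k)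
    (hG : GamEq α P κ u k) : GamEq α P κ u (k + 1) :=
  GamEq_of_LatEq hP hE (LatEq_of_GamEq_of_lifted hP hk hE hG)

lemma GamEq_pred (hP : 2 ≤ P) (hk : WinNe P u k) (hE : LiftedDTKQAt α P u k)
    (hG : GamEq α P κ u (k + 1)) : GamEq α P κ u k := by
  have hL := LatEq_of_GamEq hP hE hG
  have h3 := inv_sub_inv_window hk hP
  rw [lifted_iff hP] at hE
  unfold GamEq; unfold LatEq at hL
  have e := wprod_swap hP u k
  linear_combination hL + (u (k + 1) * wprod u (k + 2) (2 * P - 2)) * hE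
    + u k * e - α * h3

/-- The equation of order `2 P` from the difference of two relations. -/
lemma lifted_of_sub (hP : 2 ≤ P) (hk : WinNe P u k)
    (h : u (k + 1) * wprod u (k + 2) (2 * P - 2) * (u (k + 2 * P) - u k)
      + α * (u (k + 2 * P - 1) - u (k + 1)) = 0) : LiftedDTKQAt α P u k := by
  rw [lifted_iff hP]
  have h3 := inv_sub_inv_window hk hP
  have h1 : u (k + 1) * wprod u (k + 2) (2 * P - 2) ≠ 0 :=
    mul_ne_zero (hk.fst hP) (hk.right hP)
  apply mul_left_cancel₀ h1
  linear_combination h + α * h3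

/-- The terms `-α u_{k+2P}` and `α² / W_{k+1}` are common to the two relations, so subtracting them
leaves (1) in polynomial form. -/
lemma lifted_of_LamEq (hP : 2 ≤ P) (hk : WinNe P u k)
    (hG : GamEq α P κ u (k + 1)) (hL : LamEq α P κ u k) : LiftedDTKQAt α P u k := by
  apply lifted_of_sub hP hk
  rw [shift_GamEq] at hG; unfold LamEq at hL
  linear_combination hL - hG - u k * wprod_swap hP u k

lemma lifted_of_LatEq (hP : 2 ≤ P) (hk : WinNe P u k)
    (hG : GamEq α P κ u k) (hL : LatEq α P κ u k) : LiftedDTKQAt α P u k := by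
  apply lifted_of_sub hP hk
  unfold LatEq at hL; unfold GamEq at hG
  linear_combination hG - hL - u k * wprod_swap hP u k

lemma lifted_of_LatEq_succ (hP : 2 ≤ P) (hα : α ≠ 0)
    (hG : GamEq α P κ u (k + 1)) (hL : LatEq α P κ u k) : LiftedDTKQAt α P u k := by
  rw [lifted_iff hP]
  rw [shift_GamEq] at hG; unfold LatEq at hL
  apply mul_left_cancel₀ hα
  linear_combination hG - hL

/-- The numerator and denominator of `γ_n`. -/
lemma gam_eq (hP : 2 ≤ P) : gam α P u k = (u k * wprod u (k + 1) (2 * P - 2) - α)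
    / ∏ j ∈ Finset.range (P - 1), u (k + 2 * (j : ℕ) + 1) := by
  have e : 2 * P - 1 = 2 * P - 2 + 1 := by omega
  rw [gam, e]
  change (wprod u k _ - α) / _ = _
  rw [wprod_succ']

lemma wprod_even_odd (u : ℤ → ℂ) (k : ℤ) (p : ℕ) :
    (∏ j ∈ Finset.range p, u (k + 2 * (j : ℕ) + 1))
      * (∏ j ∈ Finset.range p, u (k + 1 + 2 * (j : ℕ) + 1)) = wprod u (k + 1) (2 * p) := by
  induction p with
  | zero => simp
  | succ p ih =>
    rw [Finset.prod_range_succ, Finset.prod_range_succ, Nat.mul_succ, wprod_succ, wprod_succ, ← ih]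
    have e1 : k + 1 + ((2 * p : ℕ) : ℤ) = k + 2 * (p : ℕ) + 1 := by push_cast; ring
    have e2 : k + 1 + ((2 * p + 1 : ℕ) : ℤ) = k + 1 + 2 * (p : ℕ) + 1 := by push_cast; ring
    rw [e1, e2]; ring

/-- The two denominators consist of every other term, with opposite parity, and together fill the
window `W_k`. -/
lemma gam_mul_gam (hP : 2 ≤ P) (hne : ∀ j, k < j → j < k + 2 * P - 1 → u j ≠ 0) :
    gam α P u k * gam α P u (k + 1) = u k * wprod u (k + 1) (2 * P - 2) * u (k + 2 * P - 1)
      - α * u k - α * u (k + 2 * P - 1) + α ^ 2 / wprod u (k + 1) (2 * P - 2) := by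
  have h1 : wprod u (k + 1) (2 * P - 2) ≠ 0 :=
    wprod_ne_zero fun j h1 h2 => hne j (by omega) (by omega)
  have e := wprod_swap hP u k
  rw [gam_eq hP, gam_eq hP, div_mul_div_comm, wprod_even_odd]
  have e1 : 2 * (P - 1) = 2 * P - 2 := by omega
  have e2 : k + 1 + 1 = k + 2 := by ring
  rw [e1, e2, e]
  field_simp
  ring

lemma GamEq_iff_gam (hP : 2 ≤ P) (hne : ∀ j, k < j → j < k + 2 * P - 1 → u j ≠ 0) :
    GamEq α P κ u k ↔ gam α P u k * gam α P u (k + 1) = 1 - α * κ := by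
  rw [gam_mul_gam hP hne, GamEq, eq_comm]

lemma GamEq_zero_iff_kappa (hP : 2 ≤ P) (hα : α ≠ 0) (hne : ∀ j, 0 < j → j < 2 * (P : ℤ) - 1 → u j ≠ 0) :
    GamEq α P κ u 0 ↔ κ = kappa α P u := by
  rw [GamEq_iff_gam hP (by simpa using hne), kappa, eq_div_iff hα, zero_add]
  constructor <;> intro h <;> linear_combination h

/-- The denominators `O` and `O'` satisfy `u_{k+1} O' = O u_{k+2P-1}`. With this, the
cross-multiplied identity is a multiple of (1). -/
lemma gam_add_two (hP : 2 ≤ P) (hk : WinNe P u k) (hE : LiftedDTKQAt α P u k) :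
    gam α P u (k + 2) = gam α P u k := by
  have h3 := inv_sub_inv_window hk hP
  have e := wprod_swap hP u k
  have e' : u (k + 2) * wprod u (k + 2 + 1) (2 * P - 2)
      = wprod u (k + 2) (2 * P - 2) * u (k + 2 * P) := by
    have := wprod_swap hP u (k + 1)
    rw [show k + 1 + 1 = k + 2 by ring, show k + 1 + 2 = k + 2 + 1 by ring,
      show k + 1 + 2 * (P : ℤ) - 1 = k + 2 * P by ring] at this
    exact this
  rw [lifted_iff hP] at hE
  rw [gam_eq hP, gam_eq hP, e']
  obtain ⟨p, rfl⟩ : ∃ p, P = p + 1 := ⟨P - 1, by omega⟩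
  simp only [Nat.add_sub_cancel] at *
  set O := ∏ j ∈ Finset.range p, u (k + 2 * (j : ℕ) + 1) with hO
  set O' := ∏ j ∈ Finset.range p, u (k + 2 + 2 * (j : ℕ) + 1) with hO'
  have hOO : u (k + 1) * O' = O * u (k + 2 * (p + 1 : ℕ) - 1) := by
    have h1 := Finset.prod_range_succ (fun j : ℕ => u (k + 2 * (j : ℕ) + 1)) p
    have h2 := Finset.prod_range_succ' (fun j : ℕ => u (k + 2 * (j : ℕ) + 1)) p
    rw [h1] at h2
    have e1 : k + 2 * (p : ℤ) + 1 = k + 2 * (p + 1 : ℕ) - 1 := by push_cast; ring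
    rw [e1] at h2
    rw [hO, h2, mul_comm]
    simp only [Nat.cast_zero, mul_zero, add_zero]
    congr 1
    refine Finset.prod_congr rfl fun j _ => ?_
    congr 1; push_cast; ring
  have hOne : O ≠ 0 := Finset.prod_ne_zero_iff.2 fun j hj =>
    hk _ (by omega) (by have := Finset.mem_range.1 hj; push_cast; omega)
  have hOne' : O' ≠ 0 := Finset.prod_ne_zero_iff.2 fun j hj =>
    hk _ (by omega) (by have := Finset.mem_range.1 hj; push_cast; omega)
  have hb := hk.fst hP
  rw [div_eq_div_iff hOne' hOne]
  apply mul_left_cancel₀ hb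
  linear_combination (O * u (k + 1) * wprod u (k + 2) (2 * (p + 1) - 2)) * hE - O * α * h3
    + (O * u k - 0) * e - (u k * wprod u (k + 1) (2 * (p + 1) - 2) - α) * hOO

end Relations

/-! ## Intertwining relations as scalar equations -/

/-- Each off-diagonal entry carries one scalar equation, visible already at `ζ = 0`. The lower right
entries agree identically, and the upper left ones agree as a consequence of the two equations. -/
lemma intertwinesL_iff {α κ : ℂ} {P : ℕ} {v v' : ℤ → ℂ} {n : ℤ} (h1 : v n ≠ 0) (h2 : v' n ≠ 0)
    (h3 : v (n + 1) ≠ 0) :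
    IntertwinesL α P κ v v' n ↔ pCoef α P v n = v' (n - 1) / v n + v n / v' n - κ ∧
      pCoef α P v' n = v n / v' n + v' n / v (n + 1) - κ := by
  unfold IntertwinesL laxL gauge
  have e : n - 1 + 1 = n := by ring
  rw [Matrix.mul_fin_two, Matrix.mul_fin_two, e]
  constructor
  · intro h
    have h01 := congrArg (Polynomial.eval 0) (congrFun (congrFun h 0) 1)
    have h10 := congrArg (Polynomial.eval 0) (congrFun (congrFun h 1) 0)
    simp only [of_apply, cons_val', cons_val_zero, cons_val_one, cons_val_fin_one, eval_add,
      eval_mul, eval_C, eval_X, eval_neg, eval_one, eval_zero] at h01 h10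
    constructor
    · field_simp
      field_simp at h01
      linear_combination h01
    · field_simp
      field_simp at h10
      linear_combination h10
  · rintro ⟨ha, hb⟩
    rw [ha, hb]
    have d1 : (C (v n)⁻¹ : ℂ[X]) * C (v n) = 1 := by rw [← C_mul, inv_mul_cancel₀ h1, C_1]
    have d2 : (C (v' n)⁻¹ : ℂ[X]) * C (v' n) = 1 := by rw [← C_mul, inv_mul_cancel₀ h2, C_1]
    have d3 : (C (v (n + 1))⁻¹ : ℂ[X]) * C (v (n + 1)) = 1 := by
      rw [← C_mul, inv_mul_cancel₀ h3, C_1]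
    ext i j : 1
    fin_cases i <;> fin_cases j <;>
      simp only [Fin.mk_zero, Fin.mk_one, Fin.isValue, of_apply, cons_val',
        cons_val_zero, cons_val_one, cons_val_fin_one, div_eq_mul_inv, C_add, C_sub, C_mul, C_neg]
    · linear_combination (C (v n) * C (v (n+1))⁻¹) * d2 - (C (v' (n - 1)) * C (v' n)⁻¹) * d1
    · linear_combination (C (v n)) * d2
    · linear_combination C (v' n)⁻¹ * d1
    · ring

/-- The three equations are the two off-diagonal entries and the coefficient of `ζ` in the upper
left entry. The `ζ²` coefficients agree identically; that the constant terms agree is the only real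
computation. -/
lemma intertwinesM_iff {α κ : ℂ} {P : ℕ} {v v' : ℤ → ℂ} {n : ℤ} (hα : α ≠ 0) (h1 : v n ≠ 0)
    (h2 : v' n ≠ 0) (h3 : v (n + 1) ≠ 0) (h4 : v (n - P + 1) ≠ 0) (h5 : v' (n - P + 1) ≠ 0) :
    IntertwinesM α P κ v v' n ↔
      1 - α * κ = v' (n - P) / v' n - α * (v' (n - P) / v (n - P + 1)) - α * (v n / v' n)
        + α ^ 2 * (v n / v (n - P + 1)) ∧
      1 - α * κ = v (n - P + 1) / v (n + 1) - α * (v (n - P + 1) / v' (n - P + 1))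
        - α * (v' n / v (n + 1)) + α ^ 2 * (v' n / v' (n - P + 1)) ∧
      α * (v n / v (n - P + 1)) + v' n / v (n + 1)
        = α * (v' n / v' (n - P + 1)) + v' (n - P) / v (n - P + 1) := by
  unfold IntertwinesM laxM gauge
  rw [Matrix.mul_fin_two, Matrix.mul_fin_two]
  have d1 : (C (v n)⁻¹ : ℂ[X]) * C (v n) = 1 := by rw [← C_mul, inv_mul_cancel₀ h1, C_1]
  have d2 : (C (v' n)⁻¹ : ℂ[X]) * C (v' n) = 1 := by rw [← C_mul, inv_mul_cancel₀ h2, C_1]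
  have d3 : (C (v (n + 1))⁻¹ : ℂ[X]) * C (v (n + 1)) = 1 := by
    rw [← C_mul, inv_mul_cancel₀ h3, C_1]
  have d4 : (C (v (n - P + 1))⁻¹ : ℂ[X]) * C (v (n - P + 1)) = 1 := by
    rw [← C_mul, inv_mul_cancel₀ h4, C_1]
  have d5 : (C (v' (n - P + 1))⁻¹ : ℂ[X]) * C (v' (n - P + 1)) = 1 := by
    rw [← C_mul, inv_mul_cancel₀ h5, C_1]
  constructor
  · intro h
    have h01 := congrArg (Polynomial.eval 0) (congrFun (congrFun h 0) 1)
    have h10 := congrArg (Polynomial.eval 0) (congrFun (congrFun h 1) 0)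
    have h00 := congrFun (congrFun h 0) 0
    have k0 := congrArg (Polynomial.eval 0) h00
    -- The entry is quadratic in `ζ`, so half the difference of its values at `1` and `-1` is the
    -- coefficient of `ζ`.
    have k1 := congrArg (Polynomial.eval 1) h00
    have k2 := congrArg (Polynomial.eval (-1)) h00
    simp only [of_apply, cons_val', cons_val_zero, cons_val_one, cons_val_fin_one, eval_add,
      eval_mul, eval_C, eval_X, eval_neg, eval_one, eval_sub] at h01 h10 k0 k1 k2
    refine ⟨?_, ?_, ?_⟩
    · field_simp
      field_simp at h01
      linear_combination h01
    · field_simp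
      field_simp at h10
      linear_combination h10
    · apply mul_left_cancel₀ hα
      rw [div_eq_mul_inv (v n), div_eq_mul_inv (v' n) (v' _)]
      linear_combination -(k1 - k2) / 2
  · rintro ⟨ha, hb, hc⟩
    have key : (1 - α ^ 2 * v n * (v (n - P + 1))⁻¹) * (v' n / v (n + 1) - κ)
        + α * v n / v (n + 1) = (v' (n - P) / v (n - P + 1) - κ) *
          (1 - α ^ 2 * v' n * (v' (n - P + 1))⁻¹) + α * v' (n - P) / v' (n - P + 1) := by
      apply mul_left_cancel₀ hα
      have hq : α ^ 2 * (v n / v (n - P + 1)) ≠ 0 := by positivity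
      -- In the parameters `t, q, q', e` the first relation reads `α κ = 1 - e t`, the third one `α
      -- v'_n / v_{n+1} = q' - e`, and the equality of the constant terms becomes a polynomial
      -- identity.
      set t : ℂ := 1 - v (n - P + 1) / (α * v' n) with ht
      set q := α ^ 2 * (v n / v (n - P + 1)) with hq
      set q' := α ^ 2 * (v' n / v' (n - P + 1)) with hq'
      set e := q - α * (v' (n - P) / v (n - P + 1)) with he
      have r1 : α * (v n / v' n) = q * (1 - t) := by rw [ht, hq]; field_simp; ring
      have r2 : α * (v (n - P + 1) / v' (n - P + 1)) = q' * (1 - t) := by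
        rw [ht, hq']; field_simp; ring
      have r3 : α * (v' n / v (n + 1)) = q' - e := by
        rw [he, hq', hq]; linear_combination α * hc
      have r4 : α * (v' (n - P) / v (n - P + 1)) = q - e := by rw [he]; ring
      have r5 : α * κ = 1 - e * t := by
        have : v' (n - P) / v' n = (q - e) * (1 - t) := by
          rw [← r4, ht]; field_simp; ring
        rw [this, r1, r4] at ha
        linear_combination -ha
      have s1 : α ^ 2 * v n * (v (n - P + 1))⁻¹ = q := by rw [hq]; field_simp
      have s2 : α ^ 2 * v' n * (v' (n - P + 1))⁻¹ = q' := by rw [hq']; field_simp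
      have s3 : α * (α * v n / v (n + 1)) = q * (1 - t) * (q' - e) := by
        rw [← r1, ← r3]; field_simp
      have s4 : α * (α * v' (n - P) / v' (n - P + 1)) = (q - e) * (q' * (1 - t)) := by
        rw [← r2, ← r4]; field_simp
      rw [s1, s2]
      linear_combination (1 - q) * r3 + s3 - (1 - q') * r4 - s4 + (q - q') * r5
    have ha' := congrArg C ha
    have hb' := congrArg C hb
    have hc' := congrArg C hc
    have hk' := congrArg C key
    ext i j : 1
    fin_cases i <;> fin_cases j <;>
      simp only [Fin.mk_zero, Fin.mk_one, Fin.isValue, of_apply, cons_val',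
        cons_val_zero, cons_val_one, cons_val_fin_one, div_eq_mul_inv, C_add, C_sub, C_mul, C_neg,
        C_1, C_pow] at ha' hb' hc' hk' ⊢
    · linear_combination hk' - (C α * X) * hc'
    · linear_combination (C (v' n)) * ha' + (C (v' (n - P)) - C α * C (v n)) * d2
    · linear_combination (C (v (n - P + 1))⁻¹) * hb' + (C (v (n + 1))⁻¹ - C α * C (v' (n - P + 1))⁻¹) * d4
    · ring

/-! ## Pairs of sequences and their interlacing -/

/-- On the range of indices from `a` to `b` the sequences `v, v'` do not vanish and
`u_{2j} = v_j / v'_j`, `u_{2j+1} = v'_j / v_{j+1}`. -/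
structure Interlaced (v v' u : ℤ → ℂ) (a b : ℤ) : Prop where
  ne : ∀ j, a ≤ j → j ≤ b → v j ≠ 0
  ne' : ∀ j, a ≤ j → j ≤ b → v' j ≠ 0
  even : ∀ j, a ≤ j → j ≤ b → u (2 * j) = v j / v' j
  odd : ∀ j, a ≤ j → j < b → u (2 * j + 1) = v' j / v (j + 1)

namespace Interlaced

variable {v v' u : ℤ → ℂ} {a b : ℤ}

lemma mono (h : Interlaced v v' u a b) {a' b' : ℤ} (ha : a ≤ a') (hb : b' ≤ b) :
    Interlaced v v' u a' b' :=
  ⟨fun j h1 h2 => h.ne j (by omega) (by omega), fun j h1 h2 => h.ne' j (by omega) (by omega),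
    fun j h1 h2 => h.even j (by omega) (by omega), fun j h1 h2 => h.odd j (by omega) (by omega)⟩

lemma u_ne (h : Interlaced v v' u a b) {j : ℤ} (h1 : 2 * a ≤ j) (h2 : j ≤ 2 * b) : u j ≠ 0 := by
  obtain ⟨i, rfl | rfl⟩ := Int.even_or_odd' j
  · rw [h.even i (by omega) (by omega)]
    exact div_ne_zero (h.ne _ (by omega) (by omega)) (h.ne' _ (by omega) (by omega))
  · rw [h.odd i (by omega) (by omega)]
    exact div_ne_zero (h.ne' _ (by omega) (by omega)) (h.ne _ (by omega) (by omega))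

/-- `u_{2j} u_{2j+1} = v_j / v_{j+1}`, so the product telescopes. -/
lemma wprod_even (h : Interlaced v v' u a b) (m : ℕ) {n : ℤ} (hn : a ≤ n) (hm : n + m ≤ b) :
    wprod u (2 * n) (2 * m) = v n / v (n + m) := by
  induction m with
  | zero => simp [h.ne n hn (by omega)]
  | succ m ih =>
    have h1 : 2 * n + ((2 * m : ℕ) : ℤ) = 2 * (n + m) := by push_cast; ring
    have h2 : 2 * n + ((2 * m + 1 : ℕ) : ℤ) = 2 * (n + m) + 1 := by push_cast; ring
    have h3 : n + ((m + 1 : ℕ) : ℤ) = n + m + 1 := by push_cast; ring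
    rw [Nat.mul_succ, wprod_succ, wprod_succ, ih (by omega), h1, h2, h.even _ (by omega) (by omega),
      h.odd _ (by omega) (by omega), h3]
    have := h.ne (n + m) (by omega) (by omega)
    have := h.ne' (n + m) (by omega) (by omega)
    field_simp

lemma wprod_odd (h : Interlaced v v' u a b) (m : ℕ) {n : ℤ} (hn : a ≤ n) (hm : n + m ≤ b) :
    wprod u (2 * n + 1) (2 * m) = v' n / v' (n + m) := by
  induction m with
  | zero => simp [h.ne' n hn (by omega)]
  | succ m ih =>
    have h1 : 2 * n + 1 + ((2 * m : ℕ) : ℤ) = 2 * (n + m) + 1 := by push_cast; ring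
    have h2 : 2 * n + 1 + ((2 * m + 1 : ℕ) : ℤ) = 2 * (n + m + 1) := by push_cast; ring
    have h3 : n + ((m + 1 : ℕ) : ℤ) = n + m + 1 := by push_cast; ring
    rw [Nat.mul_succ, wprod_succ, wprod_succ, ih (by omega), h1, h2, h.even _ (by omega) (by omega),
      h.odd _ (by omega) (by omega), h3]
    have := h.ne (n + m + 1) (by omega) (by omega)
    have := h.ne' (n + m) (by omega) (by omega)
    field_simp

lemma odd' (h : Interlaced v v' u a b) {i : ℤ} (j : ℤ) {k : ℤ} (h1 : a ≤ j) (hi : i = 2 * j + 1)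
    (hk : k = j + 1 ∧ j < b) : u i = v' j / v k := by
  rw [hi, hk.1]; exact h.odd j h1 hk.2

/-- Interlacing with the roles of the two sequences exchanged. -/
lemma shift_right (h : Interlaced v v' u a b) (hn : v (b + 1) ≠ 0)
    (hu : u (2 * b + 1) = v' b / v (b + 1)) :
    Interlaced v' (fun n => v (n + 1)) (fun n => u (n + 1)) a b := by
  refine ⟨h.ne', fun j h1 h2 => ?_, fun j h1 h2 => ?_, fun j h1 h2 => ?_⟩
  · rcases h2.lt_or_eq with h3 | rfl
    · exact h.ne _ (by omega) (by omega)
    · exact hn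
  · rcases h2.lt_or_eq with h3 | rfl
    · exact h.odd _ (by omega) (by omega)
    · exact hu
  · have := h.even (j + 1) (by omega) (by omega)
    rw [show 2 * (j + 1) = 2 * j + 1 + 1 by ring] at this
    exact this

end Interlaced

lemma wprod_shift (u : ℤ → ℂ) (k : ℤ) (m : ℕ) :
    wprod (fun n => u (n + 1)) k m = wprod u (k + 1) m :=
  wprod_congr fun j _ => by congr 1; ring

section

variable {α κ : ℂ} {P : ℕ} {u v v' : ℤ → ℂ}

lemma LamEq_shift {k : ℤ} : LamEq α P κ (fun n => u (n + 1)) k ↔ LamEq α P κ u (k + 1) := by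
  unfold LamEq
  rw [wprod_shift, wprod_shift]
  ring_nf

lemma GamEq_shift {k : ℤ} : GamEq α P κ (fun n => u (n + 1)) k ↔ GamEq α P κ u (k + 1) := by
  unfold GamEq
  rw [wprod_shift]
  ring_nf

lemma LatEq_shift {k : ℤ} : LatEq α P κ (fun n => u (n + 1)) k ↔ LatEq α P κ u (k + 1) := by
  unfold LatEq
  rw [wprod_shift, wprod_shift]
  ring_nf

lemma mul_wprod_mul (hP : 2 ≤ P) (k : ℤ) :
    u k * wprod u (k + 1) (2 * P - 2) * u (k + 2 * P - 1) = wprod u k (2 * P) := by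
  obtain ⟨p, rfl⟩ : ∃ p, P = p + 1 := ⟨P - 1, by omega⟩
  rw [show 2 * (p + 1) - 2 = 2 * p by omega, show 2 * (p + 1) = 2 * p + 1 + 1 by ring, wprod_succ,
    wprod_succ']
  congr 2; push_cast; ring

/-- After telescoping, the products in `LamEq` are `v_{n-P} / v_n` and `v_{n-P+1} / v_n`, and these
assemble to `α p_n + 1`. -/
lemma LamEq_even_iff (hP : 2 ≤ P) (hα : α ≠ 0) {n : ℤ} (h : Interlaced v v' u (n - P) n) :
    LamEq α P κ u (2 * (n - P)) ↔ pCoef α P v n = u (2 * n - 1) + u (2 * n) - κ := by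
  unfold LamEq pCoef
  have e1 := h.wprod_even P le_rfl (by omega)
  have e2 := h.wprod_even (n := n - P + 1) (P - 1) (by omega) (by omega)
  rw [mul_wprod_mul hP, e1, show 2 * P - 2 = 2 * (P - 1) by omega,
    show 2 * (n - (P : ℤ)) + 2 = 2 * (n - P + 1) by ring, e2,
    show n - (P : ℤ) + P = n by ring, show n - (P : ℤ) + 1 + (P - 1 : ℕ) = n by omega,
    show 2 * (n - (P : ℤ)) + 2 * P - 1 = 2 * n - 1 by ring,
    show 2 * (n - (P : ℤ)) + 2 * P = 2 * n by ring]
  have h1 := h.ne n (by omega) le_rfl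
  have h2 := h.ne (n - P + 1) (by omega) (by omega)
  have h3 := h.ne (n - P) (by omega) (by omega)
  rw [div_div_eq_mul_div]
  constructor <;> intro hh
  · apply mul_left_cancel₀ hα
    have : α * (α * v n / v (n - P + 1) + 1 / α * (v (n - P) / v n - 1))
      = α ^ 2 * v n / v (n - P + 1) + (v (n - P) / v n - 1) := by field_simp
    rw [this]; linear_combination -hh
  · have : α * (α * v n / v (n - P + 1) + 1 / α * (v (n - P) / v n - 1))
      = α ^ 2 * v n / v (n - P + 1) + (v (n - P) / v n - 1) := by field_simp
    rw [hh] at this; linear_combination this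

lemma GamEq_even_iff (hP : 2 ≤ P) {n : ℤ} (h : Interlaced v v' u (n - P) n) :
    GamEq α P κ u (2 * (n - P)) ↔ 1 - α * κ = v (n - P) / v n - α * u (2 * (n - P))
      - α * u (2 * n - 1) + α ^ 2 * (v' (n - 1) / v' (n - P)) := by
  unfold GamEq
  have e1 := h.wprod_even P le_rfl (by omega)
  have e2 := h.wprod_odd (n := n - P) (P - 1) (by omega) (by omega)
  rw [mul_wprod_mul hP, e1, show 2 * P - 2 = 2 * (P - 1) by omega, e2,
    show n - (P : ℤ) + P = n by ring, show n - (P : ℤ) + (P - 1 : ℕ) = n - 1 by omega,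
    show 2 * (n - (P : ℤ)) + 2 * P - 1 = 2 * n - 1 by ring, div_eq_mul_inv (α ^ 2), inv_div]

lemma LatEq_even_iff (hP : 2 ≤ P) {n : ℤ} (h : Interlaced v v' u n (n + P)) :
    LatEq α P κ u (2 * n) ↔ 1 - α * κ = v' n / v' (n + P) - α * u (2 * n)
      - α * u (2 * n + 1) + α ^ 2 * (v' (n + P - 1) / v' n) := by
  unfold LatEq
  have e1 := h.wprod_odd P le_rfl (by omega)
  have e2 := h.wprod_odd (n := n) (P - 1) (by omega) (by omega)
  rw [show 2 * n + 2 = 2 * n + 1 + 1 by ring,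
    show 2 * n + 2 * (P : ℤ) = 2 * n + 1 + 2 * P - 1 by ring, mul_wprod_mul hP, e1,
    show 2 * P - 2 = 2 * (P - 1) by omega, e2, show n + (P - 1 : ℕ) = n + P - 1 by omega,
    div_eq_mul_inv (α ^ 2), inv_div]

lemma LatEq_odd_iff (hP : 2 ≤ P) {n : ℤ} (h : Interlaced v v' u (n - 1) (n + P - 1))
    (hn : v (n + P) ≠ 0) (hu : u (2 * (n + P) - 1) = v' (n + P - 1) / v (n + P)) :
    LatEq α P κ u (2 * n - 1) ↔ 1 - α * κ = v n / v (n + P) - α * u (2 * n - 1)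
      - α * u (2 * n) + α ^ 2 * (v (n + P - 1) / v n) := by
  have hs := h.shift_right (by rwa [sub_add_cancel])
    (by rw [sub_add_cancel, ← hu]; congr 1; ring)
  have := LatEq_even_iff (α := α) (κ := κ) hP (n := n - 1)
    (hs.mono le_rfl (show n - 1 + (P : ℤ) ≤ n + P - 1 by omega))
  rw [LatEq_shift, show 2 * (n - 1) + 1 = 2 * n - 1 by ring, sub_add_cancel,
    show n - 1 + (P : ℤ) + 1 = n + P by ring, show n - 1 + (P : ℤ) - 1 + 1 = n + P - 1 by ring,
    show 2 * n - 1 + 1 = 2 * n by ring] at this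
  exact this

/-- Both relations evaluate `1 - α κ + α (u_{2n-1} + u_{2n})`: `LamEq` by the values of `v` from `n
- P` to `n`, `LatEq` by those from `n` to `n + P`. The Toda equation is the equality of the two
evaluations. -/
lemma todaAt_iff_of_LamEq (hP : 2 ≤ P) (hα : α ≠ 0) {n : ℤ}
    (h : Interlaced v v' u (n - P) (n + P - 1)) (hn : v (n + P) ≠ 0)
    (hu : u (2 * (n + P) - 1) = v' (n + P - 1) / v (n + P)) (hL : LamEq α P κ u (2 * (n - P))) :
    TodaAt α P v n ↔ LatEq α P κ u (2 * n - 1) := by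
  rw [LatEq_odd_iff hP (h.mono (by omega) le_rfl) hn hu]
  rw [LamEq_even_iff hP hα (h.mono le_rfl (by omega))] at hL
  unfold pCoef at hL; unfold TodaAt
  rw [show n + 1 - (P : ℤ) = n - P + 1 by ring]
  have : α * (α * v n / v (n - P + 1) + 1 / α * (v (n - P) / v n - 1))
      = α ^ 2 * (v n / v (n - P + 1)) + (v (n - P) / v n - 1) := by field_simp
  rw [hL] at this
  constructor <;> intro hh
  · linear_combination -hh + this
  · linear_combination -hh + this

/-- The equation for `p'_n` is the one for `p_n` applied to the pair `v'`, `v_{·+1}`, which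
interlaces the shifted sequence `u_{·+1}`. -/
lemma intertwinesL_iff_LamEq (hP : 2 ≤ P) (hα : α ≠ 0) {n : ℤ}
    (h : Interlaced v v' u (n - P) n) (hn : v (n + 1) ≠ 0) (hu : u (2 * n + 1) = v' n / v (n + 1)) :
    IntertwinesL α P κ v v' n ↔
      LamEq α P κ u (2 * (n - P)) ∧ LamEq α P κ u (2 * (n - P) + 1) := by
  have hs := h.shift_right hn hu
  have ho := h.odd (n - 1) (by omega) (by omega)
  rw [show 2 * (n - 1) + 1 = 2 * n - 1 by ring, show n - 1 + 1 = n by ring] at ho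
  rw [intertwinesL_iff (h.ne n (by omega) le_rfl) (h.ne' n (by omega) le_rfl) hn,
    LamEq_even_iff hP hα h, ← LamEq_shift, LamEq_even_iff hP hα hs, ho,
    show 2 * n - 1 + 1 = 2 * n by ring, hu, h.even n (by omega) le_rfl]

lemma intertwinesM_iff_GamEq (hP : 2 ≤ P) (hα : α ≠ 0) {n : ℤ}
    (h : Interlaced v v' u (n - P) n) (hn : v (n + 1) ≠ 0) (hu : u (2 * n + 1) = v' n / v (n + 1)) :
    IntertwinesM α P κ v v' n ↔
      GamEq α P κ u (2 * (n - P) + 1) ∧ LiftedDTKQAt α P u (2 * (n - P) + 1) := by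
  have hs := h.shift_right hn hu
  have hw : WinNe P u (2 * (n - P) + 1) := by
    intro j h1 h2
    rcases lt_or_eq_of_le (show j ≤ 2 * n by omega) with h3 | rfl
    · exact h.u_ne (by omega) (by omega)
    · exact h.u_ne (by omega) (by omega)
  have hv1 := h.ne n (by omega) le_rfl
  have hv2 := h.ne' n (by omega) le_rfl
  have hv3 := h.ne (n - P + 1) (by omega) (by omega)
  have hv4 := h.ne' (n - P + 1) (by omega) (by omega)
  have hv5 := h.ne' (n - P) (by omega) (by omega)
  rw [intertwinesM_iff hα hv1 hv2 hn hv3 hv4]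
  have g1 : GamEq α P κ u (2 * (n - P) + 1) ↔ 1 - α * κ = v' (n - P) / v' n
      - α * (v' (n - P) / v (n - P + 1)) - α * (v n / v' n) + α ^ 2 * (v n / v (n - P + 1)) := by
    rw [← GamEq_shift, GamEq_even_iff hP hs, h.odd (n - P) le_rfl (by omega),
      show 2 * n - 1 + 1 = 2 * n by ring, show n - 1 + 1 = n by ring, h.even n (by omega) le_rfl]
  have g2 : LiftedDTKQAt α P u (2 * (n - P) + 1) ↔ α * (v n / v (n - P + 1)) + v' n / v (n + 1)
        = α * (v' n / v' (n - P + 1)) + v' (n - P) / v (n - P + 1) := by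
    have e1 := h.wprod_even (n := n - P + 1) (P - 1) (by omega) (by omega)
    have e2 := h.wprod_odd (n := n - P + 1) (P - 1) (by omega) (by omega)
    rw [lifted_iff hP, show 2 * P - 2 = 2 * (P - 1) by omega,
      show 2 * (n - (P : ℤ)) + 1 + 1 = 2 * (n - P + 1) by ring,
      show 2 * (n - (P : ℤ)) + 1 + 2 = 2 * (n - P + 1) + 1 by ring, e1, e2,
      h.odd (n - P) le_rfl (by omega), show 2 * (n - (P : ℤ)) + 1 + 2 * P = 2 * n + 1 by ring, hu,
      show n - (P : ℤ) + 1 + (P - 1 : ℕ) = n by omega, one_div_div, one_div_div]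
    constructor <;> intro hh <;> linear_combination hh
  rw [← g1, ← g2]
  constructor
  · rintro ⟨h1, -, h3⟩; exact ⟨h1, h3⟩
  · rintro ⟨h1, h3⟩
    refine ⟨h1, ?_, h3⟩
    -- The lower left entry is `GamEq` one position further on, hence a consequence of the other two
    -- equations by conservation.
    have h2 := GamEq_succ hP hw h3 h1
    have e1 : v (n - P + 1) / v (n + 1) = u (2 * (n - P) + 1 + 1)
        * wprod u (2 * (n - P) + 1 + 1 + 1) (2 * P - 2) * u (2 * (n - P) + 1 + 1 + 2 * P - 1) := by
      rw [show 2 * (n - (P : ℤ)) + 1 + 1 = 2 * (n - P + 1) by ring, h.even _ (by omega) (by omega),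
        show 2 * P - 2 = 2 * (P - 1) by omega,
        h.wprod_odd (n := n - P + 1) (P - 1) (by omega) (by omega),
        show 2 * (n - (P : ℤ) + 1) + 2 * P - 1 = 2 * n + 1 by ring, hu,
        show n - (P : ℤ) + 1 + (P - 1 : ℕ) = n by omega]
      field_simp
    have e2 : v' n / v' (n - P + 1) = 1 / wprod u (2 * (n - P) + 1 + 1 + 1) (2 * P - 2) := by
      rw [show 2 * (n - (P : ℤ)) + 1 + 1 = 2 * (n - P + 1) by ring,
        show 2 * P - 2 = 2 * (P - 1) by omega,
        h.wprod_odd (n := n - P + 1) (P - 1) (by omega) (by omega),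
        show n - (P : ℤ) + 1 + (P - 1 : ℕ) = n by omega, one_div_div]
    unfold GamEq at h2
    rw [← e1, div_eq_mul_one_div (α ^ 2), ← e2,
      show 2 * (n - (P : ℤ)) + 1 + 1 + 2 * P - 1 = 2 * n + 1 by ring, hu,
      show 2 * (n - (P : ℤ)) + 1 + 1 = 2 * (n - P + 1) by ring,
      h.even (n - P + 1) (by omega) (by omega)] at h2
    linear_combination h2

end

/-! ## Bi-infinite sequences -/

section

variable {α κ : ℂ} {P : ℕ} {u v v' : ℤ → ℂ}

lemma GamEq_all (hP : 2 ≤ P) (hu : ∀ n, u n ≠ 0) (hE : ∀ n, LiftedDTKQAt α P u n)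
    (hG : GamEq α P κ u 0) (k : ℤ) : GamEq α P κ u k := by
  induction k using Int.induction_on with
  | zero => exact hG
  | succ i ih => exact GamEq_succ hP (fun j _ _ => hu j) (hE _) ih
  | pred i ih =>
    apply GamEq_pred hP (fun j _ _ => hu j) (hE _)
    rwa [sub_add_cancel]

lemma todaAt_of_lifted (hP : 2 ≤ P) (hα : α ≠ 0) (hI : ∀ a b, Interlaced v v' u a b)
    (hu : ∀ n, u n ≠ 0) (hE : ∀ n, LiftedDTKQAt α P u n) (hG : ∀ k, GamEq α P κ u k) (n : ℤ) :
    TodaAt α P v n := by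
  rw [todaAt_iff_of_LamEq hP hα (hI _ _) ((hI (n + P) (n + P)).ne _ le_rfl le_rfl)
    ((hI (n + P - 1) (n + P)).odd' (n + P - 1) (by omega) (by ring) (by omega))
    (LamEq_of_GamEq hP (hE _) (hG _))]
  exact LatEq_of_GamEq_of_lifted hP (fun j _ _ => hu j) (hE _) (hG _)

lemma Interlaced.shift_all (hI : ∀ a b, Interlaced v v' u a b) (a b : ℤ) :
    Interlaced v' (fun n => v (n + 1)) (fun n => u (n + 1)) a b :=
  (hI a b).shift_right ((hI (b + 1) (b + 1)).ne _ le_rfl le_rfl)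
    ((hI b (b + 1)).odd b le_rfl (by omega))

lemma lifted_shift {k : ℤ} :
    LiftedDTKQAt α P (fun n => u (n + 1)) k ↔ LiftedDTKQAt α P u (k + 1) := by
  unfold LiftedDTKQAt
  simp only [add_right_comm k _ 1]

lemma todaAt_of_lifted' (hP : 2 ≤ P) (hα : α ≠ 0) (hI : ∀ a b, Interlaced v v' u a b)
    (hu : ∀ n, u n ≠ 0) (hE : ∀ n, LiftedDTKQAt α P u n) (hG : ∀ k, GamEq α P κ u k) (n : ℤ) :
    TodaAt α P v' n :=
  todaAt_of_lifted hP hα (Interlaced.shift_all hI) (fun _ => hu _)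
    (fun _ => lifted_shift.2 (hE _)) (fun _ => GamEq_shift.2 (hG _)) n

lemma seqBT_of_lifted (hP : 2 ≤ P) (hα : α ≠ 0) (hI : ∀ a b, Interlaced v v' u a b)
    (hE : ∀ n, LiftedDTKQAt α P u n) (hG : ∀ k, GamEq α P κ u k) : SeqBT α P κ v v' := by
  refine ⟨fun n => (hI n n).ne n le_rfl le_rfl, fun n => (hI n n).ne' n le_rfl le_rfl, fun n => ?_⟩
  have hn := (hI (n + 1) (n + 1)).ne _ le_rfl le_rfl
  have ho := (hI n (n + 1)).odd n le_rfl (by omega)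
  rw [intertwinesL_iff_LamEq hP hα (hI _ _) hn ho, intertwinesM_iff_GamEq hP hα (hI _ _) hn ho]
  exact ⟨⟨LamEq_of_GamEq hP (hE _) (hG _), LamEq_of_GamEq hP (hE _) (hG _)⟩, hG _, hE _⟩

/-- The four values of `τ` in `u_n` are those occurring in `v_j / v'_j` for `n = 2j` and in `v'_j /
v_{j+1}` for `n = 2j + 1`. So `u` is interlaced over every range, and the scalar dictionary applies.
-/
theorem seqBT_of_tau (hP : 2 ≤ P) (hα : α ≠ 0) (u τ : ℤ → ℂ) (hu : ∀ n, u n ≠ 0)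
    (hτ : ∀ n, τ n ≠ 0) (hE : ∀ n, LiftedDTKQAt α P u n)
    (hut : ∀ n, u n = τ (n + 3) * τ n / (τ (n + 2) * τ (n + 1))) :
    (∀ n, gam α P u (n + 2) = gam α P u n) ∧
      (∀ n, TodaAt α P (fun m => τ (2 * m) / τ (2 * m + 2)) n) ∧
      (∀ n, TodaAt α P (fun m => τ (2 * m + 1) / τ (2 * m + 3)) n) ∧
      SeqBT α P (kappa α P u)
        (fun m => τ (2 * m) / τ (2 * m + 2)) (fun m => τ (2 * m + 1) / τ (2 * m + 3)) := by
  have hI : ∀ a b, Interlaced (fun m => τ (2 * m) / τ (2 * m + 2))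
      (fun m => τ (2 * m + 1) / τ (2 * m + 3)) u a b := by
    refine fun a b => ⟨fun j _ _ => div_ne_zero (hτ _) (hτ _),
      fun j _ _ => div_ne_zero (hτ _) (hτ _), fun j _ _ => ?_, fun j _ _ => ?_⟩
    · simp only [hut]
      have := hτ (2 * j + 3)
      have := hτ (2 * j + 2)
      have := hτ (2 * j + 1)
      field_simp
    · simp only [hut]
      rw [show 2 * j + 1 + 3 = 2 * (j + 1) + 2 by ring, show 2 * j + 1 + 2 = 2 * j + 3 by ring,
        show 2 * j + 1 + 1 = 2 * (j + 1) by ring]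
      have := hτ (2 * j + 3)
      have := hτ (2 * (j + 1))
      have := hτ (2 * (j + 1) + 2)
      field_simp
  have hG := GamEq_all hP hu hE ((GamEq_zero_iff_kappa hP hα fun j _ _ => hu j).2 rfl)
  exact ⟨fun n => gam_add_two hP (fun j _ _ => hu j) (hE n), todaAt_of_lifted hP hα hI hu hE hG,
    todaAt_of_lifted' hP hα hI hu hE hG, seqBT_of_lifted hP hα hI hE hG⟩

/-! ## Monodromy matrices -/

lemma prod_laxL_mul_gauge (m : ℕ) (a : ℤ)
    (h : ∀ i : ℕ, i < m → IntertwinesL α P κ v v' (a + i)) :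
    ((List.range m).map fun i : ℕ => laxL α P v (a + i)).prod * gauge κ v v' (a + m - 1)
      = gauge κ v v' (a - 1) * ((List.range m).map fun i : ℕ => laxL α P v' (a + i)).prod := by
  induction m with
  | zero => simp
  | succ m ih =>
    have h1 := h m (Nat.lt_succ_self m)
    have h2 := ih fun i hi => h i (hi.trans (Nat.lt_succ_self m))
    unfold IntertwinesL at h1
    rw [List.range_succ, List.map_append, List.map_append, List.prod_append, List.prod_append]
    simp only [List.map_cons, List.map_nil, List.prod_cons, List.prod_nil, mul_one]
    rw [show a + ((m + 1 : ℕ) : ℤ) - 1 = a + m by push_cast; ring, mul_assoc, h1, ← mul_assoc, h2,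
      mul_assoc]

lemma one_sub_C_mul_X_ne (α : ℂ) : (1 - C α * X : ℂ[X]) ≠ 0 := by
  intro h
  have := congrArg (Polynomial.eval 0) h
  simp at this

/-- The product of the `L`'s carries `G_n` to `G_{n-P}`, and the adjugate of `M_n` carries it back.
For the latter, the relation for `M_n` is multiplied by both adjugates and the common factor `1 - α
ζ`, a nonzero polynomial, is cancelled. -/
lemma monodromy_mul_gauge {n : ℤ}
    (hL : ∀ i : ℕ, i < P → IntertwinesL α P κ v v' (n - P + 1 + i))
    (hM : IntertwinesM α P κ v v' n) :
    monodromy α P v n * gauge κ v v' n = gauge κ v v' n * monodromy α P v' n := by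
  have h1 := prod_laxL_mul_gauge P (n - P + 1) hL
  rw [show n - (P : ℤ) + 1 + P - 1 = n by ring, show n - (P : ℤ) + 1 - 1 = n - P by ring] at h1
  have h2 : (laxM α P v n).adjugate * gauge κ v v' (n - P)
      = gauge κ v v' n * (laxM α P v' n).adjugate := by
    unfold IntertwinesM at hM
    have h3 : (laxM α P v n).adjugate * (laxM α P v n * gauge κ v v' n) * (laxM α P v' n).adjugate
        = (laxM α P v n).adjugate * (gauge κ v v' (n - P) * laxM α P v' n)
          * (laxM α P v' n).adjugate := by rw [hM]
    rw [← mul_assoc, adjugate_mul, mul_assoc ((laxM α P v n).adjugate),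
      mul_assoc (gauge κ v v' (n - P)), mul_adjugate, det_laxM, det_laxM, smul_mul_assoc,
      one_mul, smul_mul_assoc, mul_smul_comm, mul_one, mul_smul_comm] at h3
    exact ((smul_right_injective _ (one_sub_C_mul_X_ne α)) h3).symm
  unfold monodromy
  rw [mul_assoc, h1, ← mul_assoc, h2, mul_assoc]

lemma det_gauge {n : ℤ} (h : v (n + 1) ≠ 0) : (gauge κ v v' n).det = C κ - X := by
  rw [gauge, Matrix.det_fin_two_of]
  have : (C (v' n) : ℂ[X]) * C (-(v (n + 1))⁻¹) = -C (v' n / v (n + 1)) := by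
    rw [← C_mul, ← C_neg]; congr 1; field_simp
  rw [this, C_sub]; ring

lemma trace_eq_of_mul_eq {G A B : Matrix (Fin 2) (Fin 2) ℂ[X]} (hG : G.det ≠ 0)
    (h : A * G = G * B) : A.trace = B.trace := by
  have h1 : (A * G * G.adjugate).trace = (G * B * G.adjugate).trace := by rw [h]
  rw [mul_assoc, mul_adjugate, mul_assoc, Matrix.trace_mul_comm G, mul_assoc,
    adjugate_mul, mul_smul_comm, mul_smul_comm, mul_one, mul_one, trace_smul, trace_smul] at h1
  exact mul_left_cancel₀ hG h1

lemma trace_eq_of_gauge {n : ℤ} {A B : Matrix (Fin 2) (Fin 2) ℂ[X]} (h : v (n + 1) ≠ 0)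
    (hAB : A * gauge κ v v' n = gauge κ v v' n * B) : A.trace = B.trace := by
  refine trace_eq_of_mul_eq ?_ hAB
  rw [det_gauge h]
  intro h0
  have := congrArg (Polynomial.eval (κ + 1)) h0
  simp at this

lemma det_laxL {n : ℤ} (h : v n ≠ 0) : (laxL α P v n).det = 1 := by
  rw [laxL, Matrix.det_fin_two_of, mul_zero, zero_sub, ← C_mul, ← C_neg]
  simp [h]

lemma det_monodromy {n : ℤ} (h : ∀ i : ℕ, i < P → v (n - P + 1 + i) ≠ 0) :
    (monodromy α P v n).det = 1 - C α * X := by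
  have h1 : ∀ m : ℕ, m ≤ P →
      ((List.range m).map fun i : ℕ => laxL α P v (n - P + 1 + i)).prod.det = 1 := by
    intro m
    induction m with
    | zero => simp
    | succ m ih =>
      intro hm
      rw [List.range_succ, List.map_append, List.prod_append, det_mul, ih (by omega)]
      simp [det_laxL (h m (by omega))]
  rw [monodromy, det_mul, h1 P le_rfl, det_adjugate, det_laxM]
  simp

/-- At `ζ = κ` the gauge matrix has rank one, and its left kernel is spanned by the row `(v_{n+1}⁻¹,
x)`. The intertwining relation shows that the monodromy matrix preserves this kernel. The quadratic
equation is then the characteristic equation, with determinant `1 - α κ`. -/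
lemma spectrality {n : ℤ} (h : v (n + 1) ≠ 0) {x : ℂ} (hx : x = v' n / v (n + 1))
    (hv : ∀ i : ℕ, i < P → v (n - P + 1 + i) ≠ 0)
    (hM : monodromy α P v n * gauge κ v v' n = gauge κ v v' n * monodromy α P v' n) :
    ∃ μ : ℂ, Matrix.vecMul ![(v (n + 1))⁻¹, x] ((monodromy α P v n).map (Polynomial.eval κ))
        = μ • ![(v (n + 1))⁻¹, x] ∧
      μ ^ 2 - (monodromy α P v n).trace.eval κ * μ + (1 - α * κ) = 0 := by
  have hdet := congrArg (Polynomial.eval κ) (det_monodromy (α := α) hv)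
  rw [det_fin_two] at hdet
  have e00 := congrArg (Polynomial.eval κ) (congrFun (congrFun hM 0) 0)
  have e01 := congrArg (Polynomial.eval κ) (congrFun (congrFun hM 0) 1)
  have e10 := congrArg (Polynomial.eval κ) (congrFun (congrFun hM 1) 0)
  have e11 := congrArg (Polynomial.eval κ) (congrFun (congrFun hM 1) 1)
  rw [trace_fin_two]
  generalize monodromy α P v n = A at *
  generalize monodromy α P v' n = B at *
  simp only [gauge, mul_apply, Fin.sum_univ_two, Fin.isValue, of_apply, cons_val', cons_val_zero,
    cons_val_one, cons_val_fin_one, eval_add, eval_mul, eval_C, eval_X, eval_sub, eval_one,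
    eval_neg, ← hx] at e00 e01 e10 e11 hdet
  set a := (A 0 0).eval κ
  set b := (A 0 1).eval κ
  set c := (A 1 0).eval κ
  set d := (A 1 1).eval κ
  have hv' : v' n = x * v (n + 1) := by rw [hx]; field_simp
  -- The second column of the intertwining relation at `ζ = κ`, after eliminating the entries of the
  -- other monodromy matrix.
  have key : b + v (n + 1) * x * d = (a + v (n + 1) * x * c) * (v (n + 1) * x) := by
    rw [hv'] at e01 e11
    linear_combination -e01 - v (n + 1) * x * e11 + x * eval κ (B 0 1) * mul_inv_cancel₀ h
  refine ⟨a + v (n + 1) * x * c, ?_, ?_⟩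
  · ext i
    fin_cases i <;> simp [vecMul, dotProduct, Fin.sum_univ_two] <;> field_simp
    · change a + v (n + 1) * x * c = _; ring
    · change b + v (n + 1) * x * d = _
      linear_combination key
  · rw [eval_add]
    change (a + v (n + 1) * x * c) ^ 2 - (a + d) * (a + v (n + 1) * x * c) + (1 - α * κ) = 0
    linear_combination -hdet - c * key

/-- At odd positions both (1) and `GamEq` come directly from the matrices `M`. At even positions (1)
is the difference of the `LamEq` from `L` and the `GamEq` at the next, odd position. -/
theorem lifted_of_seqBT (hP : 2 ≤ P) (hα : α ≠ 0) (hBT : SeqBT α P κ v v')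
    (hu : ∀ n, u (2 * n) = v n / v' n ∧ u (2 * n + 1) = v' n / v (n + 1)) :
    (∀ n, LiftedDTKQAt α P u n) ∧ κ = kappa α P u ∧
      (∀ n, TodaAt α P v n) ∧ (∀ n, TodaAt α P v' n) ∧
      ∀ n, monodromy α P v n * gauge κ v v' n = gauge κ v v' n * monodromy α P v' n ∧
        (monodromy α P v n).trace = (monodromy α P v' n).trace ∧
        ∃ μ : ℂ,
          Matrix.vecMul ![(v (n + 1))⁻¹, u (2 * n + 1)]
              ((monodromy α P v n).map (Polynomial.eval κ))
            = μ • ![(v (n + 1))⁻¹, u (2 * n + 1)] ∧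
          μ ^ 2 - (monodromy α P v n).trace.eval κ * μ + (1 - α * κ) = 0 := by
  obtain ⟨hv, hv', hLM⟩ := hBT
  have hI : ∀ a b, Interlaced v v' u a b := fun a b =>
    ⟨fun j _ _ => hv j, fun j _ _ => hv' j, fun j _ _ => (hu j).1, fun j _ _ => (hu j).2⟩
  have hne : ∀ n, u n ≠ 0 := fun n =>
    (hI (-|n|) |n|).u_ne (by rcases abs_cases n with h | h <;> omega)
      (by rcases abs_cases n with h | h <;> omega)
  have hL : ∀ m, LamEq α P κ u (2 * m) := fun m => by
    have := ((intertwinesL_iff_LamEq hP hα (hI _ _) (hv _) (hu (m + P)).2).1 (hLM (m + P)).1).1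
    rwa [add_sub_cancel_right] at this
  have hM : ∀ m, GamEq α P κ u (2 * m + 1) ∧ LiftedDTKQAt α P u (2 * m + 1) := fun m => by
    have := (intertwinesM_iff_GamEq hP hα (hI _ _) (hv _) (hu (m + P)).2).1 (hLM (m + P)).2
    rwa [add_sub_cancel_right] at this
  have hE : ∀ n, LiftedDTKQAt α P u n := by
    intro n
    obtain ⟨m, rfl | rfl⟩ := Int.even_or_odd' n
    · exact lifted_of_LamEq hP (fun j _ _ => hne j) (hM m).1 (hL m)
    · exact (hM m).2
  have hG0 : GamEq α P κ u 0 := GamEq_pred hP (fun j _ _ => hne j) (hE 0) (hM 0).1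
  have hG := GamEq_all hP hne hE hG0
  have hmon : ∀ n, monodromy α P v n * gauge κ v v' n = gauge κ v v' n * monodromy α P v' n :=
    fun n => monodromy_mul_gauge (fun i _ => (hLM _).1) (hLM n).2
  exact ⟨hE, (GamEq_zero_iff_kappa hP hα fun j _ _ => hne j).1 hG0,
    todaAt_of_lifted hP hα hI hne hE hG, todaAt_of_lifted' hP hα hI hne hE hG,
    fun n => ⟨hmon n, trace_eq_of_gauge (hv _) (hmon n),
      spectrality (hv _) (hu n).2 (fun i _ => hv _) (hmon n)⟩⟩

end

/-! ## Orbits in finite dimension -/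

section

variable {α κ x : ℂ} {P : ℕ} {s s' : Fin (2 * P - 1) → ℂ}

/-- The orbit of a point as a sequence (constant for negative indices). -/
def orbit (α : ℂ) (P : ℕ) (u : Fin (2 * P) → ℂ) : ℤ → ℂ := fun n => uTerm α P u n.toNat

lemma coord_of_lt {m : ℕ} (w : Fin m → ℂ) {k : ℕ} (h : k < m) : coord w k = w ⟨k, h⟩ := by
  simp [coord, h]

lemma coord_val {m : ℕ} (w : Fin m → ℂ) (j : Fin m) : coord w j = w j := by
  rw [coord_of_lt w j.2]

lemma coord_phi (α : ℂ) (u : Fin (2 * P) → ℂ) {i : ℕ} (hi : i + 1 < 2 * P) :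
    coord (phi α P u) i = coord u (i + 1) := by
  rw [coord_of_lt _ (by omega : i < 2 * P)]
  simp [phi, hi]

lemma coord_phi_last (α : ℂ) (u : Fin (2 * P) → ℂ) {i : ℕ} (hi : i + 1 = 2 * P) :
    coord (phi α P u) i = coord u 0 - α * (1 / (∏ i ∈ Finset.Icc 1 (2 * P - 2), coord u i)
      - 1 / (∏ i ∈ Finset.Icc 2 (2 * P - 1), coord u i)) := by
  rw [coord_of_lt _ (by omega : i < 2 * P)]
  simp [phi, hi]

lemma uTerm_add (α : ℂ) (u : Fin (2 * P) → ℂ) (k : ℕ) {i : ℕ} (hi : i < 2 * P) :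
    uTerm α P u (k + i) = coord ((phi α P)^[k] u) i := by
  induction i generalizing k with
  | zero => rfl
  | succ i ih =>
    rw [show k + (i + 1) = (k + 1) + i by ring, ih (k + 1) (by omega), Function.iterate_succ_apply',
      coord_phi _ _ hi]

lemma uTerm_of_lt (α : ℂ) (u : Fin (2 * P) → ℂ) {i : ℕ} (hi : i < 2 * P) :
    uTerm α P u i = u ⟨i, hi⟩ := by
  have := uTerm_add α u 0 hi
  rw [zero_add] at this
  rw [this, Function.iterate_zero_apply, coord_of_lt u hi]

lemma uTerm_phi (α : ℂ) (u : Fin (2 * P) → ℂ) (k : ℕ) :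
    uTerm α P (phi α P u) k = uTerm α P u (k + 1) := by
  rw [uTerm, uTerm, Function.iterate_succ_apply]

lemma uTerm_recurrence (α : ℂ) (u : Fin (2 * P) → ℂ) (hP : 2 ≤ P) (k : ℕ) :
    uTerm α P u (k + 2 * P) = uTerm α P u k
      - α * (1 / (∏ i ∈ Finset.Icc 1 (2 * P - 2), uTerm α P u (k + i))
        - 1 / (∏ i ∈ Finset.Icc 2 (2 * P - 1), uTerm α P u (k + i))) := by
  have h1 : uTerm α P u (k + 2 * P) = coord ((phi α P)^[k + 1] u) (2 * P - 1) := by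
    rw [← uTerm_add α u (k + 1) (by omega)]; congr 1; omega
  have h0 := uTerm_add α u k (i := 0) (by omega)
  rw [h1, Function.iterate_succ_apply', coord_phi_last _ _ (by omega), ← h0, add_zero]
  congr 3
  · congr 1
    refine Finset.prod_congr rfl fun i hi => (uTerm_add α u k ?_).symm
    have := Finset.mem_Icc.1 hi; omega
  · congr 1
    refine Finset.prod_congr rfl fun i hi => (uTerm_add α u k ?_).symm
    have := Finset.mem_Icc.1 hi; omega

lemma orbit_natCast (u : Fin (2 * P) → ℂ) (k : ℕ) : orbit α P u k = uTerm α P u k := by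
  simp [orbit]

lemma orbit_lifted (u : Fin (2 * P) → ℂ) (hP : 2 ≤ P) {n : ℤ} (hn : 0 ≤ n) :
    LiftedDTKQAt α P (orbit α P u) n := by
  obtain ⟨k, rfl⟩ := Int.eq_ofNat_of_zero_le hn
  unfold LiftedDTKQAt
  have h := uTerm_recurrence α u hP k
  have e : (k : ℤ) + 2 * P = ((k + 2 * P : ℕ) : ℤ) := by push_cast; ring
  simp only [e, ← Nat.cast_add, orbit_natCast]
  rw [h]; ring

lemma lifted_unique {w w' : ℤ → ℂ} {k : ℤ} (h : LiftedDTKQAt α P w k) (h' : LiftedDTKQAt α P w' k)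
    (hP : 2 ≤ P) (hw : ∀ j, k ≤ j → j < k + 2 * P → w j = w' j) :
    w (k + 2 * P) = w' (k + 2 * P) := by
  rw [lifted_iff hP] at h h'
  have e1 : wprod w (k + 1) (2 * P - 2) = wprod w' (k + 1) (2 * P - 2) :=
    wprod_congr fun j hj => hw _ (by omega) (by omega)
  have e2 : wprod w (k + 2) (2 * P - 2) = wprod w' (k + 2) (2 * P - 2) :=
    wprod_congr fun j hj => hw _ (by omega) (by omega)
  rw [e1, e2, hw k le_rfl (by omega)] at h
  linear_combination h - h'

/-- The terms `w_0, …, w_{4P-1}` of a nowhere zero solution with Bäcklund parameter `κ`, seen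
through the even and odd products. -/
structure IsChain (α : ℂ) (P : ℕ) (κ x : ℂ) (s s' : Fin (2 * P - 1) → ℂ) (w : ℤ → ℂ) : Prop where
  ne : ∀ k : ℤ, 0 ≤ k → k < 4 * P → w k ≠ 0
  lifted : ∀ k : ℤ, 0 ≤ k → k < 2 * P → LiftedDTKQAt α P w k
  gam : GamEq α P κ w 0
  last : x = w (4 * P - 1)
  even : ∀ j : Fin (2 * P - 1), s j = w (2 * (j : ℕ)) * w (2 * (j : ℕ) + 1)
  odd : ∀ j : Fin (2 * P - 1), s' j = w (2 * (j : ℕ) + 1) * w (2 * (j : ℕ) + 2)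

namespace IsChain

variable {w : ℤ → ℂ}

lemma winNe (h : IsChain α P κ x s s' w) {k : ℤ} (h0 : 0 ≤ k + 1) (hk : k ≤ 2 * P) :
    WinNe P w k := fun j h1 h2 => h.ne j (by omega) (by omega)

lemma gam_all (h : IsChain α P κ x s s' w) (hP : 2 ≤ P) {k : ℤ} (h0 : 0 ≤ k) (hk : k ≤ 2 * P) :
    GamEq α P κ w k := by
  obtain ⟨n, rfl⟩ := Int.eq_ofNat_of_zero_le h0
  induction n with
  | zero => exact h.gam
  | succ n ih =>
    have := GamEq_succ hP (h.winNe (by omega) (by omega)) (h.lifted n (by omega) (by omega))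
      (ih (by omega) (by omega))
    simpa using this

lemma lamEq (h : IsChain α P κ x s s' w) (hP : 2 ≤ P) {k : ℤ} (h0 : 0 ≤ k) (hk : k < 2 * P) :
    LamEq α P κ w k :=
  LamEq_of_GamEq hP (h.lifted k h0 hk) (h.gam_all hP h0 hk.le)

lemma latEq (h : IsChain α P κ x s s' w) (hP : 2 ≤ P) {k : ℤ} (h0 : 0 ≤ k) (hk : k < 2 * P) :
    LatEq α P κ w k :=
  LatEq_of_GamEq hP (h.lifted k h0 hk) (h.gam_all hP (by omega) (by omega))

end IsChain

lemma isChain_orbit_iff (hP : 2 ≤ P) (hα : α ≠ 0) (u : Fin (2 * P) → ℂ) :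
    IsChain α P κ x s s' (orbit α P u) ↔ Regular α P u ∧ κ = kappaPt α P u ∧
        x = uTerm α P u (4 * P - 1) ∧ s = piHat α P u ∧ s' = piHat α P (phi α P u) := by
  have hodd : ∀ j : ℕ, orbit α P u (2 * (j : ℕ) + 1) = uTerm α P u (2 * j + 1) := fun j => by
    rw [← orbit_natCast]; push_cast; rfl
  have heven : ∀ j : ℕ, orbit α P u (2 * (j : ℕ)) = uTerm α P u (2 * j) := fun j => by
    rw [← orbit_natCast]; push_cast; rfl
  have hodd' : ∀ j : ℕ, orbit α P u (2 * (j : ℕ) + 2) = uTerm α P u (2 * j + 2) := fun j => by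
    rw [← orbit_natCast]; push_cast; rfl
  have hlast : orbit α P u (4 * P - 1) = uTerm α P u (4 * P - 1) := by
    rw [← orbit_natCast]; congr 1; omega
  constructor
  · intro h
    refine ⟨fun k hk => ?_, ?_, ?_, ?_, ?_⟩
    · have := h.ne k (by omega) (by omega)
      rwa [orbit_natCast] at this
    · exact (GamEq_zero_iff_kappa hP hα fun j h1 h2 => h.ne j (by omega) (by omega)).1 h.gam
    · rw [h.last, hlast]
    · funext j
      rw [h.even, heven, hodd]; rfl
    · funext j
      rw [h.odd, hodd', hodd, piHat, uTerm_phi, uTerm_phi]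
  · rintro ⟨hr, hκ, hx, hs, hs'⟩
    have hne : ∀ k : ℤ, 0 ≤ k → k < 4 * P → orbit α P u k ≠ 0 := fun k h0 hk => by
      obtain ⟨n, rfl⟩ := Int.eq_ofNat_of_zero_le h0
      rw [orbit_natCast]; exact hr n (by omega)
    refine ⟨hne, fun k h0 _ => orbit_lifted u hP h0, ?_, ?_, fun j => ?_, fun j => ?_⟩
    · exact (GamEq_zero_iff_kappa hP hα fun j h1 h2 => hne j (by omega) (by omega)).2 hκ
    · rw [hx, hlast]
    · rw [hs, heven, hodd]; rfl
    · rw [hs', hodd', hodd, piHat, uTerm_phi, uTerm_phi]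

lemma GamEq_congr {w w' : ℤ → ℂ} {k : ℤ} (hP : 2 ≤ P)
    (h : ∀ j, k ≤ j → j < k + 2 * P → w j = w' j) : GamEq α P κ w k ↔ GamEq α P κ w' k := by
  unfold GamEq
  rw [h k le_rfl (by omega), h (k + 2 * P - 1) (by omega) (by omega),
    wprod_congr fun j hj => h (k + 1 + j) (by omega) (by omega)]

lemma lifted_congr {w w' : ℤ → ℂ} {k : ℤ} (hP : 2 ≤ P)
    (h : ∀ j, k ≤ j → j ≤ k + 2 * P → w j = w' j) :
    LiftedDTKQAt α P w k ↔ LiftedDTKQAt α P w' k := by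
  rw [lifted_iff hP, lifted_iff hP, h k le_rfl (by omega), h (k + 2 * P) (by omega) (by omega),
    wprod_congr fun j hj => h (k + 1 + j) (by omega) (by omega),
    wprod_congr fun j hj => h (k + 2 + j) (by omega) (by omega)]

lemma IsChain.congr {w w' : ℤ → ℂ} (hP : 2 ≤ P) (hw : IsChain α P κ x s s' w)
    (h : ∀ j : ℤ, 0 ≤ j → j < 4 * P → w j = w' j) : IsChain α P κ x s s' w' where
  ne k h0 hk := by rw [← h k h0 hk]; exact hw.ne k h0 hk
  lifted k h0 hk := (lifted_congr hP fun j h1 h2 => h j (by omega) (by omega)).1 (hw.lifted k h0 hk)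
  gam := (GamEq_congr hP fun j h1 h2 => h j (by omega) (by omega)).1 hw.gam
  last := by rw [hw.last, h _ (by omega) (by omega)]
  even j := by
    have := j.2
    rw [hw.even, h _ (by omega) (by omega), h (2 * (j : ℕ) + 1) (by omega) (by omega)]
  odd j := by
    have := j.2
    rw [hw.odd, h (2 * (j : ℕ) + 1) (by omega) (by omega),
      h (2 * (j : ℕ) + 2) (by omega) (by omega)]

/-- A solution on the range `0, …, 4P-1` is an orbit. -/
lemma exists_orbit {w : ℤ → ℂ} (hP : 2 ≤ P)
    (hw : ∀ k : ℤ, 0 ≤ k → k < 2 * P → LiftedDTKQAt α P w k) :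
    ∃ u : Fin (2 * P) → ℂ, ∀ j : ℤ, 0 ≤ j → j < 4 * P → w j = orbit α P u j := by
  refine ⟨fun j => w (j : ℕ), fun j h0 hj => ?_⟩
  obtain ⟨n, rfl⟩ := Int.eq_ofNat_of_zero_le h0
  induction n using Nat.strong_induction_on with
  | _ n ih =>
    by_cases hn : n < 2 * P
    · rw [orbit_natCast, uTerm_of_lt _ _ hn]
    · have := lifted_unique (hw (n - 2 * P) (by omega) (by omega))
        (orbit_lifted (fun j => w (j : ℕ)) hP (by omega)) hP fun i h1 h2 => by
          obtain ⟨m, rfl⟩ := Int.eq_ofNat_of_zero_le (show 0 ≤ i by omega)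
          exact ih m (by omega) (by omega) (by omega)
      rwa [sub_add_cancel] at this

/-- Descent from the relations that involve the last terms to all relations. -/
lemma lifted_and_GamEq_of_descent {w : ℤ → ℂ} (hP : 2 ≤ P) (hα : α ≠ 0) {K : ℕ}
    (hne : ∀ k : ℤ, 0 ≤ k → k < K + 2 * P → w k ≠ 0) (hG : GamEq α P κ w K)
    (hL : ∀ k : ℤ, 0 ≤ k → k < K → LamEq α P κ w k ∨ LatEq α P κ w k) :
    (∀ k : ℤ, 0 ≤ k → k < K → LiftedDTKQAt α P w k) ∧ ∀ k : ℤ, 0 ≤ k → k ≤ K → GamEq α P κ w k := by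
  have key : ∀ i : ℕ, i ≤ K → GamEq α P κ w (K - i) ∧
      (i ≠ 0 → LiftedDTKQAt α P w (K - i)) := by
    intro i
    induction i with
    | zero => simpa using hG
    | succ i ih =>
      intro hi
      have h1 := (ih (by omega)).1
      rw [show (K : ℤ) - i = K - (i + 1 : ℕ) + 1 by push_cast; ring] at h1
      have hwin : WinNe P w (K - (i + 1 : ℕ)) := fun j h2 h3 => hne j (by omega) (by omega)
      have hE : LiftedDTKQAt α P w (K - (i + 1 : ℕ)) := by
        -- Either form, combined with `GamEq` at the next position, yields (1) here; and (1) then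
        -- carries `GamEq` down by one position.
        rcases hL (K - (i + 1 : ℕ)) (by omega) (by omega) with h | h
        · exact lifted_of_LamEq hP hwin h1 h
        · exact lifted_of_LatEq_succ hP hα h1 h
      exact ⟨GamEq_pred hP hwin hE h1, fun _ => hE⟩
  constructor
  · intro k h0 hk
    have := (key (K - k).toNat (by omega)).2 (by omega)
    rwa [show (K : ℤ) - ((K - k).toNat : ℕ) = k by omega] at this
  · intro k h0 hk
    have := (key (K - k).toNat (by omega)).1
    rwa [show (K : ℤ) - ((K - k).toNat : ℕ) = k by omega] at this

/-! ### From gauge matrices to chains and back -/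

/-- The sequence in which `v` and `v'` are interlaced. -/
def interlace (v v' : ℤ → ℂ) : ℤ → ℂ := fun n =>
  if Even n then v (n / 2) / v' (n / 2) else v' (n / 2) / v (n / 2 + 1)

lemma interlace_even (v v' : ℤ → ℂ) (n : ℤ) : interlace v v' (2 * n) = v n / v' n := by
  simp [interlace]

lemma interlace_odd (v v' : ℤ → ℂ) (n : ℤ) : interlace v v' (2 * n + 1) = v' n / v (n + 1) := by
  have h : ¬ Even (2 * n + 1) := by simp
  rw [interlace, if_neg h, show (2 * n + 1) / 2 = n by omega]

/-- The single relation for `M_{2P-1}` gives `GamEq` and (1) at position `2P - 1`. The relations for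
`L_P, …, L_{2P-1}` give `LamEq` at all lower positions, and descent supplies everything else. -/
theorem isChain_of_isBT (hP : 2 ≤ P) (hα : α ≠ 0) (h : IsBT α P κ x s s') :
    ∃ w, IsChain α P κ x s s' w := by
  obtain ⟨v, v', hv, hv', hs, hs', -, hL, hM, hx⟩ := h
  simp only [Set.mem_Icc] at hv hv' hL
  set w := interlace v v' with hw
  have hI : Interlaced v v' w 0 (2 * P - 1) :=
    ⟨fun j h0 h1 => hv j ⟨h0, by omega⟩, fun j h0 h1 => hv' j ⟨h0, by omega⟩,
      fun j _ _ => interlace_even v v' j, fun j _ _ => interlace_odd v v' j⟩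
  have hne : ∀ k : ℤ, 0 ≤ k → k < 4 * (P : ℤ) → w k ≠ 0 := by
    intro k h0 hk
    by_cases h : k ≤ 2 * (2 * P - 1)
    · exact hI.u_ne (by omega) h
    · obtain rfl : k = 2 * (2 * P - 1) + 1 := by omega
      rw [hw, interlace_odd]
      exact div_ne_zero (hv' _ (by omega)) (hv _ (by omega))
  have hM' := (intertwinesM_iff_GamEq hP hα (hI.mono (by omega) le_rfl) (hv _ (by omega))
    (interlace_odd v v' _)).1 hM
  rw [show 2 * (2 * (P : ℤ) - 1 - P) + 1 = (2 * P - 1 : ℕ) by omega] at hM'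
  have hLam : ∀ k : ℤ, 0 ≤ k → k < (2 * P - 1 : ℕ) → LamEq α P κ w k := by
    intro k h0 hk
    obtain ⟨m, rfl | rfl⟩ := Int.even_or_odd' k
    · have := ((intertwinesL_iff_LamEq hP hα (n := m + P) (hI.mono (by omega) (by omega))
        (hv _ (by omega)) (interlace_odd v v' _)).1 (hL _ (by omega))).1
      rwa [add_sub_cancel_right] at this
    · have := ((intertwinesL_iff_LamEq hP hα (n := m + P) (hI.mono (by omega) (by omega))
        (hv _ (by omega)) (interlace_odd v v' _)).1 (hL _ (by omega))).2
      rwa [add_sub_cancel_right] at this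
  obtain ⟨hE, hG⟩ := lifted_and_GamEq_of_descent hP hα (fun k h0 hk => hne k h0 (by omega)) hM'.1
    fun k h0 hk => Or.inl (hLam k h0 hk)
  refine ⟨w, hne, fun k h0 hk => ?_, hG 0 le_rfl (by omega), ?_, fun j => ?_, fun j => ?_⟩
  · by_cases h : k < (2 * P - 1 : ℕ)
    · exact hE k h0 h
    · obtain rfl : k = (2 * P - 1 : ℕ) := by omega
      exact hM'.2
  · rw [hx, show 4 * (P : ℤ) - 1 = 2 * (2 * P - 1) + 1 by ring, hw, interlace_odd, sub_add_cancel]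
  · have := j.2
    have h1 := hv' j (by omega)
    rw [hs, hw, interlace_odd, interlace_even]
    field_simp
  · have := j.2
    have h1 := hv (j + 1) (by omega)
    rw [hs', show 2 * ((j : ℕ) : ℤ) + 2 = 2 * ((j : ℕ) + 1) by ring, hw, interlace_odd,
      interlace_even]
    field_simp

theorem isBT_of_isChain (hP : 2 ≤ P) (hα : α ≠ 0) {w : ℤ → ℂ} (h : IsChain α P κ x s s' w) :
    IsBT α P κ x s s' := by
  -- Normalised by `v_0 = 1`; inverting the partial products makes `v_n / v_{n+1} = w_{2n}
  -- w_{2n+1}`.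
  set v : ℤ → ℂ := fun n => (wprod w 0 (2 * n.toNat))⁻¹ with hv
  set v' : ℤ → ℂ := fun n => v n / w (2 * n) with hv'
  have hvne : ∀ n, 0 ≤ n → n ≤ 2 * (P : ℤ) → v n ≠ 0 := fun n h0 hn =>
    inv_ne_zero (wprod_ne_zero fun j h1 h2 => h.ne j h1 (by omega))
  have hsucc : ∀ n, 0 ≤ n → n < 2 * (P : ℤ) → v n = v (n + 1) * (w (2 * n) * w (2 * n + 1)) := by
    intro n h0 hn
    have h1 := h.ne (2 * n) (by omega) (by omega)
    have h2 := h.ne (2 * n + 1) (by omega) (by omega)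
    have h3 := hvne n h0 hn.le
    simp only [hv] at h3 ⊢
    rw [show 2 * (n + 1).toNat = 2 * n.toNat + 1 + 1 by omega, wprod_succ, wprod_succ,
      show (0 : ℤ) + ((2 * n.toNat : ℕ) : ℤ) = 2 * n by omega,
      show (0 : ℤ) + ((2 * n.toNat + 1 : ℕ) : ℤ) = 2 * n + 1 by omega]
    have h3' := inv_ne_zero h3
    rw [inv_inv] at h3'
    field_simp
  have hodd : ∀ n, 0 ≤ n → n < 2 * (P : ℤ) → w (2 * n + 1) = v' n / v (n + 1) := by
    intro n h0 hn
    have h1 := h.ne (2 * n) (by omega) (by omega)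
    have h2 := hvne (n + 1) (by omega) (by omega)
    simp only [hv']
    rw [hsucc n h0 hn]; field_simp
  have heven : ∀ n, 0 ≤ n → n < 2 * (P : ℤ) → w (2 * n) = v n / v' n := by
    intro n h0 hn
    have h1 := h.ne (2 * n) (by omega) (by omega)
    have h2 := hvne n (by omega) (by omega)
    simp only [hv']
    field_simp
  have hv'ne : ∀ n, 0 ≤ n → n < 2 * (P : ℤ) → v' n ≠ 0 := fun n h0 hn =>
    div_ne_zero (hvne n h0 hn.le) (h.ne _ (by omega) (by omega))
  have hI : Interlaced v v' w 0 (2 * P - 1) :=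
    ⟨fun j h0 h1 => hvne j h0 (by omega), fun j h0 h1 => hv'ne j h0 (by omega),
      fun j h0 h1 => heven j h0 (by omega), fun j h0 h1 => hodd j h0 (by omega)⟩
  refine ⟨v, v', fun n hn => hvne n hn.1 hn.2, fun n hn => hv'ne n hn.1 (by have := hn.2; omega),
    fun j => ?_, fun j => ?_, ?_, fun n hn => ?_, ?_, ?_⟩
  · have := j.2
    rw [h.even, hsucc j (by omega) (by omega), mul_div_cancel_left₀ _ (hvne _ (by omega) (by omega))]
  · have := j.2
    have h1 := hv'ne j (by omega) (by omega)
    have h2 := hv'ne (j + 1) (by omega) (by omega)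
    have h3 := hvne (j + 1) (by omega) (by omega)
    rw [h.odd, hodd _ (by omega) (by omega), show 2 * ((j : ℕ) : ℤ) + 2 = 2 * ((j : ℕ) + 1) by ring,
      heven _ (by omega) (by omega)]
    field_simp
  · rw [todaAt_iff_of_LamEq hP hα (hI.mono (by omega) (by omega)) (hvne _ (by omega) (by omega))
      (by rw [show 2 * ((P : ℤ) + P) - 1 = 2 * (2 * P - 1) + 1 by ring,
            hodd _ (by omega) (by omega)]
          congr 2 <;> ring) (h.lamEq hP (by omega) (by omega))]
    exact h.latEq hP (by omega) (by omega)
  · have h1 := hn.1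
    have h2 := hn.2
    rw [intertwinesL_iff_LamEq hP hα (hI.mono (by omega) (by omega)) (hvne _ (by omega) (by omega))
      (hodd _ (by omega) (by omega))]
    exact ⟨h.lamEq hP (by omega) (by omega), h.lamEq hP (by omega) (by omega)⟩
  · rw [intertwinesM_iff_GamEq hP hα (hI.mono (by omega) (by omega)) (hvne _ (by omega) (by omega))
      (hodd _ (by omega) (by omega))]
    exact ⟨h.gam_all hP (by omega) (by omega), h.lifted _ (by omega) (by omega)⟩
  · rw [h.last, show 4 * (P : ℤ) - 1 = 2 * (2 * P - 1) + 1 by ring, hodd _ (by omega) (by omega),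
      sub_add_cancel]

theorem isBT_iff_exists_isChain (hP : 2 ≤ P) (hα : α ≠ 0) :
    IsBT α P κ x s s' ↔ ∃ w, IsChain α P κ x s s' w :=
  ⟨isChain_of_isBT hP hα, fun ⟨_, h⟩ => isBT_of_isChain hP hα h⟩

theorem isBT_iff_exists_point (hP : 2 ≤ P) (hα : α ≠ 0) :
    IsBT α P κ x s s' ↔ ∃ u : Fin (2 * P) → ℂ, Regular α P u ∧ κ = kappaPt α P u ∧
        x = uTerm α P u (4 * P - 1) ∧ s = piHat α P u ∧ s' = piHat α P (phi α P u) := by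
  simp only [← isChain_orbit_iff hP hα]
  constructor
  · intro h
    obtain ⟨w, hw⟩ := isChain_of_isBT hP hα h
    obtain ⟨u, hu⟩ := exists_orbit hP hw.lifted
    exact ⟨u, hw.congr hP hu⟩
  · rintro ⟨u, hu⟩
    exact isBT_of_isChain hP hα hu

end

section

variable {α κ x : ℂ} {P : ℕ} {s s' : Fin (2 * P - 1) → ℂ}

/-! ## Solutions are mapped to solutions -/

/-- The products of consecutive pairs of terms, from the term number `k` on. -/
def pairs (P : ℕ) (w : ℤ → ℂ) (k : ℤ) : Fin (2 * P - 1) → ℂ := fun j =>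
  w (k + 2 * (j : ℕ)) * w (k + 2 * (j : ℕ) + 1)

lemma coord_pairs (w : ℤ → ℂ) (k : ℤ) {j : ℕ} (hj : j < 2 * P - 1) :
    coord (pairs P w k) j = w (k + 2 * (j : ℕ)) * w (k + 2 * (j : ℕ) + 1) := by
  rw [coord_of_lt _ hj]; rfl

lemma prod_coord_pairs (w : ℤ → ℂ) (k : ℤ) {a b : ℕ} (hb : b < 2 * P - 1) :
    ∏ i ∈ Finset.Icc a b, coord (pairs P w k) i = wprod w (k + 2 * a) (2 * (b + 1 - a)) := by
  rw [prod_Icc_eq_range]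
  have key : ∀ m : ℕ, m ≤ b + 1 - a → ∏ j ∈ Finset.range m, coord (pairs P w k) (a + j)
      = wprod w (k + 2 * a) (2 * m) := by
    intro m
    induction m with
    | zero => simp
    | succ m ih =>
      intro hm
      rw [Finset.prod_range_succ, ih (by omega), coord_pairs _ _ (by omega), Nat.mul_succ,
        wprod_succ, wprod_succ, mul_assoc]
      congr 3
      · push_cast; ring
      · push_cast; ring
  exact key _ le_rfl

/-- The equation for the products of consecutive pairs. -/
lemma toda_pairs {w : ℤ → ℂ} {k : ℤ} (hP : 2 ≤ P) (h1 : LamEq α P κ w k)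
    (h2 : LatEq α P κ w (k + 2 * P - 1)) :
    wprod w (k + 2 * P) (2 * P) + α ^ 2 / wprod w (k + 2 * P) (2 * P - 2)
      = wprod w k (2 * P) + α ^ 2 / wprod w (k + 2) (2 * P - 2) := by
  unfold LamEq at h1; unfold LatEq at h2
  rw [mul_wprod_mul hP] at h1
  rw [show k + 2 * (P : ℤ) - 1 + 2 = k + 2 * P + 1 by ring,
    show k + 2 * (P : ℤ) - 1 + 1 = k + 2 * P by ring,
    show k + 2 * (P : ℤ) - 1 + 2 * P = k + 2 * P + 2 * P - 1 by ring, mul_wprod_mul hP] at h2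
  -- Both relations contain the sum `w_{k+2P-1} + w_{k+2P}`, which cancels.
  linear_combination h1 - h2

/-- On pair products, `χ̂` is the shift by two positions. Only the last coordinate needs an
argument: it solves the equation of `toda_pairs`, in which its coefficient is a product of nonzero
terms. -/
lemma chiHat_pairs {w : ℤ → ℂ} {k : ℤ} (hP : 2 ≤ P) (h1 : LamEq α P κ w k)
    (h2 : LatEq α P κ w (k + 2 * P - 1))
    (hne : ∀ j, k + 2 * P ≤ j → j < k + 4 * P - 2 → w j ≠ 0) :
    chiHat α P (pairs P w k) = pairs P w (k + 2) := by
  funext j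
  unfold chiHat
  split_ifs with hj
  · rw [coord_pairs _ _ hj, pairs]
    congr 2 <;> push_cast <;> ring
  · have hj' : (j : ℕ) = 2 * P - 2 := by have := j.2; omega
    rw [prod_coord_pairs _ _ (by omega), prod_coord_pairs _ _ (by omega),
      prod_coord_pairs _ _ (by omega)]
    have e1 : 2 * (P - 1 + 1 - 0) = 2 * P := by omega
    have e2 : 2 * (2 * P - 2 + 1 - P) = 2 * P - 2 := by omega
    have e3 : 2 * (P - 1 + 1 - 1) = 2 * P - 2 := by omega
    have h3 := toda_pairs hP h1 h2
    have hw : wprod w (k + 2 * P) (2 * P - 2) ≠ 0 :=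
      wprod_ne_zero fun j h1 h2 => hne j h1 (by omega)
    have h4 : wprod w (k + 2 * P) (2 * P) = wprod w (k + 2 * P) (2 * P - 2)
        * (w (k + 4 * P - 2) * w (k + 4 * P - 1)) := by
      conv_lhs => rw [show 2 * P = 2 * P - 2 + 1 + 1 by omega]
      rw [wprod_succ, wprod_succ, mul_assoc]
      congr 3 <;> omega
    rw [e1, e2, e3, pairs, hj', Nat.cast_zero, mul_zero, add_zero, Nat.cast_one, mul_one,
      show k + 2 + 2 * ((2 * P - 2 : ℕ) : ℤ) = k + 4 * P - 2 by omega,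
      show k + 4 * (P : ℤ) - 2 + 1 = k + 4 * P - 1 by omega, div_eq_iff hw]
    rw [h4] at h3
    linear_combination -h3

lemma IsChain.eq_pairs {w : ℤ → ℂ} (h : IsChain α P κ x s s' w) :
    s = pairs P w 0 ∧ s' = pairs P w 1 := by
  constructor
  · funext j; rw [h.even, pairs, zero_add]
  · funext j; rw [h.odd, pairs]; congr 2 <;> ring

/-- The chain is continued as an orbit of (1) and shifted by two. The only new terms are `w_{4P}`
and `w_{4P+1}`, and the hypotheses on the images under `χ̂` say exactly what is needed for them not
to vanish. -/
theorem isBT_chiHat (hP : 2 ≤ P) (hα : α ≠ 0) (h : IsBT α P κ x s s')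
    (h1 : ∀ j, chiHat α P s' j ≠ 0) (h2 : ∀ j, chiHat α P (chiHat α P s) j ≠ 0) :
    ∃ x', IsBT α P κ x' (chiHat α P s) (chiHat α P s') := by
  obtain ⟨w₀, hw₀⟩ := isChain_of_isBT hP hα h
  obtain ⟨u, hu⟩ := exists_orbit hP hw₀.lifted
  have hw := hw₀.congr hP hu
  have hE : ∀ n, 0 ≤ n → LiftedDTKQAt α P (orbit α P u) n := fun n hn => orbit_lifted u hP hn
  generalize orbit α P u = w at hw hE
  have hl : (2 * P - 2 : ℕ) < 2 * P - 1 := by omega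
  obtain ⟨rfl, rfl⟩ := hw.eq_pairs
  have e0 : chiHat α P (pairs P w 0) = pairs P w 2 := by
    have := chiHat_pairs hP (hw.lamEq hP le_rfl (by omega))
      (hw.latEq hP (k := 0 + 2 * P - 1) (by omega) (by omega))
      fun j h1 h2 => hw.ne j (by omega) (by omega)
    rwa [zero_add] at this
  have g0 := hw.gam_all hP (k := 2 * P) (by omega) le_rfl
  have e1 : chiHat α P (pairs P w 1) = pairs P w 3 :=
    chiHat_pairs hP (hw.lamEq hP (by omega) (by omega))
      (by rw [show 1 + 2 * (P : ℤ) - 1 = 2 * P by ring]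
          exact LatEq_of_GamEq_of_lifted hP (hw.winNe (by omega) le_rfl) (hE _ (by omega)) g0)
      fun j h1 h2 => hw.ne j (by omega) (by omega)
  -- The last entry of `χ̂(s')` is `w_{4P-1} w_{4P}`. This has to precede the treatment of
  -- `w_{4P+1}`, because the window used there contains `w_{4P}`.
  have n0 : w (4 * P) ≠ 0 := by
    have := h1 ⟨2 * P - 2, hl⟩
    rw [e1, pairs, show 3 + 2 * ((2 * P - 2 : ℕ) : ℤ) + 1 = 4 * P by omega] at this
    exact right_ne_zero_of_mul this
  have hne : ∀ j : ℤ, 0 ≤ j → j ≤ 4 * P → w j ≠ 0 := fun j h0 hj => by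
    rcases hj.lt_or_eq with h | rfl
    · exact hw.ne j h0 h
    · exact n0
  have g1 : GamEq α P κ w (2 * P + 1) :=
    GamEq_succ hP (hw.winNe (by omega) le_rfl) (hE _ (by omega)) g0
  have e2 : chiHat α P (pairs P w 2) = pairs P w 4 :=
    chiHat_pairs hP (LamEq_of_GamEq hP (hE _ (by omega)) (hw.gam_all hP (by omega) (by omega)))
      (by rw [show 2 + 2 * (P : ℤ) - 1 = 2 * P + 1 by ring]
          exact LatEq_of_GamEq_of_lifted hP (fun j h1 h2 => hne j (by omega) (by omega))
            (hE _ (by omega)) g1)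
      fun j h1 h2 => hw.ne j (by omega) (by omega)
  have n1 : w (4 * P + 1) ≠ 0 := by
    have := h2 ⟨2 * P - 2, hl⟩
    rw [e0, e2, pairs, show 4 + 2 * ((2 * P - 2 : ℕ) : ℤ) + 1 = 4 * P + 1 by omega] at this
    exact right_ne_zero_of_mul this
  rw [e0, e1]
  refine ⟨w (4 * P + 1), isBT_of_isChain hP hα (w := fun n => w (n + 1 + 1)) ⟨fun k h0 hk => ?_,
    fun k h0 hk => ?_, ?_, ?_, fun j => ?_, fun j => ?_⟩⟩
  · rcases eq_or_ne k (4 * P - 1) with rfl | h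
    · rwa [show 4 * (P : ℤ) - 1 + 1 + 1 = 4 * P + 1 by ring]
    · exact hne _ (by omega) (by omega)
  · have := hE (k + 1 + 1) (by omega)
    rw [← lifted_shift (u := w), ← lifted_shift (u := fun n => w (n + 1))] at this
    exact this
  · have := hw.gam_all hP (k := 0 + 1 + 1) (by omega) (by omega)
    rw [← GamEq_shift (u := w), ← GamEq_shift (u := fun n => w (n + 1))] at this
    exact this
  · congr 1; ring
  · rw [pairs]; congr 2 <;> ring
  · rw [pairs]; congr 2 <;> ring

/-! ## First integrals -/

lemma vOf_succ {j : ℕ} : vOf s ((j : ℤ) + 1) = vOf s j * (coord s j)⁻¹ := by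
  have : ((j : ℤ) + 1).toNat = j + 1 := by omega
  rw [vOf, vOf, this, Finset.prod_range_succ]; simp

lemma eq_mul_vOf {v : ℤ → ℂ} (hv : ∀ n ∈ Set.Icc (0 : ℤ) (2 * P - 1), v n ≠ 0)
    (hs : ∀ j : Fin (2 * P - 1), s j = v (j : ℕ) / v ((j : ℕ) + 1)) {n : ℕ} (hn : n < 2 * P) :
    v n = v 0 * vOf s n := by
  induction n with
  | zero => simp [vOf]
  | succ n ih =>
    have h1 := hv n ⟨by omega, by omega⟩
    have h2 := hv (n + 1) ⟨by omega, by omega⟩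
    have h3 := ih (by omega)
    rw [Nat.cast_succ, vOf_succ, ← mul_assoc, ← h3, coord_of_lt _ (show n < 2 * P - 1 by omega), hs,
      inv_div]
    field_simp

/-- `p_n` depends only on ratios, and the off-diagonal entries scale by `c` and `c⁻¹`. So scaling
`v` amounts to conjugation by `diag(c, 1)`, which leaves the trace of the monodromy unchanged. -/
lemma laxL_scale {c : ℂ} (hc : c ≠ 0) {v w : ℤ → ℂ} {n : ℤ} (h0 : v n = c * w n)
    (h1 : v (n - P) = c * w (n - P)) (h2 : v (n - P + 1) = c * w (n - P + 1)) :
    laxL α P v n * !![C c, 0; 0, 1] = !![C c, 0; 0, 1] * laxL α P w n := by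
  have hp : pCoef α P v n = pCoef α P w n := by
    unfold pCoef
    rw [h0, h1, h2, mul_div_mul_left _ _ hc, mul_left_comm, mul_div_mul_left _ _ hc, mul_div_assoc]
  have hi : (C (w n)⁻¹ : ℂ[X]) = C c * C (v n)⁻¹ := by
    rw [← C_mul, h0, mul_inv, mul_inv_cancel_left₀ hc]
  unfold laxL
  rw [hp, Matrix.mul_fin_two, Matrix.mul_fin_two]
  ext i j : 1
  fin_cases i <;> fin_cases j <;>
    simp only [Fin.mk_zero, Fin.mk_one, Fin.isValue, of_apply, cons_val', cons_val_zero,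
      cons_val_one, cons_val_fin_one]
  · ring
  · rw [h0, C_mul]; ring
  · rw [C_neg, C_neg, hi]; ring
  · ring

lemma adjugate_laxM_scale {c : ℂ} (hc : c ≠ 0) {v w : ℤ → ℂ} {n : ℤ} (h0 : v n = c * w n)
    (h2 : v (n - P + 1) = c * w (n - P + 1)) :
    (laxM α P v n).adjugate * !![C c, 0; 0, 1] = !![C c, 0; 0, 1] * (laxM α P w n).adjugate := by
  have hi : (w (n - P + 1))⁻¹ = c * (v (n - P + 1))⁻¹ := by
    rw [h2, mul_inv, mul_inv_cancel_left₀ hc]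
  unfold laxM
  rw [adjugate_fin_two_of, adjugate_fin_two_of, Matrix.mul_fin_two, Matrix.mul_fin_two]
  ext i j : 1
  fin_cases i <;> fin_cases j <;> simp [hi, h0] <;> ring

lemma prod_map_scale {ι R : Type*} [Monoid R] {D : R} {A B : ι → R} (l : List ι)
    (h : ∀ i ∈ l, A i * D = D * B i) : (l.map A).prod * D = D * (l.map B).prod := by
  induction l with
  | nil => simp
  | cons i l ih =>
    rw [List.map_cons, List.map_cons, List.prod_cons, List.prod_cons, mul_assoc,
      ih fun j hj => h j (List.mem_cons_of_mem _ hj), ← mul_assoc,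
      h i List.mem_cons_self, mul_assoc]

lemma trace_monodromy_eq_vOf (hP : 2 ≤ P) {v : ℤ → ℂ}
    (hv : ∀ n ∈ Set.Icc (0 : ℤ) (2 * P - 1), v n ≠ 0)
    (hs : ∀ j : Fin (2 * P - 1), s j = v (j : ℕ) / v ((j : ℕ) + 1)) :
    (monodromy α P v (2 * P - 1)).trace = (monodromy α P (vOf s) (2 * P - 1)).trace := by
  have hc : v 0 ≠ 0 := hv 0 ⟨le_rfl, by omega⟩
  have hsc : ∀ n : ℤ, 0 ≤ n → n ≤ 2 * P - 1 → v n = v 0 * vOf s n := fun n h0 hn => by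
    obtain ⟨k, rfl⟩ := Int.eq_ofNat_of_zero_le h0
    exact eq_mul_vOf hv hs (by omega)
  apply trace_eq_of_mul_eq (G := !![C (v 0), 0; 0, 1]) (by simp [Matrix.det_fin_two_of, hc])
  unfold monodromy
  rw [mul_assoc, prod_map_scale _ fun i hi => ?_, ← mul_assoc, adjugate_laxM_scale hc, mul_assoc]
  · exact hsc _ (by omega) (by omega)
  · exact hsc _ (by omega) (by omega)
  · have := List.mem_range.1 hi
    exact laxL_scale hc (hsc _ (by omega) (by omega)) (hsc _ (by omega) (by omega))
      (hsc _ (by omega) (by omega))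

theorem traceIntegral_eq_of_isBT (hP : 2 ≤ P) (h : IsBT α P κ x s s') (k : ℕ) :
    traceIntegral α P k s' = traceIntegral α P k s := by
  obtain ⟨v, v', hv, hv', hs, hs', -, hL, hM, -⟩ := h
  unfold traceIntegral
  have hv1 : ∀ n ∈ Set.Icc (0 : ℤ) (2 * P - 1), v n ≠ 0 := fun n hn =>
    hv n ⟨hn.1, by have := hn.2; omega⟩
  have hmul : monodromy α P v (2 * P - 1) * gauge κ v v' (2 * P - 1)
      = gauge κ v v' (2 * P - 1) * monodromy α P v' (2 * P - 1) := by
    refine monodromy_mul_gauge (fun i hi => hL _ ?_) hM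
    constructor <;> omega
  have hlast : v (2 * P - 1 + 1) ≠ 0 := hv _ ⟨by omega, by omega⟩
  rw [← trace_monodromy_eq_vOf hP hv1 hs, ← trace_monodromy_eq_vOf hP hv' hs',
    trace_eq_of_gauge hlast hmul]

end

/-! ## Rational functions and generic properties

`pt` assigns to the points of `X` their coordinates. -/

section Rational

variable {σ X : Type*} {pt : X → σ → ℂ} {x₀ : X}

/-- `p` holds outside the zero set of a polynomial that does not vanish at `x₀`. -/
def GenericAt (pt : X → σ → ℂ) (x₀ : X) (p : X → Prop) : Prop :=
  ∃ Q : MvPolynomial σ ℂ, MvPolynomial.eval (pt x₀) Q ≠ 0 ∧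
    ∀ x, MvPolynomial.eval (pt x) Q ≠ 0 → p x

/-- `f` is a rational function that is regular at `x₀`. -/
def RegularAt (pt : X → σ → ℂ) (x₀ : X) (f : X → ℂ) : Prop :=
  ∃ A B : MvPolynomial σ ℂ, MvPolynomial.eval (pt x₀) B ≠ 0 ∧
    ∀ x, MvPolynomial.eval (pt x) B ≠ 0 →
      f x = MvPolynomial.eval (pt x) A / MvPolynomial.eval (pt x) B

namespace GenericAt

variable {p q : X → Prop}

lemma of_forall (h : ∀ x, p x) : GenericAt pt x₀ p := ⟨1, by simp, fun x _ => h x⟩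

lemma mono (hp : GenericAt pt x₀ p) (h : ∀ x, p x → q x) : GenericAt pt x₀ q :=
  hp.imp fun _ hQ => ⟨hQ.1, fun x hx => h x (hQ.2 x hx)⟩

lemma and (hp : GenericAt pt x₀ p) (hq : GenericAt pt x₀ q) :
    GenericAt pt x₀ fun x => p x ∧ q x := by
  obtain ⟨Q, h1, h2⟩ := hp
  obtain ⟨R, h3, h4⟩ := hq
  refine ⟨Q * R, by simp [h1, h3], fun x hx => ?_⟩
  rw [map_mul] at hx
  exact ⟨h2 x (left_ne_zero_of_mul hx), h4 x (right_ne_zero_of_mul hx)⟩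

lemma forall_lt {p : ℕ → X → Prop} (N : ℕ) (h : ∀ i < N, GenericAt pt x₀ (p i)) :
    GenericAt pt x₀ fun x => ∀ i < N, p i x := by
  induction N with
  | zero => exact of_forall fun x i hi => absurd hi (Nat.not_lt_zero i)
  | succ N ih =>
    refine ((ih fun i hi => h i (by omega)).and (h N (Nat.lt_succ_self N))).mono
      fun x hx i hi => ?_
    rcases Nat.lt_succ_iff_lt_or_eq.1 hi with h1 | rfl
    · exact hx.1 i h1
    · exact hx.2

end GenericAt

namespace RegularAt

variable {f g : X → ℂ}

lemma const (c : ℂ) : RegularAt pt x₀ fun _ => c :=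
  ⟨MvPolynomial.C c, 1, by simp, fun x _ => by simp⟩

lemma coord (i : σ) : RegularAt pt x₀ fun x => pt x i :=
  ⟨MvPolynomial.X i, 1, by simp, fun x _ => by simp⟩

lemma add (hf : RegularAt pt x₀ f) (hg : RegularAt pt x₀ g) :
    RegularAt pt x₀ fun x => f x + g x := by
  obtain ⟨A, B, h1, h2⟩ := hf
  obtain ⟨A', B', h3, h4⟩ := hg
  refine ⟨A * B' + A' * B, B * B', by simp [h1, h3], fun x hx => ?_⟩
  rw [map_mul] at hx
  have k1 := left_ne_zero_of_mul hx
  have k2 := right_ne_zero_of_mul hx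
  beta_reduce
  rw [h2 x k1, h4 x k2, map_add, map_mul, map_mul, map_mul]
  field_simp

lemma mul (hf : RegularAt pt x₀ f) (hg : RegularAt pt x₀ g) :
    RegularAt pt x₀ fun x => f x * g x := by
  obtain ⟨A, B, h1, h2⟩ := hf
  obtain ⟨A', B', h3, h4⟩ := hg
  refine ⟨A * A', B * B', by simp [h1, h3], fun x hx => ?_⟩
  rw [map_mul] at hx
  have k1 := left_ne_zero_of_mul hx
  have k2 := right_ne_zero_of_mul hx
  beta_reduce
  rw [h2 x k1, h4 x k2, map_mul, map_mul]
  field_simp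

lemma sub (hf : RegularAt pt x₀ f) (hg : RegularAt pt x₀ g) :
    RegularAt pt x₀ fun x => f x - g x := by
  have := hf.add ((const (-1)).mul hg)
  simpa [sub_eq_add_neg] using this

lemma inv (hf : RegularAt pt x₀ f) (h0 : f x₀ ≠ 0) : RegularAt pt x₀ fun x => (f x)⁻¹ := by
  obtain ⟨A, B, h1, h2⟩ := hf
  rw [h2 x₀ h1, div_ne_zero_iff] at h0
  -- The denominator is `A B` and not `A`: its nonvanishing must also guarantee `B ≠ 0`, where the
  -- formula for `f` is valid.
  refine ⟨B * B, A * B, by simp [h0.1, h1], fun x hx => ?_⟩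
  rw [map_mul] at hx
  have k1 := left_ne_zero_of_mul hx
  have k2 := right_ne_zero_of_mul hx
  beta_reduce
  rw [h2 x k2, map_mul, map_mul]
  field_simp

lemma div (hf : RegularAt pt x₀ f) (hg : RegularAt pt x₀ g) (h0 : g x₀ ≠ 0) :
    RegularAt pt x₀ fun x => f x / g x := by
  simpa [div_eq_mul_inv] using hf.mul (hg.inv h0)

lemma prod {ι : Type*} (t : Finset ι) {F : ι → X → ℂ} (h : ∀ i ∈ t, RegularAt pt x₀ (F i)) :
    RegularAt pt x₀ fun x => ∏ i ∈ t, F i x := by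
  classical
  induction t using Finset.induction_on with
  | empty => simpa using const 1
  | insert i t hi ih =>
    simp only [Finset.prod_insert hi]
    exact (h i (Finset.mem_insert_self i t)).mul
      (ih fun j hj => h j (Finset.mem_insert_of_mem hj))

lemma eval {τ : Type*} {F : X → τ → ℂ} (h : ∀ i, RegularAt pt x₀ fun x => F x i)
    (Q : MvPolynomial τ ℂ) : RegularAt pt x₀ fun x => MvPolynomial.eval (F x) Q := by
  induction Q using MvPolynomial.induction_on with
  | C a => simpa using const a
  | add p q hp hq => simpa using hp.add hq
  | mul_X p i hp => simpa using hp.mul (h i)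

lemma generic_ne (hf : RegularAt pt x₀ f) (h0 : f x₀ ≠ 0) : GenericAt pt x₀ fun x => f x ≠ 0 := by
  obtain ⟨A, B, h1, h2⟩ := hf
  rw [h2 x₀ h1, div_ne_zero_iff] at h0
  refine ⟨A * B, by simp [h0.1, h1], fun x hx => ?_⟩
  rw [map_mul] at hx
  rw [h2 x (right_ne_zero_of_mul hx)]
  exact div_ne_zero (left_ne_zero_of_mul hx) (right_ne_zero_of_mul hx)

lemma generic_differentiableAt [Fintype σ] [NormedAddCommGroup X] [NormedSpace ℂ X]
    (hpt : Differentiable ℂ pt) (hf : RegularAt pt x₀ f) :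
    GenericAt pt x₀ fun x => DifferentiableAt ℂ f x := by
  obtain ⟨A, B, h1, h2⟩ := hf
  have hd : ∀ Q : MvPolynomial σ ℂ, Differentiable ℂ fun x => MvPolynomial.eval (pt x) Q := by
    intro Q
    induction Q using MvPolynomial.induction_on with
    | C a => simp
    | add p q hp hq => simpa only [map_add] using hp.fun_add hq
    | mul_X p i hp =>
      simpa only [map_mul, MvPolynomial.eval_X] using hp.fun_mul (differentiable_pi.1 hpt i)
  refine ⟨B, h1, fun x hx => ?_⟩
  have hopen : ∀ᶠ y in 𝓝 x, MvPolynomial.eval (pt y) B ≠ 0 :=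
    (hd B).continuous.continuousAt.eventually_ne hx
  have hA : DifferentiableAt ℂ (fun x => MvPolynomial.eval (pt x) A) x := hd A x
  have hB : DifferentiableAt ℂ (fun x => MvPolynomial.eval (pt x) B) x := hd B x
  have hAB := hA.fun_mul (hB.fun_inv hx)
  exact hAB.congr_of_eventuallyEq (hopen.mono fun y hy => by rw [h2 y hy, div_eq_mul_inv])

end RegularAt

/-- A polynomial condition defines an open set. -/
lemma isOpen_eval_ne [Fintype σ] [TopologicalSpace X] (hpt : Continuous pt)
    (Q : MvPolynomial σ ℂ) : IsOpen {x | MvPolynomial.eval (pt x) Q ≠ 0} :=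
  isOpen_ne_fun ((MvPolynomial.continuous_eval Q).comp hpt) continuous_const

end Rational

/-! ## The correspondence as a quadratic equation for the gauge variable -/

section Quadratic

variable {α κ x : ℂ} {P : ℕ} {s s' : Fin (2 * P - 1) → ℂ} {w : ℤ → ℂ}

/-- The coordinates `s_0, …, s_{N-1}`, continued by `s_N`. -/
def sExt (α : ℂ) (P : ℕ) (s : Fin (2 * P - 1) → ℂ) (n : ℕ) : ℂ :=
  if n < 2 * P - 1 then coord s n else coord (chiHat α P s) (2 * P - 2)

/-- The sum `u_{2n-1} + u_{2n}` as a function of `κ` and `s`. -/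
def pairSum (α : ℂ) (P : ℕ) (κ : ℂ) (s : Fin (2 * P - 1) → ℂ) (n : ℕ) : ℂ :=
  if P ≤ n then ((∏ i ∈ Finset.range P, sExt α P s (n - P + i))
      + α ^ 2 / (∏ i ∈ Finset.range (P - 1), sExt α P s (n - P + 1 + i)) - (1 - α * κ)) / α
  else ((∏ i ∈ Finset.range P, sExt α P s (n + i))
      + α ^ 2 / (∏ i ∈ Finset.range (P - 1), sExt α P s (n + i)) - (1 - α * κ)) / α

/-- The solution with initial values `a, b` of the linear recurrence whose ratios of successive
terms are the odd terms of `u`. -/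
def linRec (α : ℂ) (P : ℕ) (κ : ℂ) (s : Fin (2 * P - 1) → ℂ) (a b : ℂ) : ℕ → ℂ
  | 0 => a
  | 1 => b
  | m + 2 => pairSum α P κ s (2 * P - (m + 1)) * linRec α P κ s a b (m + 1)
      - sExt α P s (2 * P - (m + 1)) * linRec α P κ s a b m

/-- Every term is affine in the starting value `x`; this is why the closing relation has degree two
in `x`. -/
lemma linRec_eq (m : ℕ) :
    linRec α P κ s 1 x m = linRec α P κ s 0 1 m * x + linRec α P κ s 1 0 m := by
  induction m using Nat.twoStepInduction with
  | zero => simp [linRec]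
  | one => simp [linRec]
  | more m h0 h1 => simp only [linRec, h0, h1]; ring

/-- The product `s_P ⋯ s_{2P-1}`. -/
def topProd (α : ℂ) (P : ℕ) (s : Fin (2 * P - 1) → ℂ) : ℂ :=
  ∏ i ∈ Finset.range P, sExt α P s (P + i)

/-- The difference of `1 - α κ` and `α² / (s_P ⋯ s_{2P-2})`. -/
def shiftedParam (α : ℂ) (P : ℕ) (κ : ℂ) (s : Fin (2 * P - 1) → ℂ) : ℂ :=
  1 - α * κ - α ^ 2 / ∏ i ∈ Finset.range (P - 1), sExt α P s (P + i)

/-- The leading coefficient of the quadratic equation for the gauge variable. -/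
def quadCoeff₂ (α : ℂ) (P : ℕ) (κ : ℂ) (s : Fin (2 * P - 1) → ℂ) : ℂ :=
  α * linRec α P κ s 0 1 (P + 1) + shiftedParam α P κ s * linRec α P κ s 0 1 P

/-- The linear coefficient of the quadratic equation for the gauge variable. -/
def quadCoeff₁ (α : ℂ) (P : ℕ) (κ : ℂ) (s : Fin (2 * P - 1) → ℂ) : ℂ :=
  α * linRec α P κ s 1 0 (P + 1) - topProd α P s * linRec α P κ s 0 1 (P + 1)
    + shiftedParam α P κ s * linRec α P κ s 1 0 P
    + α * sExt α P s (2 * P - 1) * linRec α P κ s 0 1 P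

/-- The constant coefficient of the quadratic equation for the gauge variable. -/
def quadCoeff₀ (α : ℂ) (P : ℕ) (κ : ℂ) (s : Fin (2 * P - 1) → ℂ) : ℂ :=
  α * sExt α P s (2 * P - 1) * linRec α P κ s 1 0 P - topProd α P s * linRec α P κ s 1 0 (P + 1)

/-- The quadratic polynomial with the gauge variables as its zeros. -/
def quad (α : ℂ) (P : ℕ) (κ : ℂ) (s : Fin (2 * P - 1) → ℂ) (x : ℂ) : ℂ :=
  quadCoeff₂ α P κ s * x ^ 2 + quadCoeff₁ α P κ s * x + quadCoeff₀ α P κ s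

/-- This is the closing relation of `HasPairs.gamEq_iff` with `w_{2P-1}` replaced by the ratio of
the terms of `linRec` with numbers `P + 1` and `P`, cleared of denominators. -/
lemma quad_eq : quad α P κ s x
    = linRec α P κ s 1 x P * (α * sExt α P s (2 * P - 1) + shiftedParam α P κ s * x)
      - linRec α P κ s 1 x (P + 1) * (topProd α P s - α * x) := by
  rw [linRec_eq (x := x) P, linRec_eq (x := x) (P + 1), quad, quadCoeff₂, quadCoeff₁, quadCoeff₀]; ring

/-- The image of `s` that belongs to the gauge variable `x`. -/
def chiOf (α : ℂ) (P : ℕ) (κ : ℂ) (s : Fin (2 * P - 1) → ℂ) (x : ℂ) : Fin (2 * P - 1) → ℂ :=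
  fun j => sExt α P s ((j : ℕ) + 1) * (linRec α P κ s 1 x (2 * P - j)
    * linRec α P κ s 1 x (2 * P - j - 2)) / linRec α P κ s 1 x (2 * P - j - 1) ^ 2

lemma sExt_of_lt {n : ℕ} (h : n < 2 * P - 1) : sExt α P s n = s ⟨n, h⟩ := by
  rw [sExt, if_pos h, coord_of_lt]

/-- The equation that defines `s_N`. -/
lemma sExt_toda (hP : 2 ≤ P) (h : ∀ n < 2 * P, sExt α P s n ≠ 0) :
    (∏ i ∈ Finset.range P, sExt α P s (P + i))
      + α ^ 2 / (∏ i ∈ Finset.range (P - 1), sExt α P s (P + i))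
    = (∏ i ∈ Finset.range P, sExt α P s i)
      + α ^ 2 / (∏ i ∈ Finset.range (P - 1), sExt α P s (1 + i)) := by
  obtain ⟨p, rfl⟩ : ∃ p, P = p + 1 := ⟨P - 1, by omega⟩
  have hlast : sExt α (p + 1) s (p + 1 + p) = ((∏ i ∈ Finset.Icc 0 (p + 1 - 1), coord s i)
      - α ^ 2 * (1 / (∏ i ∈ Finset.Icc (p + 1) (2 * (p + 1) - 2), coord s i)
        - 1 / (∏ i ∈ Finset.Icc 1 (p + 1 - 1), coord s i)))
      / ∏ i ∈ Finset.Icc (p + 1) (2 * (p + 1) - 2), coord s i := by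
    rw [sExt, if_neg (by omega), coord_of_lt _ (by omega), chiHat, if_neg (by simp; omega)]
  have hco : ∀ n < 2 * (p + 1) - 1, coord s n = sExt α (p + 1) s n := fun n hn => by
    rw [sExt, if_pos hn]
  have e0 : ∏ i ∈ Finset.Icc 0 (p + 1 - 1), coord s i
      = ∏ i ∈ Finset.range (p + 1), sExt α (p + 1) s i := by
    rw [prod_Icc_eq_range]
    refine Finset.prod_congr (by simp) fun i hi => ?_
    rw [zero_add, hco _ (by have := Finset.mem_range.1 hi; omega)]
  have e1 : ∏ i ∈ Finset.Icc (p + 1) (2 * (p + 1) - 2), coord s i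
      = ∏ i ∈ Finset.range p, sExt α (p + 1) s (p + 1 + i) := by
    rw [prod_Icc_eq_range, show 2 * (p + 1) - 2 + 1 - (p + 1) = p by omega]
    exact Finset.prod_congr rfl fun i hi => hco _ (by have := Finset.mem_range.1 hi; omega)
  have e2 : ∏ i ∈ Finset.Icc 1 (p + 1 - 1), coord s i
      = ∏ i ∈ Finset.range p, sExt α (p + 1) s (1 + i) := by
    rw [prod_Icc_eq_range, show p + 1 - 1 + 1 - 1 = p by omega]
    exact Finset.prod_congr rfl fun i hi => hco _ (by have := Finset.mem_range.1 hi; omega)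
  have hne : ∏ i ∈ Finset.range p, sExt α (p + 1) s (p + 1 + i) ≠ 0 :=
    Finset.prod_ne_zero_iff.2 fun i hi => h _ (by have := Finset.mem_range.1 hi; omega)
  rw [e0, e1, e2] at hlast
  rw [Finset.prod_range_succ (fun i => sExt α (p + 1) s (p + 1 + i)), hlast, Nat.add_sub_cancel,
    mul_div_cancel₀ _ hne]
  ring

/-- The terms of `w` have the pairwise products `s_n`. -/
def HasPairs (α : ℂ) (P : ℕ) (s : Fin (2 * P - 1) → ℂ) (w : ℤ → ℂ) : Prop :=
  ∀ n < 2 * P, sExt α P s n = w (2 * n) * w (2 * n + 1)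

lemma HasPairs.prod (h : HasPairs α P s w) {a m : ℕ} (ham : a + m ≤ 2 * P) :
    ∏ i ∈ Finset.range m, sExt α P s (a + i) = wprod w (2 * a) (2 * m) := by
  induction m with
  | zero => simp
  | succ m ih =>
    rw [Finset.prod_range_succ, ih (by omega), h _ (by omega), show 2 * (m + 1) = 2 * m + 1 + 1 by ring,
      wprod_succ, wprod_succ, mul_assoc]
    push_cast
    rw [show 2 * ((a : ℤ) + m) = 2 * a + 2 * m by ring,
      show 2 * (a : ℤ) + 2 * m + 1 = 2 * a + (2 * m + 1) by ring]

/-- For `n ≥ P` the sum is read off from `s_{n-P}, …, s_{n-1}`. For `n < P` those indices are not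
available, and `LatEq` expresses it by `s_n, …, s_{n+P-1}` instead. -/
lemma HasPairs.lamEq_iff (h : HasPairs α P s w) (hP : 2 ≤ P) (hα : α ≠ 0) {n : ℕ} (h0 : P ≤ n)
    (h1 : n < 2 * P) :
    LamEq α P κ w (2 * n - 2 * P) ↔ pairSum α P κ s n = w (2 * n - 1) + w (2 * n) := by
  have e1 := h.prod (a := n - P) (m := P) (by omega)
  have e2 := h.prod (a := n - P + 1) (m := P - 1) (by omega)
  rw [pairSum, if_pos h0, e1, e2, div_eq_iff hα]
  unfold LamEq
  rw [mul_wprod_mul hP, show 2 * ((n - P : ℕ) : ℤ) = 2 * n - 2 * P by omega,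
    show 2 * ((n - P + 1 : ℕ) : ℤ) = 2 * n - 2 * P + 2 by omega,
    show 2 * (P - 1) = 2 * P - 2 by omega,
    show 2 * (n : ℤ) - 2 * P + 2 * P - 1 = 2 * n - 1 by ring,
    show 2 * (n : ℤ) - 2 * P + 2 * P = 2 * n by ring]
  constructor <;> intro h <;> linear_combination -h

lemma latEq_odd_iff (hP : 2 ≤ P) {n : ℤ} : LatEq α P κ w (2 * n - 1) ↔
    1 - α * κ = wprod w (2 * n) (2 * P) - α * w (2 * n - 1) - α * w (2 * n)
      + α ^ 2 / wprod w (2 * n) (2 * P - 2) := by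
  unfold LatEq
  rw [show 2 * n - 1 + 2 = 2 * n + 1 by ring, show 2 * n - 1 + 1 = 2 * n by ring,
    show 2 * n - 1 + 2 * P = 2 * n + 2 * P - 1 by ring, mul_wprod_mul hP]

lemma HasPairs.latEq_iff (h : HasPairs α P s w) (hP : 2 ≤ P) (hα : α ≠ 0)
    (hne : ∀ n < 2 * P, sExt α P s n ≠ 0) {n : ℕ} (h1 : n ≤ P) :
    LatEq α P κ w (2 * n - 1) ↔ pairSum α P κ s n = w (2 * n - 1) + w (2 * n) := by
  have e1 := h.prod (a := n) (m := P) (by omega)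
  have e2 := h.prod (a := n) (m := P - 1) (by omega)
  have key : pairSum α P κ s n = ((∏ i ∈ Finset.range P, sExt α P s (n + i))
      + α ^ 2 / (∏ i ∈ Finset.range (P - 1), sExt α P s (n + i)) - (1 - α * κ)) / α := by
    rcases h1.lt_or_eq with h2 | rfl
    · rw [pairSum, if_neg (by omega)]
    -- At `n = P` the two formulas for the sum agree, by the equation that defines `s_N`.
    · rw [pairSum, if_pos le_rfl, sExt_toda hP hne]
      simp
  rw [key, e1, e2, div_eq_iff hα, latEq_odd_iff hP, show 2 * (P - 1) = 2 * P - 2 by omega]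
  constructor <;> intro h <;> linear_combination -h

/-- Multiplication by `w_{4P-1}` completes all products to products of the `s_n`, so that only
`w_{2P-1}` and `w_{4P-1}` remain. -/
lemma HasPairs.gamEq_iff (h : HasPairs α P s w) (hP : 2 ≤ P)
    (hx : w (4 * P - 1) ≠ 0) :
    GamEq α P κ w (2 * P - 1) ↔ w (2 * P - 1) * (topProd α P s - α * w (4 * P - 1))
      = α * sExt α P s (2 * P - 1) + shiftedParam α P κ s * w (4 * P - 1) := by
  obtain ⟨p, rfl⟩ : ∃ p, P = p + 1 := ⟨P - 1, by omega⟩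
  have e1 := h.prod (a := p + 1) (m := p + 1) (by omega)
  have e2 := h.prod (a := p + 1) (m := p) (by omega)
  have e3 := h (2 * (p + 1) - 1) (by omega)
  have hx' : w (4 * p + 3) ≠ 0 := by
    rwa [show 4 * ((p + 1 : ℕ) : ℤ) - 1 = 4 * p + 3 by push_cast; ring] at hx
  rw [topProd, shiftedParam, e1, Nat.add_sub_cancel, e2, e3]
  unfold GamEq
  rw [show 2 * (p + 1) - 2 = 2 * p by omega, show 2 * (p + 1) = 2 * p + 1 + 1 by ring, wprod_succ,
    wprod_succ]
  push_cast
  rw [show (2 : ℤ) * (p + 1) - 1 + 1 = 2 * (p + 1) by ring,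
    show (2 : ℤ) * (p + 1) - 1 + 2 * (p + 1) - 1 = 4 * p + 2 by ring,
    show (2 : ℤ) * (p + 1) + 2 * p = 4 * p + 2 by ring,
    show (2 : ℤ) * (p + 1) + (2 * p + 1) = 4 * p + 3 by ring,
    show (4 : ℤ) * (p + 1) - 1 = 4 * p + 3 by ring,
    show (2 : ℤ) * (2 * p + 1) = 4 * p + 2 by ring,
    show (4 : ℤ) * p + 2 + 1 = 4 * p + 3 by ring] at *
  constructor
  · intro h; linear_combination -w (4 * p + 3) * h
  · intro h; apply mul_left_cancel₀ hx'; linear_combination -h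

lemma IsChain.hasPairs (h : IsChain α P κ x s s' w) (hP : 2 ≤ P) : HasPairs α P s w := by
  intro n hn
  rcases Nat.lt_or_ge n (2 * P - 1) with h1 | h1
  · rw [sExt_of_lt h1, h.even]
  · obtain rfl : n = 2 * P - 1 := by omega
    have hs := h.eq_pairs.1
    have h2 := chiHat_pairs hP (h.lamEq hP le_rfl (by omega))
      (h.latEq hP (k := 0 + 2 * P - 1) (by omega) (by omega))
      (fun j h1 h2 => h.ne j (by omega) (by omega))
    rw [sExt, if_neg (by omega), hs, h2, coord_pairs _ _ (by omega)]
    congr 2 <;> omega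

lemma IsChain.pairSum_eq (h : IsChain α P κ x s s' w) (hP : 2 ≤ P) (hα : α ≠ 0) {n : ℕ}
    (h0 : 1 ≤ n) (hn : n < 2 * P) : pairSum α P κ s n = w (2 * n - 1) + w (2 * n) := by
  have hp := h.hasPairs hP
  rcases Nat.lt_or_ge n P with h1 | h1
  · refine (hp.latEq_iff hP hα (fun n hn => ?_) h1.le).1 (h.latEq hP (by omega) (by omega))
    rw [hp n hn]
    exact mul_ne_zero (h.ne _ (by omega) (by omega)) (h.ne _ (by omega) (by omega))
  · exact (hp.lamEq_iff hP hα h1 hn).1 (h.lamEq hP (by omega) (by omega))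

/-- Sum and product relations combine to the Riccati recursion `w_{2n-1} = pairSum n - s_n /
w_{2n+1}`, which runs downwards from `w_{4P-1} = x`. Writing the odd terms as ratios of successive
terms linearises it. -/
lemma IsChain.linRec_eq (h : IsChain α P κ x s s' w) (hP : 2 ≤ P) (hα : α ≠ 0) {m : ℕ}
    (hm : m < 2 * P) : linRec α P κ s 1 x m ≠ 0 ∧ linRec α P κ s 1 x (m + 1)
      = w (4 * P - 2 * m - 1) * linRec α P κ s 1 x m := by
  induction m with
  | zero => simp [linRec, h.last]
  | succ m ih =>
    obtain ⟨h1, h2⟩ := ih (by omega)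
    have h3 : linRec α P κ s 1 x (m + 1) ≠ 0 := by
      rw [h2]; exact mul_ne_zero (h.ne _ (by omega) (by omega)) h1
    refine ⟨h3, ?_⟩
    have hs := h.hasPairs hP (2 * P - (m + 1)) (by omega)
    have hw := h.pairSum_eq hP hα (n := 2 * P - (m + 1)) (by omega) (by omega)
    rw [show 2 * ((2 * P - (m + 1) : ℕ) : ℤ) = 4 * P - 2 * m - 2 by omega] at hs hw
    rw [linRec, hs, hw]
    push_cast
    rw [show 4 * (P : ℤ) - 2 * m - 2 + 1 = 4 * P - 2 * m - 1 by ring,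
      show 4 * (P : ℤ) - 2 * m - 2 - 1 = 4 * P - 2 * (m + 1) - 1 by ring]
    linear_combination w (4 * P - 2 * m - 2) * h2

lemma IsChain.even_mul (h : IsChain α P κ x s s' w) (hP : 2 ≤ P) (hα : α ≠ 0) {m : ℕ}
    (hm : m < 2 * P) : w (4 * P - 2 * m - 2) * linRec α P κ s 1 x (m + 1)
      = sExt α P s (2 * P - (m + 1)) * linRec α P κ s 1 x m := by
  obtain ⟨h1, h2⟩ := h.linRec_eq hP hα hm
  have hs := h.hasPairs hP (2 * P - (m + 1)) (by omega)
  rw [show 2 * ((2 * P - (m + 1) : ℕ) : ℤ) = 4 * P - 2 * m - 2 by omega,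
    show 4 * (P : ℤ) - 2 * m - 2 + 1 = 4 * P - 2 * m - 1 by ring] at hs
  rw [h2, hs]; ring

theorem IsChain.quad_and_eq (h : IsChain α P κ x s s' w) (hP : 2 ≤ P) (hα : α ≠ 0) :
    quad α P κ s x = 0 ∧ s' = chiOf α P κ s x := by
  constructor
  · have h1 := ((h.hasPairs hP).gamEq_iff hP (h.ne _ (by omega) (by omega))).1
      (h.gam_all hP (by omega) (by omega))
    have h2 := (h.linRec_eq hP hα (m := P) (by omega)).2
    rw [show 4 * (P : ℤ) - 2 * P - 1 = 2 * P - 1 by ring] at h2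
    rw [quad_eq, h2]
    rw [← h.last] at h1
    linear_combination -linRec α P κ s 1 x P * h1
  · funext j
    have hj := j.2
    obtain ⟨m, hm⟩ : ∃ m, 2 * P - (j : ℕ) - 2 = m := ⟨_, rfl⟩
    obtain ⟨h1, h2⟩ := h.linRec_eq hP hα (m := m + 1) (by omega)
    have h3 := h.even_mul hP hα (m := m) (by omega)
    rw [h.odd, chiOf, show 2 * P - (j : ℕ) = m + 2 by omega, show m + 2 - 2 = m by omega,
      show m + 2 - 1 = m + 1 by omega, show (j : ℕ) + 1 = 2 * P - (m + 1) by omega,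
      eq_div_iff (pow_ne_zero 2 h1), h2]
    rw [show 4 * (P : ℤ) - 2 * (m + 1 : ℕ) - 1 = 2 * (j : ℕ) + 1 by omega,
      show 4 * (P : ℤ) - 2 * m - 2 = 2 * (j : ℕ) + 2 by omega] at *
    linear_combination w (2 * (j : ℕ) + 1) * linRec α P κ s 1 x (m + 1) * h3

/-- The chain that belongs to a zero of the quadratic polynomial. -/
def chainOf (α : ℂ) (P : ℕ) (κ : ℂ) (s : Fin (2 * P - 1) → ℂ) (x : ℂ) : ℤ → ℂ := fun k =>
  if Even k then sExt α P s (k / 2).toNat * linRec α P κ s 1 x (2 * P - (k / 2).toNat - 1)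
      / linRec α P κ s 1 x (2 * P - (k / 2).toNat)
  else linRec α P κ s 1 x (2 * P - (k / 2).toNat) / linRec α P κ s 1 x (2 * P - (k / 2).toNat - 1)

lemma chainOf_even (n : ℕ) : chainOf α P κ s x (2 * n) = sExt α P s n
    * linRec α P κ s 1 x (2 * P - n - 1) / linRec α P κ s 1 x (2 * P - n) := by
  simp [chainOf]

lemma chainOf_odd (n : ℕ) : chainOf α P κ s x (2 * n + 1) = linRec α P κ s 1 x (2 * P - n)
    / linRec α P κ s 1 x (2 * P - n - 1) := by
  have h : ¬ Even (2 * (n : ℤ) + 1) := by simp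
  rw [chainOf, if_neg h, show (2 * (n : ℤ) + 1) / 2 = n by omega, Int.toNat_natCast]

/-- By construction the prescribed products and sums hold, which amounts to `LamEq` at even and
`LatEq` at odd positions below `2P - 1`. The quadratic equation adds `GamEq` at `2P - 1`, so descent
applies. The top equation (1) comes from `GamEq` and `LatEq` at `2P - 1`. -/
theorem isChain_chainOf (hP : 2 ≤ P) (hα : α ≠ 0) (hs : ∀ n < 2 * P, sExt α P s n ≠ 0)
    (hY : ∀ m ≤ 2 * P, linRec α P κ s 1 x m ≠ 0) (hq : quad α P κ s x = 0) :
    IsChain α P κ x s (chiOf α P κ s x) (chainOf α P κ s x) := by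
  set w := chainOf α P κ s x with hw
  have hne : ∀ k : ℤ, 0 ≤ k → k < 4 * P → w k ≠ 0 := by
    intro k h0 hk
    obtain ⟨n, rfl⟩ := Int.eq_ofNat_of_zero_le h0
    obtain ⟨i, rfl | rfl⟩ := Nat.even_or_odd' n
    · push_cast; rw [hw, chainOf_even]
      exact div_ne_zero (mul_ne_zero (hs _ (by omega)) (hY _ (by omega))) (hY _ (by omega))
    · push_cast; rw [hw, chainOf_odd]
      exact div_ne_zero (hY _ (by omega)) (hY _ (by omega))
  have hp : HasPairs α P s w := by
    intro n hn
    rw [hw, chainOf_even, chainOf_odd]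
    have h1 := hY (2 * P - n) (by omega)
    have h2 := hY (2 * P - n - 1) (by omega)
    field_simp
  have hsum : ∀ n : ℕ, 1 ≤ n → n < 2 * P → pairSum α P κ s n = w (2 * n - 1) + w (2 * n) := by
    intro n h0 hn
    obtain ⟨m, hm⟩ : ∃ m, 2 * P - n - 1 = m := ⟨_, rfl⟩
    have h1 := hY (m + 1) (by omega)
    rw [show 2 * (n : ℤ) - 1 = 2 * (n - 1 : ℕ) + 1 by omega, hw, chainOf_even, chainOf_odd,
      show 2 * P - (n - 1) = m + 2 by omega, show 2 * P - n - 1 = m by omega,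
      show 2 * P - n = m + 1 by omega, show m + 2 - 1 = m + 1 by omega, linRec,
      show 2 * P - (m + 1) = n by omega, ← add_div, sub_add_cancel, mul_div_assoc, div_self h1,
      mul_one]
  have hlast : w (4 * P - 1) = x := by
    rw [show 4 * (P : ℤ) - 1 = 2 * (2 * P - 1 : ℕ) + 1 by omega, hw, chainOf_odd,
      show 2 * P - (2 * P - 1) = 1 by omega]
    simp [linRec]
  have hG : GamEq α P κ w (2 * P - 1) := by
    rw [hp.gamEq_iff hP (hne _ (by omega) (by omega)), hlast]
    have h1 := hY P (by omega)
    have e : w (2 * P - 1) = linRec α P κ s 1 x (P + 1) / linRec α P κ s 1 x P := by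
      rw [show 2 * (P : ℤ) - 1 = 2 * (P - 1 : ℕ) + 1 by omega, hw, chainOf_odd,
        show 2 * P - (P - 1) = P + 1 by omega, Nat.add_sub_cancel]
    rw [e]
    rw [quad_eq] at hq
    field_simp
    linear_combination -hq
  have hLat : ∀ n : ℕ, 1 ≤ n → n ≤ P → LatEq α P κ w (2 * n - 1) := fun n h0 hn =>
    (hp.latEq_iff hP hα hs hn).2 (hsum n h0 (by omega))
  have hdesc := lifted_and_GamEq_of_descent (K := 2 * P - 1) (κ := κ) (w := w) hP hα
    (fun k h0 h1 => hne k h0 (by omega))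
    (by rw [show ((2 * P - 1 : ℕ) : ℤ) = 2 * P - 1 by omega]; exact hG) (by
      intro k h0 hk
      obtain ⟨n, rfl⟩ := Int.eq_ofNat_of_zero_le h0
      obtain ⟨i, rfl | rfl⟩ := Nat.even_or_odd' n
      · left
        have := (hp.lamEq_iff (κ := κ) hP hα (n := i + P) (by omega) (by omega)).2
          (hsum _ (by omega) (by omega))
        rwa [show 2 * ((i + P : ℕ) : ℤ) - 2 * P = ((2 * i : ℕ) : ℤ) by push_cast; ring] at this
      · right
        have := hLat (i + 1) (by omega) (by omega)
        rwa [show 2 * ((i + 1 : ℕ) : ℤ) - 1 = ((2 * i + 1 : ℕ) : ℤ) by push_cast; ring] at this)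
  refine ⟨hne, fun k h0 hk => ?_, hdesc.2 0 le_rfl (by omega), hlast.symm, fun j => ?_,
    fun j => ?_⟩
  · rcases (show k < ((2 * P - 1 : ℕ) : ℤ) ∨ k = 2 * P - 1 by omega) with h | rfl
    · exact hdesc.1 k h0 h
    · exact lifted_of_LatEq hP (fun j h1 h2 => hne j (by omega) (by omega)) hG
        (hLat P (by omega) le_rfl)
  · rw [← hp j (by omega), sExt_of_lt j.2]
  · have hj := j.2
    rw [show 2 * ((j : ℕ) : ℤ) + 2 = 2 * ((j + 1 : ℕ) : ℤ) by push_cast; ring, hw, chainOf_odd,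
      chainOf_even, chiOf, show 2 * P - ((j : ℕ) + 1) = 2 * P - j - 1 by omega,
      show 2 * P - (j : ℕ) - 1 - 1 = 2 * P - j - 2 by omega]
    have h1 := hY (2 * P - j - 1) (by omega)
    field_simp

theorem isBT_iff_quad (hP : 2 ≤ P) (hα : α ≠ 0) (hs : ∀ n < 2 * P, sExt α P s n ≠ 0)
    (hY : quad α P κ s x = 0 → ∀ m ≤ 2 * P, linRec α P κ s 1 x m ≠ 0) :
    IsBT α P κ x s s' ↔ quad α P κ s x = 0 ∧ s' = chiOf α P κ s x := by
  rw [isBT_iff_exists_isChain hP hα]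
  constructor
  · rintro ⟨w, hw⟩; exact hw.quad_and_eq hP hα
  · rintro ⟨hq, rfl⟩; exact ⟨_, isChain_chainOf hP hα hs (hY hq) hq⟩

/-- The gauge variable is determined by `s` and `s'`. -/
theorem gauge_variable_unique (hP : 2 ≤ P) (hα : α ≠ 0) {x₁ x₂ : ℂ}
    (h1 : IsBT α P κ x₁ s s') (h2 : IsBT α P κ x₂ s s')
    (hs : s ⟨0, by omega⟩ ≠ s ⟨1, by omega⟩) : x₁ = x₂ := by
  obtain ⟨u, hu⟩ := isChain_of_isBT hP hα h1
  obtain ⟨w, hw⟩ := isChain_of_isBT hP hα h2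
  have hev : ∀ j : ℕ, j < 2 * P - 1 →
      u (2 * j) * u (2 * j + 1) = w (2 * j) * w (2 * j + 1) := fun j hj => by
    rw [← hu.even ⟨j, hj⟩, hw.even ⟨j, hj⟩]
  have hod : ∀ j : ℕ, j < 2 * P - 1 →
      u (2 * j + 1) * u (2 * j + 2) = w (2 * j + 1) * w (2 * j + 2) := fun j hj => by
    rw [← hu.odd ⟨j, hj⟩, hw.odd ⟨j, hj⟩]
  have hev0 := hev 0 (by omega)
  have hev1 := hev 1 (by omega)
  have hod0 := hod 0 (by omega)
  have heq : ∀ (a m : ℕ), a + m < 2 * P → wprod u (2 * a + 1) (2 * m) = wprod w (2 * a + 1) (2 * m) := by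
    intro a m hm
    induction m with
    | zero => simp
    | succ m ih =>
      have := hod (a + m) (by omega)
      rw [show 2 * (m + 1) = 2 * m + 1 + 1 by ring, wprod_succ, wprod_succ, wprod_succ, wprod_succ,
        ih (by omega), mul_assoc, mul_assoc]
      push_cast at this ⊢
      rw [show 2 * (a : ℤ) + 1 + 2 * m = 2 * (a + m) + 1 by ring,
        show 2 * (a : ℤ) + 1 + (2 * m + 1) = 2 * (a + m) + 2 by ring, this]
  have hlat : ∀ {w : ℤ → ℂ} (a : ℕ), LatEq α P κ w (2 * a) ↔ 1 - α * κ
      = wprod w (2 * a + 1) (2 * P) - α * w (2 * a) - α * w (2 * a + 1)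
        + α ^ 2 / wprod w (2 * a + 1) (2 * P - 2) := by
    intro w a
    unfold LatEq
    rw [show 2 * (a : ℤ) + 2 = 2 * a + 1 + 1 by ring,
      show 2 * (a : ℤ) + 2 * P = 2 * a + 1 + 2 * P - 1 by ring, mul_wprod_mul hP]
  -- At an even position the products in `LatEq` start at an odd index, so they are products of the
  -- `s'_j` and agree for both chains; the sums must then agree as well.
  have hsum_even : ∀ a : ℕ, a < 2 → u (2 * a) + u (2 * a + 1) = w (2 * a) + w (2 * a + 1) := by
    intro a ha
    have k1 := (hlat a).1 (hu.latEq hP (by omega) (by omega))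
    have k2 := (hlat a).1 (hw.latEq hP (by omega) (by omega))
    rw [heq a P (by omega), show 2 * P - 2 = 2 * (P - 1) by omega, heq a (P - 1) (by omega)] at k1
    rw [show 2 * P - 2 = 2 * (P - 1) by omega] at k2
    apply mul_left_cancel₀ hα
    linear_combination k1 - k2
  have hsum1 : u 1 + u 2 = w 1 + w 2 := by
    have k1 := hu.pairSum_eq hP hα (n := 1) le_rfl (by omega)
    have k2 := hw.pairSum_eq hP hα (n := 1) le_rfl (by omega)
    norm_num at k1 k2
    rw [← k1, ← k2]
  have hsum0 := hsum_even 0 (by omega)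
  have hsum2 := hsum_even 1 (by omega)
  norm_num at hev0 hev1 hod0 hsum0 hsum2
  have h0 : u 0 = w 0 := by
    -- With `d = w_0 - u_0 ≠ 0` the equal sums give `w_1 = u_1 - d`, `w_2 = u_2 + d`, `w_3 = u_3 -
    -- d`. Each equal product then yields a linear equation after division by `d`, and together
    -- these force `u_0 = u_2` and `u_1 = u_3`, hence `s_0 = s_1`.
    by_contra hne
    have hd : w 0 - u 0 ≠ 0 := sub_ne_zero.2 (Ne.symm hne)
    apply hs
    rw [hu.even, hu.even]
    norm_num
    have d0 : u 1 - u 0 - (w 0 - u 0) = 0 := by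
      apply mul_left_cancel₀ hd
      linear_combination w 0 * hsum0 - hev0
    have d1 : u 1 - u 2 - (w 0 - u 0) = 0 := by
      apply mul_left_cancel₀ hd
      have e1 : w 1 = u 1 - (w 0 - u 0) := by linear_combination -hsum0
      have e2 : w 2 = u 2 + (w 0 - u 0) := by linear_combination hsum0 - hsum1
      rw [e1, e2] at hod0
      linear_combination -hod0
    have d2 : u 3 - u 2 - (w 0 - u 0) = 0 := by
      apply mul_left_cancel₀ hd
      have e2 : w 2 = u 2 + (w 0 - u 0) := by linear_combination hsum0 - hsum1
      have e3 : w 3 = u 3 - (w 0 - u 0) := by linear_combination hsum1 - hsum0 - hsum2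
      rw [e2, e3] at hev1
      linear_combination -hev1
    have e0 : u 0 = u 2 := by linear_combination d1 - d0
    have e1 : u 1 = u 3 := by linear_combination d1 - d2
    rw [e0, e1]
  -- From the common value at `0` the products `s_j` and `s'_j` determine all terms up to number `4P
  -- - 2`; the last one then follows from (1).
  have hall : ∀ n : ℕ, n < 4 * P - 1 → u n = w n := by
    intro n hn
    induction n with
    | zero => simpa using h0
    | succ n ih =>
      have hn' := ih (by omega)
      have hne := hw.ne n (by omega) (by omega)
      apply mul_left_cancel₀ hne
      obtain ⟨i, rfl | rfl⟩ := Nat.even_or_odd' n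
      · have := hev i (by omega)
        push_cast at *
        rw [hn'] at this; exact this
      · have := hod i (by omega)
        push_cast at *
        rw [hn'] at this
        rw [show 2 * (i : ℤ) + 1 + 1 = 2 * i + 2 by ring]; exact this
  rw [hu.last, hw.last]
  have := lifted_unique (hu.lifted (2 * P - 1) (by omega) (by omega))
    (hw.lifted (2 * P - 1) (by omega) (by omega)) hP (fun j h0 h1 => by
      obtain ⟨n, rfl⟩ := Int.eq_ofNat_of_zero_le (show 0 ≤ j by omega)
      exact hall n (by omega))
  rwa [show 2 * (P : ℤ) - 1 + 2 * P = 4 * P - 1 by ring] at this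

end Quadratic

/-! ## The two branches near a generic point -/

section Generic

variable {α : ℂ} {P : ℕ}

/-- The coordinates of a pair `(κ, s)`. -/
def optPt {N : ℕ} (w : ℂ × (Fin N → ℂ)) (o : Option (Fin N)) : ℂ := o.elim w.1 w.2

lemma differentiable_optPt {N : ℕ} : Differentiable ℂ (optPt (N := N)) := by
  refine differentiable_pi.2 fun o => ?_
  cases o with
  | none => exact differentiable_fst
  | some i =>
    change Differentiable ℂ fun w : ℂ × (Fin N → ℂ) => w.2 i
    fun_prop

/-- The point with `s_j = -1` and `κ` such that `u_j = (-1)^(j+1)` belongs to it. -/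
def basePt (α : ℂ) (P : ℕ) : ℂ × (Fin (2 * P - 1) → ℂ) :=
  ((1 - ((-1) ^ P + α ^ 2 / (-1) ^ (P - 1))) / α, fun _ => -1)

lemma coord_basePt {n : ℕ} (hn : n < 2 * P - 1) : coord (basePt α P).2 n = -1 := by
  rw [coord_of_lt _ hn]; rfl

lemma prod_basePt {a b : ℕ} (hb : b < 2 * P - 1) :
    ∏ i ∈ Finset.Icc a b, coord (basePt α P).2 i = (-1) ^ (b + 1 - a) := by
  rw [Finset.prod_congr rfl fun i hi => coord_basePt (α := α)
    (lt_of_le_of_lt (Finset.mem_Icc.1 hi).2 hb), Finset.prod_const, Nat.card_Icc]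

lemma neg_one_pow_pred (hP : 2 ≤ P) : (-1 : ℂ) ^ P = -(-1) ^ (P - 1) := by
  obtain ⟨p, rfl⟩ : ∃ p, P = p + 1 := ⟨P - 1, by omega⟩
  rw [Nat.add_sub_cancel, pow_succ]; ring

lemma neg_one_pow_mul_self (n : ℕ) : (-1 : ℂ) ^ n * (-1) ^ n = 1 := by
  rw [← mul_pow]; norm_num

lemma sExt_basePt (hP : 2 ≤ P) (n : ℕ) : sExt α P (basePt α P).2 n = -1 := by
  rw [sExt]
  split_ifs with h
  · exact coord_basePt h
  · have h1 : (-1 : ℂ) ^ (P - 1) ≠ 0 := pow_ne_zero _ (by norm_num)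
    rw [coord_of_lt _ (by omega), chiHat, if_neg (by simp; omega), prod_basePt (by omega),
      prod_basePt (by omega), prod_basePt (by omega), show P - 1 + 1 - 0 = P by omega,
      show 2 * P - 2 + 1 - P = P - 1 by omega, show P - 1 + 1 - 1 = P - 1 by omega,
      neg_one_pow_pred hP, sub_self, mul_zero, sub_zero, neg_div, div_self h1]

lemma pairSum_basePt (hP : 2 ≤ P) (hα : α ≠ 0) (n : ℕ) :
    pairSum α P (basePt α P).1 (basePt α P).2 n = 0 := by
  rw [pairSum]
  simp only [sExt_basePt hP, Finset.prod_const, Finset.card_range, ite_self]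
  rw [basePt, mul_div_cancel₀ _ hα]
  ring

/-- `κ` is chosen to make all sums zero; with all products equal to `-1` the recurrence repeats with
period two. -/
lemma linRec_basePt (hP : 2 ≤ P) (hα : α ≠ 0) (a b : ℂ) (m : ℕ) :
    linRec α P (basePt α P).1 (basePt α P).2 a b m = if Even m then a else b := by
  induction m using Nat.twoStepInduction with
  | zero => simp [linRec]
  | one => simp [linRec]
  | more m h0 h1 =>
    rw [linRec, pairSum_basePt hP hα, sExt_basePt hP, h0]
    by_cases h : Even m <;> simp [h, Nat.even_add]

lemma topProd_basePt (hP : 2 ≤ P) : topProd α P (basePt α P).2 = (-1) ^ P := by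
  simp [topProd, sExt_basePt hP]

lemma shiftedParam_basePt (hP : 2 ≤ P) (hα : α ≠ 0) :
    shiftedParam α P (basePt α P).1 (basePt α P).2 = (-1) ^ P := by
  simp only [shiftedParam, sExt_basePt hP, Finset.prod_const, Finset.card_range]
  rw [basePt, mul_div_cancel₀ _ hα]; ring

/-- At this point the quadratic is a nonzero multiple of `x² - 1`, so it has two distinct zeros. -/
lemma quadCoeff_basePt (hP : 2 ≤ P) (hα : α ≠ 0) :
    quadCoeff₂ α P (basePt α P).1 (basePt α P).2 ≠ 0 ∧
    quadCoeff₁ α P (basePt α P).1 (basePt α P).2 = 0 ∧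
    quadCoeff₀ α P (basePt α P).1 (basePt α P).2
      = -quadCoeff₂ α P (basePt α P).1 (basePt α P).2 := by
  simp only [quadCoeff₂, quadCoeff₁, quadCoeff₀, linRec_basePt hP hα, sExt_basePt hP,
    topProd_basePt hP, shiftedParam_basePt hP hα, Nat.even_add_one]
  by_cases h : Even P
  · simp [h, h.neg_one_pow, hα]
  · simp [h, (Nat.not_even_iff_odd.1 h).neg_one_pow]

variable {w₀ : ℂ × (Fin (2 * P - 1) → ℂ)}

lemma regularAt_coord (n : ℕ) : RegularAt optPt w₀ fun w => coord w.2 n := by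
  unfold coord
  split_ifs with h
  · exact RegularAt.coord (pt := optPt) (some ⟨n, h⟩)
  · exact RegularAt.const 0

lemma regularAt_param : RegularAt optPt w₀ fun w => 1 - α * w.1 :=
  (RegularAt.const 1).sub ((RegularAt.const α).mul (RegularAt.coord (pt := optPt) none))

lemma regularAt_sExt (hP : 2 ≤ P) (n : ℕ) :
    RegularAt optPt (basePt α P) fun w => sExt α P w.2 n := by
  unfold sExt
  split_ifs with h
  · exact regularAt_coord n
  · have h1 : ∀ n, (-1 : ℂ) ^ n ≠ 0 := fun n => pow_ne_zero _ (by norm_num)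
    have hp : ∀ a b, RegularAt optPt (basePt α P) fun w => ∏ i ∈ Finset.Icc a b, coord w.2 i :=
      fun a b => RegularAt.prod _ fun i _ => regularAt_coord i
    have e : (fun w : ℂ × (Fin (2 * P - 1) → ℂ) => coord (chiHat α P w.2) (2 * P - 2)) = fun w =>
        ((∏ i ∈ Finset.Icc 0 (P - 1), coord w.2 i)
          - α ^ 2 * (1 / (∏ i ∈ Finset.Icc P (2 * P - 2), coord w.2 i)
            - 1 / (∏ i ∈ Finset.Icc 1 (P - 1), coord w.2 i)))
          / ∏ i ∈ Finset.Icc P (2 * P - 2), coord w.2 i := by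
      funext w
      rw [coord_of_lt _ (by omega), chiHat, if_neg (by simp; omega)]
    rw [e]
    refine RegularAt.div (RegularAt.sub (hp _ _) (RegularAt.mul (RegularAt.const _)
      (RegularAt.sub (RegularAt.div (RegularAt.const 1) (hp _ _) ?_)
        (RegularAt.div (RegularAt.const 1) (hp _ _) ?_)))) (hp _ _) ?_
    all_goals rw [prod_basePt (by omega)]; exact h1 _

lemma sExt_basePt_prod_ne (hP : 2 ≤ P) {m : ℕ} (f : ℕ → ℕ) :
    ∏ i ∈ Finset.range m, sExt α P (basePt α P).2 (f i) ≠ 0 :=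
  Finset.prod_ne_zero_iff.2 fun i _ => by rw [sExt_basePt hP]; norm_num

lemma regularAt_prod_sExt (hP : 2 ≤ P) {m : ℕ} (f : ℕ → ℕ) :
    RegularAt optPt (basePt α P) fun w => ∏ i ∈ Finset.range m, sExt α P w.2 (f i) :=
  RegularAt.prod _ fun _ _ => regularAt_sExt hP _

lemma regularAt_pairSum (hP : 2 ≤ P) (hα : α ≠ 0) (n : ℕ) :
    RegularAt optPt (basePt α P) fun w => pairSum α P w.1 w.2 n := by
  unfold pairSum
  split_ifs with h <;>
  exact RegularAt.div (((regularAt_prod_sExt hP _).add (RegularAt.div (RegularAt.const _)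
    (regularAt_prod_sExt hP _) (sExt_basePt_prod_ne hP _))).sub regularAt_param)
    (RegularAt.const _) hα

lemma regularAt_linRec (hP : 2 ≤ P) (hα : α ≠ 0) (a b : ℂ) (m : ℕ) :
    RegularAt optPt (basePt α P) fun w => linRec α P w.1 w.2 a b m := by
  induction m using Nat.twoStepInduction with
  | zero => exact RegularAt.const a
  | one => exact RegularAt.const b
  | more m h0 h1 =>
    exact ((regularAt_pairSum hP hα _).mul h1).sub ((regularAt_sExt hP _).mul h0)

lemma regularAt_shiftedParam (hP : 2 ≤ P) :
    RegularAt optPt (basePt α P) fun w => shiftedParam α P w.1 w.2 :=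
  regularAt_param.sub (RegularAt.div (RegularAt.const _) (regularAt_prod_sExt hP _)
    (sExt_basePt_prod_ne hP _))

lemma regularAt_quadCoeff (hP : 2 ≤ P) (hα : α ≠ 0) :
    (RegularAt optPt (basePt α P) fun w => quadCoeff₂ α P w.1 w.2) ∧
    (RegularAt optPt (basePt α P) fun w => quadCoeff₁ α P w.1 w.2) ∧
    (RegularAt optPt (basePt α P) fun w => quadCoeff₀ α P w.1 w.2) := by
  have hr := fun a b m => regularAt_linRec (α := α) hP hα a b m
  have ha : RegularAt optPt (basePt α P) fun _ => α := RegularAt.const α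
  have hc := regularAt_shiftedParam (α := α) hP
  have hs := regularAt_sExt (α := α) hP (2 * P - 1)
  have ht : RegularAt optPt (basePt α P) fun w => topProd α P w.2 := regularAt_prod_sExt hP _
  exact ⟨(ha.mul (hr _ _ _)).add (hc.mul (hr _ _ _)),
    (((ha.mul (hr _ _ _)).sub (ht.mul (hr _ _ _))).add (hc.mul (hr _ _ _))).add
      ((ha.mul hs).mul (hr _ _ _)),
    ((ha.mul hs).mul (hr _ _ _)).sub (ht.mul (hr _ _ _))⟩

/-- The resultant of the quadratic polynomial and the `m`-th term of the linear recurrence. -/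
def resultantAt (α : ℂ) (P : ℕ) (w : ℂ × (Fin (2 * P - 1) → ℂ)) (m : ℕ) : ℂ :=
  quadCoeff₂ α P w.1 w.2 * (linRec α P w.1 w.2 1 0 m * linRec α P w.1 w.2 1 0 m)
    - quadCoeff₁ α P w.1 w.2 * (linRec α P w.1 w.2 0 1 m * linRec α P w.1 w.2 1 0 m)
    + quadCoeff₀ α P w.1 w.2 * (linRec α P w.1 w.2 0 1 m * linRec α P w.1 w.2 0 1 m)

/-- The discriminant of the quadratic polynomial. -/
def discAt (α : ℂ) (P : ℕ) (w : ℂ × (Fin (2 * P - 1) → ℂ)) : ℂ :=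
  quadCoeff₁ α P w.1 w.2 * quadCoeff₁ α P w.1 w.2
    - 4 * (quadCoeff₂ α P w.1 w.2 * quadCoeff₀ α P w.1 w.2)

/-- The conditions under which the correspondence is two-valued near `w`. -/
structure GoodAt (α : ℂ) (P : ℕ) (w : ℂ × (Fin (2 * P - 1) → ℂ)) : Prop where
  sExt_ne : ∀ n < 2 * P, sExt α P w.2 n ≠ 0
  quadCoeff_ne : quadCoeff₂ α P w.1 w.2 ≠ 0
  disc_ne : discAt α P w ≠ 0
  resultant_ne : ∀ m < 2 * P + 1, resultantAt α P w m ≠ 0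
  diff_sExt : ∀ n < 2 * P, DifferentiableAt ℂ (fun w => sExt α P w.2 n) w
  diff₂ : DifferentiableAt ℂ (fun w => quadCoeff₂ α P w.1 w.2) w
  diff₁ : DifferentiableAt ℂ (fun w => quadCoeff₁ α P w.1 w.2) w
  diff_disc : DifferentiableAt ℂ (discAt α P) w
  diff_f : ∀ m < 2 * P + 1, DifferentiableAt ℂ (fun w => linRec α P w.1 w.2 0 1 m) w
  diff_g : ∀ m < 2 * P + 1, DifferentiableAt ℂ (fun w => linRec α P w.1 w.2 1 0 m) w

/-- Finitely many conditions, each on a rational function regular at the base point: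
differentiability is automatic off the zeros of a denominator, and nonvanishing is checked at the
base point. -/
lemma generic_goodAt (hP : 2 ≤ P) (hα : α ≠ 0) :
    GenericAt optPt (basePt α P) (GoodAt α P) := by
  obtain ⟨h2, h1, h0⟩ := regularAt_quadCoeff (α := α) hP hα
  obtain ⟨b2, b1, b0⟩ := quadCoeff_basePt (α := α) hP hα
  have hr := fun a b m => regularAt_linRec (α := α) hP hα a b m
  have hdisc : RegularAt optPt (basePt α P) (discAt α P) :=
    (h1.mul h1).sub ((RegularAt.const 4).mul (h2.mul h0))
  have hres : ∀ m, RegularAt optPt (basePt α P) fun w => resultantAt α P w m := fun m =>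
    ((h2.mul ((hr _ _ m).mul (hr _ _ m))).sub (h1.mul ((hr _ _ m).mul (hr _ _ m)))).add
      (h0.mul ((hr _ _ m).mul (hr _ _ m)))
  have k1 := GenericAt.forall_lt (2 * P) fun n _ => (regularAt_sExt (α := α) hP n).generic_ne
    (by rw [sExt_basePt hP]; norm_num)
  have k2 := h2.generic_ne b2
  have k3 := hdisc.generic_ne (by simp [discAt, b1, b0, b2])
  have k4 := GenericAt.forall_lt (2 * P + 1) fun m _ => (hres m).generic_ne (by
    rw [resultantAt, b0, b1, linRec_basePt hP hα, linRec_basePt hP hα]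
    by_cases h : Even m <;> simp [h, b2])
  have k5 := GenericAt.forall_lt (2 * P) fun n _ =>
    (regularAt_sExt (α := α) hP n).generic_differentiableAt differentiable_optPt
  have k6 := h2.generic_differentiableAt differentiable_optPt
  have k7 := h1.generic_differentiableAt differentiable_optPt
  have k8 := hdisc.generic_differentiableAt differentiable_optPt
  have k9 := GenericAt.forall_lt (2 * P + 1) fun m _ =>
    (hr 0 1 m).generic_differentiableAt differentiable_optPt
  have k10 := GenericAt.forall_lt (2 * P + 1) fun m _ =>
    (hr 1 0 m).generic_differentiableAt differentiable_optPt
  refine (k1.and (k2.and (k3.and (k4.and (k5.and (k6.and (k7.and (k8.and (k9.and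
    k10))))))))).mono fun w h => ?_
  obtain ⟨a1, a2, a3, a4, a5, a6, a7, a8, a9, a10⟩ := h
  exact ⟨a1, a2, a3, a4, a5, a6, a7, a8, a9, a10⟩

/-- A common zero of the quadratic and of the affine function `linRec α P κ s 1 x m` of `x` would
annihilate their resultant. -/
lemma GoodAt.linRec_ne {w : ℂ × (Fin (2 * P - 1) → ℂ)} (h : GoodAt α P w) {x : ℂ}
    (hq : quad α P w.1 w.2 x = 0) {m : ℕ} (hm : m ≤ 2 * P) :
    linRec α P w.1 w.2 1 x m ≠ 0 := by
  intro h0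
  apply h.resultant_ne m (by omega)
  rw [linRec_eq] at h0
  rw [quad] at hq
  rw [resultantAt, show linRec α P w.1 w.2 1 0 m = -(linRec α P w.1 w.2 0 1 m * x) by
    linear_combination h0]
  linear_combination (linRec α P w.1 w.2 0 1 m) ^ 2 * hq

/-- A square root of a holomorphic function near a point where it does not vanish. -/
def localSqrt {E : Type*} (f : E → ℂ) (r : ℂ) (w : E) : ℂ :=
  r * Complex.exp (Complex.log (f w / r ^ 2) / 2)

lemma localSqrt_sq {E : Type*} {f : E → ℂ} {r : ℂ} (hr : r ≠ 0) {w : E} (hw : f w ≠ 0) :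
    localSqrt f r w ^ 2 = f w := by
  rw [localSqrt, mul_pow, ← Complex.exp_nat_mul, Nat.cast_ofNat, mul_div_cancel₀ _ two_ne_zero,
    Complex.exp_log (div_ne_zero hw (pow_ne_zero 2 hr)), mul_div_cancel₀ _ (pow_ne_zero 2 hr)]

/-- The condition `s_0 ≠ s_1` stays a separate hypothesis because it fails at the base point. It is
needed only to separate `χ₁` from `χ₂`. -/
theorem exists_generic_isTwoValuedOn (hP : 2 ≤ P) (hα : α ≠ 0) :
    GenericAt optPt (basePt α P) fun w => w.2 ⟨0, by omega⟩ ≠ w.2 ⟨1, by omega⟩ →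
      ∃ W x₁ x₂ χ₁ χ₂, w ∈ W ∧ IsTwoValuedOn α P W x₁ x₂ χ₁ χ₂ := by
  obtain ⟨Q, hQ0, hQ⟩ := generic_goodAt (α := α) hP hα
  refine ⟨Q, hQ0, fun w₁ hw₁ hs₁ => ?_⟩
  obtain ⟨r, hr⟩ : ∃ r : ℂ, r ^ 2 = discAt α P w₁ := IsAlgClosed.exists_pow_nat_eq _ two_pos
  have hr0 : r ≠ 0 := by
    rintro rfl
    exact (hQ w₁ hw₁).disc_ne (by rw [← hr]; norm_num)
  set O : Set (ℂ × (Fin (2 * P - 1) → ℂ)) :=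
    {w | MvPolynomial.eval (optPt w) Q ≠ 0} ∩ {w | w.2 ⟨0, by omega⟩ ≠ w.2 ⟨1, by omega⟩} with hO
  have hOo : IsOpen O := by
    refine (isOpen_eval_ne differentiable_optPt.continuous Q).inter (isOpen_ne_fun ?_ ?_)
    · exact (continuous_apply _).comp continuous_snd
    · exact (continuous_apply _).comp continuous_snd
  -- On `W` the normalised discriminant avoids the cut of the logarithm, so its root is holomorphic.
  -- At `w₁` it equals `1`, since `r² = discAt α P w₁`.
  set W : Set (ℂ × (Fin (2 * P - 1) → ℂ)) :=
    O ∩ (fun w => discAt α P w / r ^ 2) ⁻¹' Complex.slitPlane with hW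
  have hgood : ∀ w ∈ W, GoodAt α P w := fun w hw => hQ w hw.1.1
  set x₁ : ℂ × (Fin (2 * P - 1) → ℂ) → ℂ := fun w =>
    (-quadCoeff₁ α P w.1 w.2 + localSqrt (discAt α P) r w) / (2 * quadCoeff₂ α P w.1 w.2) with hx₁
  set x₂ : ℂ × (Fin (2 * P - 1) → ℂ) → ℂ := fun w =>
    (-quadCoeff₁ α P w.1 w.2 - localSqrt (discAt α P) r w) / (2 * quadCoeff₂ α P w.1 w.2) with hx₂
  have hWo : IsOpen W := by
    refine ContinuousOn.isOpen_inter_preimage (fun w hw => ?_) hOo Complex.isOpen_slitPlane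
    exact ((hQ w hw.1).diff_disc.continuousAt.div_const _).continuousWithinAt
  have hsqrt : ∀ w ∈ W, DifferentiableAt ℂ (localSqrt (discAt α P) r) w := by
    intro w hw
    have h1 : DifferentiableAt ℂ (fun w => discAt α P w / r ^ 2) w :=
      by simpa only [div_eq_mul_inv] using (hgood w hw).diff_disc.mul_const _
    have h2 : DifferentiableAt ℂ (fun w => Complex.log (discAt α P w / r ^ 2) / 2) w := by
      simpa only [div_eq_mul_inv] using (h1.clog hw.2).mul_const _
    exact h2.cexp.const_mul r
  have hden : ∀ w ∈ W, DifferentiableAt ℂ (fun w => (2 * quadCoeff₂ α P w.1 w.2)⁻¹) w :=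
    fun w hw => ((hgood w hw).diff₂.const_mul 2).fun_inv
      (mul_ne_zero two_ne_zero (hgood w hw).quadCoeff_ne)
  have hd₁ : ∀ w ∈ W, DifferentiableAt ℂ x₁ w := fun w hw => by
    simp only [hx₁, div_eq_mul_inv]
    exact ((hgood w hw).diff₁.fun_neg.fun_add (hsqrt w hw)).fun_mul (hden w hw)
  have hd₂ : ∀ w ∈ W, DifferentiableAt ℂ x₂ w := fun w hw => by
    simp only [hx₂, div_eq_mul_inv]
    exact ((hgood w hw).diff₁.fun_neg.fun_sub (hsqrt w hw)).fun_mul (hden w hw)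
  have hsq : ∀ w ∈ W, localSqrt (discAt α P) r w ^ 2 = discAt α P w := fun w hw =>
    localSqrt_sq hr0 (hgood w hw).disc_ne
  have hquad : ∀ w ∈ W, ∀ x, quad α P w.1 w.2 x = 0 ↔ x = x₁ w ∨ x = x₂ w := by
    intro w hw x
    have h2 := (hgood w hw).quadCoeff_ne
    have h := quadratic_eq_zero_iff h2 (b := quadCoeff₁ α P w.1 w.2)
      (c := quadCoeff₀ α P w.1 w.2) (s := localSqrt (discAt α P) r w) (by
        have := hsq w hw
        rw [discrim, ← pow_two, this, discAt]; ring) x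
    rw [quad, pow_two, h]
  have hne : ∀ w ∈ W, x₁ w ≠ x₂ w := by
    intro w hw h
    have h2 := (hgood w hw).quadCoeff_ne
    simp only [hx₁, hx₂] at h
    rw [div_left_inj' (mul_ne_zero two_ne_zero h2)] at h
    have h0 : localSqrt (discAt α P) r w = 0 := by linear_combination h / 2
    apply (hgood w hw).disc_ne
    rw [← hsq w hw, h0]; norm_num
  have hχ : ∀ w ∈ W, ∀ y : ℂ × (Fin (2 * P - 1) → ℂ) → ℂ, DifferentiableAt ℂ y w →
      quad α P w.1 w.2 (y w) = 0 → DifferentiableAt ℂ (fun w => chiOf α P w.1 w.2 (y w)) w := by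
    intro w hw y hy hq
    have hg := hgood w hw
    have hlin : ∀ m < 2 * P + 1, DifferentiableAt ℂ (fun w => linRec α P w.1 w.2 1 (y w) m) w := by
      intro m hm
      have := ((hg.diff_f m hm).fun_mul hy).fun_add (hg.diff_g m hm)
      exact this.congr_of_eventuallyEq (Filter.Eventually.of_forall fun w => linRec_eq m)
    refine differentiableAt_pi.2 fun j => ?_
    have hj := j.2
    simp only [chiOf, div_eq_mul_inv]
    exact ((hg.diff_sExt _ (by omega)).fun_mul ((hlin _ (by omega)).fun_mul
      (hlin _ (by omega)))).fun_mul (((hlin _ (by omega)).fun_pow 2).fun_inv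
        (pow_ne_zero 2 (hg.linRec_ne hq (by omega))))
  have hq₁ : ∀ w ∈ W, quad α P w.1 w.2 (x₁ w) = 0 := fun w hw => (hquad w hw _).2 (Or.inl rfl)
  have hq₂ : ∀ w ∈ W, quad α P w.1 w.2 (x₂ w) = 0 := fun w hw => (hquad w hw _).2 (Or.inr rfl)
  have hbt : ∀ w ∈ W, ∀ x s', IsBT α P w.1 x w.2 s' ↔
      quad α P w.1 w.2 x = 0 ∧ s' = chiOf α P w.1 w.2 x := fun w hw x s' =>
    isBT_iff_quad hP hα (hgood w hw).sExt_ne fun hq m hm => (hgood w hw).linRec_ne hq hm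
  refine ⟨W, x₁, x₂, fun w => chiOf α P w.1 w.2 (x₁ w), fun w => chiOf α P w.1 w.2 (x₂ w),
    ⟨⟨hw₁, hs₁⟩, ?_⟩, hWo, fun w hw => (hd₁ w hw).differentiableWithinAt,
    fun w hw => (hd₂ w hw).differentiableWithinAt,
    fun w hw => (hχ w hw _ (hd₁ w hw) (hq₁ w hw)).differentiableWithinAt,
    fun w hw => (hχ w hw _ (hd₂ w hw) (hq₂ w hw)).differentiableWithinAt, hne, ?_, ?_⟩
  · rw [Set.mem_preimage, hr, div_self (hQ w₁ hw₁).disc_ne]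
    exact Complex.one_mem_slitPlane
  · intro w hw h
    exact hne w hw (gauge_variable_unique hP hα
      ((hbt w hw _ _).2 ⟨hq₁ w hw, rfl⟩) ((hbt w hw _ _).2 ⟨hq₂ w hw, h⟩) hw.1.2)
  · intro w hw x s'
    rw [hbt w hw, hquad w hw]
    constructor
    · rintro ⟨rfl | rfl, rfl⟩
      · exact Or.inl ⟨rfl, rfl⟩
      · exact Or.inr ⟨rfl, rfl⟩
    · rintro (⟨rfl, rfl⟩ | ⟨rfl, rfl⟩)
      · exact ⟨Or.inl rfl, rfl⟩
      · exact ⟨Or.inr rfl, rfl⟩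

theorem exists_polynomial_isTwoValuedOn (hP : 2 ≤ P) (hα : α ≠ 0) :
    ∃ Q : MvPolynomial (Option (Fin (2 * P - 1))) ℂ, Q ≠ 0 ∧
      ∀ (κ : ℂ) (s : Fin (2 * P - 1) → ℂ), MvPolynomial.eval (fun o => o.elim κ s) Q ≠ 0 →
        ∃ W x₁ x₂ χ₁ χ₂, (κ, s) ∈ W ∧ IsTwoValuedOn α P W x₁ x₂ χ₁ χ₂ := by
  obtain ⟨R, hR0, hR⟩ := exists_generic_isTwoValuedOn (α := α) hP hα
  refine ⟨R * (MvPolynomial.X (some ⟨0, by omega⟩) - MvPolynomial.X (some ⟨1, by omega⟩)), ?_, ?_⟩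
  · refine mul_ne_zero (by rintro rfl; simp at hR0) (sub_ne_zero.2 fun h => ?_)
    have := MvPolynomial.X_injective h
    simp at this
  · intro κ s h
    rw [map_mul, map_sub, MvPolynomial.eval_X, MvPolynomial.eval_X] at h
    exact hR (κ, s) (left_ne_zero_of_mul h) (sub_ne_zero.1 (right_ne_zero_of_mul h))

end Generic

/-! ## The branch that belongs to `φ` -/

section Branch

variable {α : ℂ} {P : ℕ}

lemma IsTwoValuedOn.swap {W : Set (ℂ × (Fin (2 * P - 1) → ℂ))}
    {x₁ x₂ : ℂ × (Fin (2 * P - 1) → ℂ) → ℂ}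
    {χ₁ χ₂ : ℂ × (Fin (2 * P - 1) → ℂ) → Fin (2 * P - 1) → ℂ}
    (h : IsTwoValuedOn α P W x₁ x₂ χ₁ χ₂) : IsTwoValuedOn α P W x₂ x₁ χ₂ χ₁ :=
  ⟨h.isOpen, h.holo_x₂, h.holo_x₁, h.holo_χ₂, h.holo_χ₁, fun w hw => (h.x_ne w hw).symm,
    fun w hw => (h.χ_ne w hw).symm, fun w hw x s' => (h.isBT_iff w hw x s').trans or_comm⟩

/-- The point `(-1, 1, -1, 1, …)`. -/
def altPt (P : ℕ) : Fin (2 * P) → ℂ := fun j => (-1) ^ ((j : ℕ) + 1)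

/-- Two windows of even length, one step apart, have the same product on an alternating sequence.
Hence the correction in (1) vanishes and the sequence continues with period `2P`. -/
lemma uTerm_altPt (hP : 2 ≤ P) (k : ℕ) : uTerm α P (altPt P) k = (-1) ^ (k + 1) := by
  induction k using Nat.strong_induction_on with
  | _ k ih =>
    rcases Nat.lt_or_ge k (2 * P) with h | h
    · rw [uTerm_of_lt _ _ h]; rfl
    · obtain ⟨i, rfl⟩ := Nat.exists_eq_add_of_le' h
      have e : ∏ j ∈ Finset.Icc 1 (2 * P - 2), uTerm α P (altPt P) (i + j)
          = ∏ j ∈ Finset.Icc 2 (2 * P - 1), uTerm α P (altPt P) (i + j) := by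
        rw [prod_Icc_eq_range, prod_Icc_eq_range, show 2 * P - 2 + 1 - 1 = 2 * (P - 1) by omega,
          show 2 * P - 1 + 1 - 2 = 2 * (P - 1) by omega]
        have h2 : ∀ j ∈ Finset.range (2 * (P - 1)), uTerm α P (altPt P) (i + (2 + j))
            = -1 * uTerm α P (altPt P) (i + (1 + j)) := fun j hj => by
          have := Finset.mem_range.1 hj
          rw [ih _ (by omega), ih _ (by omega)]; ring
        rw [Finset.prod_congr rfl h2, Finset.prod_mul_distrib, Finset.prod_const, Finset.card_range,
          pow_mul]
        norm_num
      rw [uTerm_recurrence α _ hP, e, sub_self, mul_zero, sub_zero, ih i (by omega)]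
      rw [show i + 2 * P + 1 = i + 1 + 2 * P by ring, pow_add _ (i + 1), pow_mul]
      norm_num

lemma orbit_altPt (hP : 2 ≤ P) {n : ℕ} : orbit α P (altPt P) n = (-1) ^ (n + 1) := by
  rw [orbit_natCast, uTerm_altPt hP]

lemma wprod_orbit_altPt (hP : 2 ≤ P) (a m : ℕ) :
    wprod (orbit α P (altPt P)) a (2 * m) = (-1) ^ m := by
  induction m with
  | zero => simp
  | succ m ih =>
    rw [show 2 * (m + 1) = 2 * m + 1 + 1 by ring, wprod_succ, wprod_succ, ih, ← Nat.cast_add,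
      ← Nat.cast_add, orbit_altPt hP, orbit_altPt hP, mul_assoc, pow_succ (-1 : ℂ) m,
      show a + (2 * m + 1) + 1 = a + 2 * m + 1 + 1 by ring, pow_succ (-1 : ℂ) (a + 2 * m + 1),
      ← mul_assoc ((-1 : ℂ) ^ (a + 2 * m + 1)), neg_one_pow_mul_self, one_mul]

lemma kappaPt_altPt (hP : 2 ≤ P) (hα : α ≠ 0) : kappaPt α P (altPt P) = (basePt α P).1 := by
  have hne : ∀ j : ℤ, 0 < j → j < 2 * (P : ℤ) - 1 → orbit α P (altPt P) j ≠ 0 := by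
    intro j h0 _
    obtain ⟨n, rfl⟩ := Int.eq_ofNat_of_zero_le h0.le
    rw [orbit_altPt hP]
    exact pow_ne_zero _ (by norm_num)
  refine ((GamEq_zero_iff_kappa hP hα hne).1 ?_).symm
  have e1 := wprod_orbit_altPt (α := α) hP 0 P
  have e2 := wprod_orbit_altPt (α := α) hP 1 (P - 1)
  have e3 := orbit_altPt (α := α) hP (n := 0)
  have e4 := orbit_altPt (α := α) hP (n := 2 * P - 1)
  rw [show 2 * P - 1 + 1 = 2 * P by omega, pow_mul,
    show ((2 * P - 1 : ℕ) : ℤ) = 0 + 2 * P - 1 by omega] at e4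
  rw [neg_one_sq, one_pow] at e4
  unfold GamEq
  rw [mul_wprod_mul hP]
  rw [Nat.cast_zero] at e1 e3
  rw [Nat.cast_one] at e2
  rw [show 2 * P - 2 = 2 * (P - 1) by omega, e4, zero_add, e1, e2, e3, basePt,
    mul_div_cancel₀ _ hα]
  ring

lemma piHat_altPt (hP : 2 ≤ P) : piHat α P (altPt P) = (basePt α P).2 := by
  funext j
  rw [piHat, uTerm_altPt hP, uTerm_altPt hP, pow_succ _ (2 * (j : ℕ) + 1), ← mul_assoc,
    neg_one_pow_mul_self, one_mul]
  rfl

lemma regularAt_uTerm (hP : 2 ≤ P) (k : ℕ) :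
    RegularAt (fun u : Fin (2 * P) → ℂ => u) (altPt P) fun u => uTerm α P u k := by
  induction k using Nat.strong_induction_on with
  | _ k ih =>
    rcases Nat.lt_or_ge k (2 * P) with h | h
    · simp only [uTerm_of_lt _ _ h]
      exact RegularAt.coord (pt := fun u : Fin (2 * P) → ℂ => u) ⟨k, h⟩
    · obtain ⟨i, rfl⟩ := Nat.exists_eq_add_of_le' h
      have hne : ∀ t : Finset ℕ, ∏ j ∈ t, uTerm α P (altPt P) (i + j) ≠ 0 := fun t =>
        Finset.prod_ne_zero_iff.2 fun j _ => by
          rw [uTerm_altPt hP]; exact pow_ne_zero _ (by norm_num)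
      simp only [uTerm_recurrence α _ hP]
      refine (ih i (by omega)).sub ((RegularAt.const α).mul
        ((RegularAt.div (RegularAt.const 1) (RegularAt.prod _ fun j hj => ih _ ?_) (hne _)).sub
          (RegularAt.div (RegularAt.const 1) (RegularAt.prod _ fun j hj => ih _ ?_) (hne _))))
      all_goals have := Finset.mem_Icc.1 hj; omega

lemma regularAt_gam (hP : 2 ≤ P) (n : ℕ) :
    RegularAt (fun u : Fin (2 * P) → ℂ => u) (altPt P) fun u => gam α P (orbit α P u) n := by
  have ho : ∀ k : ℤ, 0 ≤ k →
      RegularAt (fun u : Fin (2 * P) → ℂ => u) (altPt P) fun u => orbit α P u k := by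
    intro k _
    exact regularAt_uTerm hP _
  unfold gam
  refine RegularAt.div ((RegularAt.prod _ fun j _ => ho _ (by omega)).sub (RegularAt.const α))
    (RegularAt.prod _ fun j _ => ho _ (by omega)) (Finset.prod_ne_zero_iff.2 fun j _ => ?_)
  rw [show (n : ℤ) + 2 * (j : ℕ) + 1 = ((n + 2 * j + 1 : ℕ) : ℤ) by push_cast; ring, orbit_altPt hP]
  exact pow_ne_zero _ (by norm_num)

lemma regularAt_kappaPt (hP : 2 ≤ P) (hα : α ≠ 0) :
    RegularAt (fun u : Fin (2 * P) → ℂ => u) (altPt P) (kappaPt α P) := by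
  have h0 := regularAt_gam (α := α) hP 0
  have h1 := regularAt_gam (α := α) hP 1
  exact ((RegularAt.const 1).sub (h0.mul h1)).div (RegularAt.const α) hα

lemma regularAt_piHat (hP : 2 ≤ P) (j : Fin (2 * P - 1)) :
    RegularAt (fun u : Fin (2 * P) → ℂ => u) (altPt P) fun u => piHat α P u j :=
  (regularAt_uTerm hP _).mul (regularAt_uTerm hP _)

/-- The polynomial condition on `(κ, s)` is pulled back along the rational map `u ↦ (κ(u), π̂₂(u))`,
which sends `altPt` to `basePt` and is regular there, so the condition is not vacuous. -/
theorem exists_polynomial_branch (hP : 2 ≤ P) (hα : α ≠ 0) :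
    ∃ Q : MvPolynomial (Fin (2 * P)) ℂ, Q ≠ 0 ∧
      ∀ u₀ : Fin (2 * P) → ℂ, MvPolynomial.eval u₀ Q ≠ 0 →
        ∃ W x₁ x₂ χ₁ χ₂, IsTwoValuedOn α P W x₁ x₂ χ₁ χ₂ ∧
          ∃ V : Set (Fin (2 * P) → ℂ), IsOpen V ∧ u₀ ∈ V ∧ ∀ u ∈ V,
            Regular α P u ∧ (kappaPt α P u, piHat α P u) ∈ W ∧
            piHat α P (phi α P u) = χ₁ (kappaPt α P u, piHat α P u) := by
  set pt : (Fin (2 * P) → ℂ) → Fin (2 * P) → ℂ := fun u => u with hpt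
  have hptd : Differentiable ℂ pt := differentiable_id
  set F : (Fin (2 * P) → ℂ) → ℂ × (Fin (2 * P - 1) → ℂ) := fun u =>
    (kappaPt α P u, piHat α P u) with hF
  have hF0 : F (altPt P) = basePt α P := by
    rw [hF]; simp only [kappaPt_altPt hP hα, piHat_altPt hP]
  obtain ⟨R, hR0, hR⟩ := exists_generic_isTwoValuedOn (α := α) hP hα
  have g1 : GenericAt pt (altPt P) fun u => MvPolynomial.eval (optPt (F u)) R ≠ 0 := by
    refine (RegularAt.eval (F := fun u => optPt (F u)) (fun o => ?_) R).generic_ne ?_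
    · cases o with
      | none => exact regularAt_kappaPt hP hα
      | some j => exact regularAt_piHat hP j
    · rwa [hF0]
  have g2 : GenericAt pt (altPt P) fun u => DifferentiableAt ℂ (kappaPt α P) u :=
    (regularAt_kappaPt hP hα).generic_differentiableAt hptd
  have g3 : GenericAt pt (altPt P) fun u => ∀ k < 4 * P,
      DifferentiableAt ℂ (fun u => uTerm α P u k) u :=
    GenericAt.forall_lt (4 * P) fun k _ => (regularAt_uTerm hP k).generic_differentiableAt hptd
  have g4 : GenericAt pt (altPt P) fun u => Regular α P u :=
    GenericAt.forall_lt (4 * P) fun k _ => (regularAt_uTerm hP k).generic_ne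
      (by rw [uTerm_altPt hP]; exact pow_ne_zero _ (by norm_num))
  obtain ⟨S, hS0, hS⟩ := g1.and (g2.and (g3.and g4))
  -- The second factor is `s_0 - s_1` in terms of `u`.
  refine ⟨S * (MvPolynomial.X ⟨0, by omega⟩ * MvPolynomial.X ⟨1, by omega⟩
    - MvPolynomial.X ⟨2, by omega⟩ * MvPolynomial.X ⟨3, by omega⟩), ?_, ?_⟩
  · refine mul_ne_zero (by rintro rfl; simp at hS0) fun h => ?_
    have := congrArg (MvPolynomial.eval fun j : Fin (2 * P) => if (j : ℕ) < 2 then (1 : ℂ) else 0) h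
    simp at this
  · intro u₀ hu₀
    rw [map_mul] at hu₀
    have hS' := left_ne_zero_of_mul hu₀
    obtain ⟨hR₀, hk₀, hd₀, hreg₀⟩ := hS u₀ hS'
    have hs01 : (F u₀).2 ⟨0, by omega⟩ ≠ (F u₀).2 ⟨1, by omega⟩ := by
      have := right_ne_zero_of_mul hu₀
      simp only [map_sub, map_mul, MvPolynomial.eval_X] at this
      simp only [hF, piHat]
      rw [uTerm_of_lt α u₀ (i := 2 * 0) (by omega), uTerm_of_lt α u₀ (i := 2 * 0 + 1) (by omega),
        uTerm_of_lt α u₀ (i := 2 * 1) (by omega), uTerm_of_lt α u₀ (i := 2 * 1 + 1) (by omega)]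
      exact sub_ne_zero.1 this
    obtain ⟨W, x₁, x₂, χ₁, χ₂, hW, hT⟩ := hR (F u₀) hR₀ hs01
    have hbt : ∀ u, Regular α P u → IsBT α P (F u).1 (uTerm α P u (4 * P - 1)) (F u).2
        (piHat α P (phi α P u)) := fun u hu =>
      (isBT_iff_exists_point hP hα).2 ⟨u, hu, rfl, rfl, rfl, rfl⟩
    have hFc : ContinuousAt F u₀ := by
      refine hk₀.continuousAt.prodMk (continuousAt_pi.2 fun j => ?_)
      have := j.2
      exact (hd₀ _ (by omega)).continuousAt.mul (hd₀ _ (by omega)).continuousAt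
    have hWn : W ∈ 𝓝 (F u₀) := hT.isOpen.mem_nhds hW
    have main : ∀ y₁ y₂ ψ₁ ψ₂, IsTwoValuedOn α P W y₁ y₂ ψ₁ ψ₂ →
        uTerm α P u₀ (4 * P - 1) = y₁ (F u₀) →
        ∃ V : Set (Fin (2 * P) → ℂ), IsOpen V ∧ u₀ ∈ V ∧ ∀ u ∈ V,
            Regular α P u ∧ F u ∈ W ∧ piHat α P (phi α P u) = ψ₁ (F u) := by
      intro y₁ y₂ ψ₁ ψ₂ hy h0
      have e1 : ∀ᶠ u in 𝓝 u₀, MvPolynomial.eval (pt u) S ≠ 0 :=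
        (isOpen_eval_ne hptd.continuous S).mem_nhds hS'
      have e2 : ∀ᶠ u in 𝓝 u₀, F u ∈ W := hFc hWn
      have c2 : ContinuousAt (fun u => y₂ (F u)) u₀ :=
        ((hy.holo_x₂.differentiableAt hWn).continuousAt).comp hFc
      -- The gauge variable of `u` depends continuously on `u` and differs from the second root at
      -- `u₀`, so nearby it must be the first root.
      have e3 : ∀ᶠ u in 𝓝 u₀, uTerm α P u (4 * P - 1) ≠ y₂ (F u) :=
        ((hd₀ (4 * P - 1) (by omega)).continuousAt.ne_iff_eventually_ne c2).1
          (by rw [h0]; exact hy.x_ne _ hW)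
      obtain ⟨V, hV, hVo, hmem⟩ := eventually_nhds_iff.1 (e1.and (e2.and e3))
      refine ⟨V, hVo, hmem, fun u hu => ?_⟩
      obtain ⟨a1, a2, a3⟩ := hV u hu
      have hreg := (hS u a1).2.2.2
      refine ⟨hreg, a2, ?_⟩
      rcases (hy.isBT_iff _ a2 _ _).1 (hbt u hreg) with h | h
      · exact h.2
      · exact absurd h.1 a3
    rcases (hT.isBT_iff _ hW _ _).1 (hbt u₀ hreg₀) with h | h
    · exact ⟨W, x₁, x₂, χ₁, χ₂, hT, main _ _ _ _ hT h.1⟩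
    · exact ⟨W, x₂, x₁, χ₂, χ₁, hT.swap, main _ _ _ _ hT.swap h.1⟩

end Branch

/-! ## Two-forms evaluated on a pair of vectors -/

section Forms

/-- The wedge product of two linear forms, each given by its values on a pair of vectors. -/
def wedge (x y : ℂ × ℂ) : ℂ := x.1 * y.2 - x.2 * y.1

/-- The 2-form `∑ d_k ∧ a_k`. -/
def omegaForm (P : ℕ) (a d : ℕ → ℂ × ℂ) : ℂ := ∑ k ∈ Finset.range P, wedge (d k) (a k)

/-- The 2-form that represents the Poisson tensor. -/
def rhoForm (P : ℕ) (A B : ℕ → ℂ) (Q : ℂ) (a d : ℕ → ℂ × ℂ) : ℂ :=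
  (∑ l ∈ Finset.range P, wedge (∑ k ∈ Finset.range l, d k) (d l))
    - (∑ k ∈ Finset.range P, (A k + B k) * wedge (a k) (d k))
    + (∑ k ∈ Finset.range (P - 1), A (k + 1) * B k * wedge (a k) (a (k + 1)))
    - Q * wedge (a 0) (d (P - 1)) - Q * A (P - 1) * wedge (a 0) (a (P - 1))

lemma sum_shift (ω η : ℕ → ℂ × ℂ) (n : ℕ) : ∑ k ∈ Finset.range n, (η k + ω (k + 1))
    = (∑ k ∈ Finset.range n, (ω k + η k)) + ω n - ω 0 := by
  induction n with
  | zero => simp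
  | succ n ih => rw [Finset.sum_range_succ, Finset.sum_range_succ, ih]; abel

/-- The terms `ω_k + η_k` and `η_k + ω_{k+1}` are two groupings of one sequence `ω_0, η_0, ω_1, η_1,
…`. The ordered double sums therefore differ only by products of neighbours and by terms at the two
ends. -/
lemma ordered_sum_shift (ω η : ℕ → ℂ × ℂ) (n : ℕ) :
    (∑ l ∈ Finset.range n, wedge (∑ k ∈ Finset.range l, (η k + ω (k + 1))) (η l + ω (l + 1)))
      - (∑ l ∈ Finset.range n, wedge (∑ k ∈ Finset.range l, (ω k + η k)) (ω l + η l))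
    = wedge (∑ k ∈ Finset.range n, (ω k + η k)) (ω n)
      - (∑ l ∈ Finset.range n, wedge (η l) (ω l + ω (l + 1)))
      - wedge (ω 0) (∑ k ∈ Finset.range n, (η k + ω (k + 1))) := by
  induction n with
  | zero => simp [wedge]
  | succ n ih =>
    rw [Finset.sum_range_succ, Finset.sum_range_succ (fun l => wedge _ (ω l + η l)),
      Finset.sum_range_succ (fun l => wedge (η l) _), Finset.sum_range_succ (fun k => ω k + η k),
      Finset.sum_range_succ (fun k => η k + ω (k + 1))]
    have h := sum_shift ω η n
    generalize (∑ l ∈ Finset.range n, wedge (∑ k ∈ Finset.range l, (η k + ω (k + 1)))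
      (η l + ω (l + 1))) = T₁ at *
    generalize (∑ l ∈ Finset.range n, wedge (∑ k ∈ Finset.range l, (ω k + η k)) (ω l + η l)) = T₂ at *
    generalize (∑ l ∈ Finset.range n, wedge (η l) (ω l + ω (l + 1))) = T₃ at *
    rw [h] at ih ⊢
    generalize (∑ k ∈ Finset.range n, (ω k + η k)) = D at *
    simp only [wedge, Prod.fst_add, Prod.snd_add, Prod.fst_sub, Prod.snd_sub] at *
    linear_combination ih

/-- The change of the sums `∑ d_k` by the terms at both ends. -/
lemma ordered_sum_ends (p : ℕ) (d h : ℕ → ℂ × ℂ) (q : ℂ × ℂ) (h0 : d 0 = h 0 + q)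
    (hk : ∀ k < p, d (k + 1) = h (k + 1)) (hl : d (p + 1) = h (p + 1) - q)
    (hsum : ∑ k ∈ Finset.range (p + 2), h k = 0) :
    (∑ l ∈ Finset.range (p + 2), wedge (∑ k ∈ Finset.range l, d k) (d l))
      = (∑ l ∈ Finset.range (p + 2), wedge (∑ k ∈ Finset.range l, h k) (h l))
        - wedge q (h 0 + h (p + 1)) := by
  have key : ∀ n, n < p + 1 → ∑ k ∈ Finset.range (n + 1), d k = (∑ k ∈ Finset.range (n + 1), h k) + q := by
    intro n hn
    induction n with
    | zero => simp [h0]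
    | succ n ih =>
      rw [Finset.sum_range_succ, ih (by omega), Finset.sum_range_succ _ (n + 1), hk n (by omega)]
      abel
  have key2 : ∀ n, n < p + 1 → (∑ l ∈ Finset.range (n + 1), wedge (∑ k ∈ Finset.range l, d k) (d l))
      = (∑ l ∈ Finset.range (n + 1), wedge (∑ k ∈ Finset.range l, h k) (h l))
        + wedge q ((∑ k ∈ Finset.range (n + 1), h k) - h 0) := by
    intro n hn
    induction n with
    | zero => simp [wedge]
    | succ n ih =>
      rw [Finset.sum_range_succ, ih (by omega), Finset.sum_range_succ _ (n + 1),
        Finset.sum_range_succ h (n + 1), key n (by omega), hk n (by omega)]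
      simp only [wedge, Prod.fst_add, Prod.snd_add, Prod.fst_sub, Prod.snd_sub]
      ring
  rw [Finset.sum_range_succ] at hsum
  rw [Finset.sum_range_succ, key2 p (by omega), Finset.sum_range_succ _ (p + 1), key p (by omega), hl,
    eq_neg_of_add_eq_zero_left hsum]
  simp only [wedge, Prod.fst_add, Prod.snd_add, Prod.fst_sub, Prod.snd_sub, Prod.fst_neg,
    Prod.snd_neg]
  ring

/-- The relations between a pair of vectors `(a, d)` at `s`, and its image `(a', d')` at `s'`
under a Bäcklund transformation. -/
structure FormData (p : ℕ) (A B A' B' e o : ℕ → ℂ) (Q Q' ε r c : ℂ) (a a' d d' : ℕ → ℂ × ℂ)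
    (m : ℂ × ℂ) : Prop where
  pFirst : A 0 + B 0 = e 0 + c - ε + Q
  pMid : ∀ k < p, A (k + 1) + B (k + 1) = o k + e (k + 1) + c
  pLast : A (p + 1) = o p + e (p + 1) + c - Q
  bLast : B (p + 1) = 0
  prod : ∀ k < p + 1, A (k + 1) * B k = e k * o k
  dFirst : d 0 = e 0 • (a 0 - a' 0) - m + Q • (a (p + 1) - a 0)
  dMid : ∀ k < p, d (k + 1) = o k • (a' k - a (k + 1)) + e (k + 1) • (a (k + 1) - a' (k + 1))
  dLast : d (p + 1) = o p • (a' p - a (p + 1)) + e (p + 1) • (a (p + 1) - a' (p + 1))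
    - Q • (a (p + 1) - a 0)
  pMid' : ∀ k < p + 1, A' k + B' k = e k + o k + c
  pLast' : A' (p + 1) = e (p + 1) + c - ε
  bLast' : B' (p + 1) = 0
  prod' : ∀ k < p + 1, A' (k + 1) * B' k = o k * e (k + 1)
  dMid' : ∀ k < p + 1, d' k = e k • (a k - a' k) + o k • (a' k - a (k + 1))
  dLast' : d' (p + 1) = e (p + 1) • (a (p + 1) - a' (p + 1)) - m
  q : Q = r * e (p + 1)
  q' : Q' = r * e 0
  eps : ε + r * (c - ε) = 0
  mul_m : (r - 1) • m = ε • (a 0 - a' (p + 1))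
  wedge_m : wedge (a 0 - a' (p + 1)) m = 0

namespace FormData

variable {p : ℕ} {A B A' B' e o : ℕ → ℂ} {Q Q' ε r c : ℂ} {a a' d d' : ℕ → ℂ × ℂ} {m : ℂ × ℂ}

lemma sum_eq (h : FormData p A B A' B' e o Q Q' ε r c a a' d d' m) :
    ∑ k ∈ Finset.range (p + 2), d k = ∑ k ∈ Finset.range (p + 2), d' k := by
  rw [Finset.sum_range_succ, Finset.sum_range_succ', Finset.sum_range_succ _ (p + 1), h.dFirst,
    h.dLast, h.dLast', Finset.sum_congr rfl fun k hk => h.dMid k (Finset.mem_range.1 hk),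
    Finset.sum_congr rfl fun k hk => h.dMid' k (Finset.mem_range.1 hk),
    Finset.sum_add_distrib, Finset.sum_add_distrib, Finset.sum_range_succ (fun k => o k • _),
    Finset.sum_range_succ' (fun k => e k • _)]
  abel

/-- The contributions of `e_k` cancel and those of `o_k` telescope. The remainder at the ends is
`(a_0 - a'_{p+1}) ∧ m`, which is zero. -/
lemma omega_eq (h : FormData p A B A' B' e o Q Q' ε r c a a' d d' m) :
    omegaForm (p + 2) a d = omegaForm (p + 2) a' d' := by
  have key : ∀ n ≤ p, ∑ k ∈ Finset.range n, wedge (d (k + 1)) (a (k + 1))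
      - ∑ k ∈ Finset.range n, wedge (d' (k + 1)) (a' (k + 1))
      = wedge (o 0 • (a' 0 - a 1)) (a' 0)
        - wedge (o n • (a' n - a (n + 1))) (a' n) := by
    intro n hn
    induction n with
    | zero => simp
    | succ n ih =>
      rw [Finset.sum_range_succ, Finset.sum_range_succ, h.dMid n (by omega),
        h.dMid' (n + 1) (by omega)]
      have := ih (by omega)
      simp only [wedge, Prod.fst_add, Prod.snd_add, Prod.fst_sub, Prod.snd_sub, Prod.smul_fst,
        Prod.smul_snd, smul_eq_mul] at *
      linear_combination this
  have k1 := key p le_rfl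
  have k2 := h.wedge_m
  rw [omegaForm, omegaForm, Finset.sum_range_succ, Finset.sum_range_succ',
    Finset.sum_range_succ _ (p + 1), Finset.sum_range_succ' _ p, h.dFirst, h.dLast, h.dLast',
    h.dMid' 0 (by omega)]
  simp only [wedge, Prod.fst_add, Prod.snd_add, Prod.fst_sub, Prod.snd_sub, Prod.smul_fst,
    Prod.smul_snd, smul_eq_mul, zero_add] at *
  linear_combination k1 + k2

/-- Up to end terms, `d_k = ω_k + η_k` and `d'_k = η_k + ω_{k+1}` are two groupings of one sequence.
`ordered_sum_shift` gives the change of the ordered sums; the sums with coefficients `A + B` and `A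
B` compensate it term by term, and the part proportional to `c` is `omega_eq`. The relations for
`ε`, `r` and `m` absorb the ends. -/
lemma rho_eq (h : FormData p A B A' B' e o Q Q' ε r c a a' d d' m)
    (hsum : ∑ k ∈ Finset.range (p + 2), d k = 0) :
    rhoForm (p + 2) A B Q a d = rhoForm (p + 2) A' B' Q' a' d' := by
  set η : ℕ → ℂ × ℂ := fun k => e k • (a k - a' k) with hη
  -- The value `-m` at both ends closes the sequence up: the total sums of the two groupings then
  -- agree.
  set ω : ℕ → ℂ × ℂ := fun k =>
    if k = 0 ∨ k = p + 2 then -m else o (k - 1) • (a' (k - 1) - a k) with hω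
  set q : ℂ × ℂ := Q • (a (p + 1) - a 0) with hq
  have hω0 : ω 0 = -m := by simp [hω]
  have hωl : ω (p + 1 + 1) = -m := by simp [hω]
  have hωk : ∀ k < p + 1, ω (k + 1) = o k • (a' k - a (k + 1)) := fun k hk => by
    simp only [hω]; rw [if_neg (by omega), Nat.add_sub_cancel]
  have hd0 : d 0 = ω 0 + η 0 + q := by rw [h.dFirst, hω0, hq]; abel
  have hdk : ∀ k < p, d (k + 1) = ω (k + 1) + η (k + 1) := fun k hk => by
    rw [h.dMid k hk, hωk k (by omega)]
  have hdl : d (p + 1) = ω (p + 1) + η (p + 1) - q := by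
    rw [h.dLast, hωk p (by omega)]
  have hd' : ∀ k < p + 2, d' k = η k + ω (k + 1) := by
    intro k hk
    rcases Nat.lt_succ_iff_lt_or_eq.1 hk with h1 | rfl
    · rw [h.dMid' k h1, hωk k h1]
    · rw [h.dLast', hωl, sub_eq_add_neg]
  have hsum' : ∑ k ∈ Finset.range (p + 2), (η k + ω (k + 1)) = 0 := by
    rw [← Finset.sum_congr rfl fun k hk => hd' k (Finset.mem_range.1 hk), ← h.sum_eq, hsum]
  have hsumh : ∑ k ∈ Finset.range (p + 2), (ω k + η k) = 0 := by
    have := sum_shift ω η (p + 2)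
    rw [hsum', hω0, hωl] at this
    simpa using this.symm
  have k1 := ordered_sum_ends p d (fun k => ω k + η k) q hd0 hdk hdl hsumh
  have k2 := ordered_sum_shift ω η (p + 2)
  rw [hsumh, hsum'] at k2
  have k3 : (∑ l ∈ Finset.range (p + 2), wedge (∑ k ∈ Finset.range l, d' k) (d' l))
      = ∑ l ∈ Finset.range (p + 2),
        wedge (∑ k ∈ Finset.range l, (η k + ω (k + 1))) (η l + ω (l + 1)) := by
    refine Finset.sum_congr rfl fun l hl => ?_
    have hl := Finset.mem_range.1 hl
    rw [hd' l hl, Finset.sum_congr rfl fun k hk => hd' k (by have := Finset.mem_range.1 hk; omega)]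
  -- The interior contributions form a telescoping sum whose primitive is the expression in
  -- parentheses on the right, at `n` and at `0`.
  have bulk : ∀ n ≤ p, (∑ k ∈ Finset.range n, (A' (k + 1) + B' (k + 1)) * wedge (a' (k + 1)) (d' (k + 1)))
      - (∑ k ∈ Finset.range n, (A (k + 1) + B (k + 1)) * wedge (a (k + 1)) (d (k + 1)))
      - (∑ k ∈ Finset.range n, A' (k + 1) * B' k * wedge (a' k) (a' (k + 1)))
      + (∑ k ∈ Finset.range n, A (k + 1) * B k * wedge (a k) (a (k + 1)))
      + (∑ k ∈ Finset.range n, wedge (η (k + 1)) (ω (k + 1) + ω (k + 1 + 1)))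
      - c * ((∑ k ∈ Finset.range n, wedge (d (k + 1)) (a (k + 1)))
        - ∑ k ∈ Finset.range n, wedge (d' (k + 1)) (a' (k + 1)))
      = ((e n + o n) * wedge (a' n) (ω (n + 1)) + o n * wedge (a' n) (η n)
          + wedge (η n) (ω (n + 1)))
        - ((e 0 + o 0) * wedge (a' 0) (ω 1) + o 0 * wedge (a' 0) (η 0) + wedge (η 0) (ω 1)) := by
    intro n hn
    induction n with
    | zero => simp
    | succ n ih =>
      have := ih (by omega)
      simp only [Finset.sum_range_succ]
      rw [h.pMid' (n + 1) (by omega), h.pMid n (by omega), h.prod n (by omega), h.prod' n (by omega),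
        hd' (n + 1) (by omega), hdk n (by omega), hωk n (by omega), hωk (n + 1) (by omega)]
      rw [hωk n (by omega)] at this
      simp only [wedge, hη, Prod.fst_add, Prod.snd_add, Prod.fst_sub, Prod.snd_sub, Prod.smul_fst,
        Prod.smul_snd, smul_eq_mul] at *
      linear_combination this
  have k4 := bulk p le_rfl
  have k5 := h.omega_eq
  have k6 := h.wedge_m
  have k7 := congrArg Prod.fst h.mul_m
  have k8 := congrArg Prod.snd h.mul_m
  have k9 := h.eps
  rw [omegaForm, omegaForm, Finset.sum_range_succ, Finset.sum_range_succ',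
    Finset.sum_range_succ _ (p + 1), Finset.sum_range_succ' _ p] at k5
  rw [Finset.sum_range_succ (fun l => wedge (η l) _), Finset.sum_range_succ' _ p, ← k3] at k2
  have k10 : ∑ k ∈ Finset.range (p + 2), (A k + B k) * wedge (a k) (d k)
      = (∑ k ∈ Finset.range p, (A (k + 1) + B (k + 1)) * wedge (a (k + 1)) (d (k + 1)))
        + (e 0 + c - ε + Q) * wedge (a 0) (d 0)
        + (o p + e (p + 1) + c - Q) * wedge (a (p + 1)) (d (p + 1)) := by
    rw [Finset.sum_range_succ, Finset.sum_range_succ', h.pFirst, h.bLast, h.pLast, add_zero]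
  have k11 : ∑ k ∈ Finset.range (p + 2), (A' k + B' k) * wedge (a' k) (d' k)
      = (∑ k ∈ Finset.range p, (A' (k + 1) + B' (k + 1)) * wedge (a' (k + 1)) (d' (k + 1)))
        + (e 0 + o 0 + c) * wedge (a' 0) (d' 0)
        + (e (p + 1) + c - ε) * wedge (a' (p + 1)) (d' (p + 1)) := by
    rw [Finset.sum_range_succ, Finset.sum_range_succ', h.pMid' 0 (by omega), h.bLast', h.pLast',
      add_zero]
  have k12 : ∑ k ∈ Finset.range (p + 1), A (k + 1) * B k * wedge (a k) (a (k + 1))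
      = (∑ k ∈ Finset.range p, A (k + 1) * B k * wedge (a k) (a (k + 1)))
        + e p * o p * wedge (a p) (a (p + 1)) := by
    rw [Finset.sum_range_succ, h.prod p (by omega)]
  have k13 : ∑ k ∈ Finset.range (p + 1), A' (k + 1) * B' k * wedge (a' k) (a' (k + 1))
      = (∑ k ∈ Finset.range p, A' (k + 1) * B' k * wedge (a' k) (a' (k + 1)))
        + o p * e (p + 1) * wedge (a' p) (a' (p + 1)) := by
    rw [Finset.sum_range_succ, h.prod' p (by omega)]
  rw [rhoForm, rhoForm, k1, k10, k11, show p + 2 - 1 = p + 1 by omega, k12, k13, h.pLast, h.pLast',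
    h.q, h.q']
  rw [h.q] at hq
  clear bulk k1 k3 k10 k11 k12 k13
  generalize (∑ l ∈ Finset.range (p + 2), wedge (∑ k ∈ Finset.range l, d' k) (d' l)) = T₁ at *
  generalize (∑ l ∈ Finset.range (p + 2), wedge (∑ k ∈ Finset.range l, (ω k + η k)) (ω l + η l))
    = T₂ at *
  generalize (∑ k ∈ Finset.range p, wedge (η (k + 1)) (ω (k + 1) + ω (k + 1 + 1))) = T₃ at *
  generalize (∑ k ∈ Finset.range p, (A' (k + 1) + B' (k + 1)) * wedge (a' (k + 1)) (d' (k + 1)))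
    = T₄ at *
  generalize (∑ k ∈ Finset.range p, (A (k + 1) + B (k + 1)) * wedge (a (k + 1)) (d (k + 1)))
    = T₅ at *
  generalize (∑ k ∈ Finset.range p, A' (k + 1) * B' k * wedge (a' k) (a' (k + 1))) = T₆ at *
  generalize (∑ k ∈ Finset.range p, A (k + 1) * B k * wedge (a k) (a (k + 1))) = T₇ at *
  generalize (∑ k ∈ Finset.range p, wedge (d (k + 1)) (a (k + 1))) = T₈ at *
  generalize (∑ k ∈ Finset.range p, wedge (d' (k + 1)) (a' (k + 1))) = T₉ at *
  rw [hd0, hdl, hd' 0 (by omega), hd' (p + 1) (by omega), hωl, zero_add, hωk 0 (by omega),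
    hωk p (by omega), hω0] at k5 ⊢
  rw [hωl, zero_add, hωk 0 (by omega), hωk p (by omega), hω0] at k2
  rw [← zero_add 1, hωk 0 (by omega), hωk p (by omega), zero_add] at k4
  rw [hq] at *
  simp only [wedge, hη, Prod.fst_add, Prod.snd_add, Prod.fst_sub, Prod.snd_sub, Prod.smul_fst,
    Prod.smul_snd, smul_eq_mul, Prod.fst_neg, Prod.snd_neg, Prod.fst_zero, Prod.snd_zero] at *
  linear_combination -k2 + k4 + c * k5 - ε * k6 + (e (p + 1) * (a (p + 1)).1 - e 0 * (a' 0).1) * k8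
    - (e (p + 1) * (a (p + 1)).2 - e 0 * (a' 0).2) * k7
    - (e (p + 1) * ((a 0).1 * (a (p + 1)).2 - (a 0).2 * (a (p + 1)).1)
      - e 0 * ((a' 0).1 * (a' (p + 1)).2 - (a' 0).2 * (a' (p + 1)).1)) * k9

end FormData

end Forms

/-! ## The Poisson tensor as a 2-form -/

section Tensor

variable {α : ℂ} {P : ℕ}

/-- The product `s_k ⋯ s_{k+P-1}`. -/
def aCoef (P : ℕ) (s : Fin (2 * P - 1) → ℂ) (k : ℕ) : ℂ := ∏ i ∈ Finset.range P, coord s (k + i)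

/-- The quotient `α² / (s_{k+1} ⋯ s_{k+P-1})` for `k < P - 1`. -/
def bCoef (α : ℂ) (P : ℕ) (s : Fin (2 * P - 1) → ℂ) (k : ℕ) : ℂ :=
  if k + 1 < P then α ^ 2 / ∏ i ∈ Finset.range (P - 1), coord s (k + 1 + i) else 0

/-- The quotient `α² / (s_P ⋯ s_{2P-2})`. -/
def qCoef (α : ℂ) (P : ℕ) (s : Fin (2 * P - 1) → ℂ) : ℂ :=
  α ^ 2 / ∏ i ∈ Finset.range (P - 1), coord s (P + i)

/-- The differential of `aCoef k + bCoef k` in terms of the logarithmic differentials `t_n` of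
numbers `v_n` with `s_n = v_n / v_{n+1}`. -/
def dForm (α : ℂ) (P : ℕ) (s : Fin (2 * P - 1) → ℂ) (t : ℕ → ℂ) (k : ℕ) : ℂ :=
  aCoef P s k * (t k - t (P + k)) + bCoef α P s k * (t (P + k) - t (k + 1))

lemma poissonTensor_eq_sub (hP : 2 ≤ P) (s : Fin (2 * P - 1) → ℂ) (i j : Fin (2 * P - 1)) :
    poissonTensor α P s i j = bracketUpper α P s i j - bracketUpper α P s j i := by
  have key : ∀ i j : Fin (2 * P - 1), ¬ i < j → bracketUpper α P s i j = 0 := by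
    intro i j h
    have h' : (j : ℕ) ≤ i := not_lt.1 h
    rw [bracketUpper, if_neg (by omega), if_neg (by omega), if_neg (by omega), if_neg (by omega)]
    simp
  rw [poissonTensor]
  split_ifs with h1 h2
  · rw [key j i h1.le.not_gt, sub_zero]
  · rw [key i j h1, zero_sub]
  · rw [key i j h1, key j i h2, sub_zero]

lemma sum_fin_shift {N δ : ℕ} (hδ : δ ≤ N) (F : ℕ → ℕ → ℂ) :
    ∑ i : Fin N, ∑ j : Fin N, (if (j : ℕ) = i + δ then F i j else 0)
      = ∑ i ∈ Finset.range (N - δ), F i (i + δ) := by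
  have h1 : ∀ i : ℕ, ∑ j : Fin N, (if (j : ℕ) = i + δ then F i j else 0)
      = if i + δ < N then F i (i + δ) else 0 := by
    intro i
    rw [Fin.sum_univ_eq_sum_range (fun j => if j = i + δ then F i j else 0) N, Finset.sum_ite_eq']
    simp
  rw [Finset.sum_congr rfl fun (i : Fin N) _ => h1 i,
    Fin.sum_univ_eq_sum_range (fun i => if i + δ < N then F i (i + δ) else 0) N,
    ← Finset.sum_filter]
  congr 1
  ext i
  simp
  omega

/-- The tensor in logarithmic coordinates. -/
lemma sum_poissonTensor (p : ℕ) (s ξ η : Fin (2 * (p + 2) - 1) → ℂ) (hs : ∀ i, s i ≠ 0)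
    (ζ : ℕ → ℂ × ℂ)
    (hζ : ∀ i : Fin (2 * (p + 2) - 1), ζ i = (s i * ξ i, s i * η i)) :
    ∑ i, ∑ j, poissonTensor α (p + 2) s i j * ξ i * η j
      = (∑ i ∈ Finset.range (2 * p + 2), wedge (ζ i) (ζ (i + 1)))
        - 2 * (∑ i ∈ Finset.range (p + 2), wedge (ζ i) (ζ (i + (p + 1))))
        + 2 * (∑ i ∈ Finset.range (p + 1), wedge (ζ i) (ζ (i + (p + 2))))
        - α ^ 2 / (∏ i ∈ Finset.range (2 * p + 3), coord s i) * wedge (ζ 0) (ζ (2 * p + 2)) := by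
  have e1 : ∑ i, ∑ j, poissonTensor α (p + 2) s i j * ξ i * η j
      = ∑ i, ∑ j, bracketUpper α (p + 2) s i j * (ξ i * η j - ξ j * η i) := by
    have h1 : ∀ i j, poissonTensor α (p + 2) s i j * ξ i * η j
        = bracketUpper α (p + 2) s i j * (ξ i * η j) - bracketUpper α (p + 2) s j i * (ξ i * η j) :=
      fun i j => by rw [poissonTensor_eq_sub (by omega)]; ring
    simp only [h1, mul_sub, Finset.sum_sub_distrib]
    congr 1
    rw [Finset.sum_comm]
  have e2 : ∀ i j : Fin (2 * (p + 2) - 1),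
      bracketUpper α (p + 2) s i j * (ξ i * η j - ξ j * η i)
      = (if (j : ℕ) = i + 1 then wedge (ζ i) (ζ j) else 0)
        - 2 * (if (j : ℕ) = i + (p + 1) then wedge (ζ i) (ζ j) else 0)
        + 2 * (if (j : ℕ) = i + (p + 2) then wedge (ζ i) (ζ j) else 0)
        - (if (j : ℕ) = i + (2 * p + 2) then
            α ^ 2 / (∏ i ∈ Finset.range (2 * p + 3), coord s i) * wedge (ζ i) (ζ j) else 0) := by
    intro i j
    have hw : wedge (ζ i) (ζ j) = s i * s j * (ξ i * η j - ξ j * η i) := by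
      rw [hζ, hζ, wedge]; ring
    have h4 : (if (j : ℕ) = i + (2 * (p + 2) - 2) then
        -(α ^ 2 / ∏ k ∈ Finset.Icc ((i : ℕ) + 1) (i + (2 * (p + 2) - 3)), coord s k) else 0)
        * (ξ i * η j - ξ j * η i)
        = - (if (j : ℕ) = i + (2 * p + 2) then
            α ^ 2 / (∏ i ∈ Finset.range (2 * p + 3), coord s i) * wedge (ζ i) (ζ j) else 0) := by
      rw [show 2 * (p + 2) - 2 = 2 * p + 2 by omega]
      split_ifs with h
      · have hi : (i : ℕ) = 0 := by omega
        have hj : (j : ℕ) = 2 * p + 2 := by omega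
        have c0 : coord s 0 = s i := by rw [← coord_val s i, hi]
        have c1 : coord s (2 * p + 1 + 1) = s j := by rw [← coord_val s j, hj]
        have c2 : ∏ i ∈ Finset.range (2 * p + 3), coord s i
            = (∏ k ∈ Finset.range (2 * p + 1), coord s (1 + k)) * s j * s i := by
          rw [Finset.prod_range_succ', Finset.prod_range_succ, c0, c1]
          simp only [add_comm 1]
        rw [hw, prod_Icc_eq_range, hi, show 0 + (2 * (p + 2) - 3) + 1 - (0 + 1) = 2 * p + 1 by omega,
          c2]
        simp only [zero_add]
        have := hs i
        have := hs j
        have : ∏ k ∈ Finset.range (2 * p + 1), coord s (1 + k) ≠ 0 :=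
          Finset.prod_ne_zero_iff.2 fun k hk => by
            rw [coord_of_lt _ (by have := Finset.mem_range.1 hk; omega)]; exact hs _
        field_simp
      · simp
    rw [bracketUpper, add_mul, h4, hw, show p + 2 - 1 = p + 1 by omega]
    split_ifs <;> ring
  rw [e1]
  simp only [e2, Finset.sum_add_distrib, Finset.sum_sub_distrib, ← Finset.mul_sum]
  rw [sum_fin_shift (by omega) fun i j => wedge (ζ i) (ζ j),
    sum_fin_shift (by omega) fun i j => wedge (ζ i) (ζ j),
    sum_fin_shift (by omega) fun i j => wedge (ζ i) (ζ j),
    sum_fin_shift (by omega) fun i j =>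
      α ^ 2 / (∏ i ∈ Finset.range (2 * p + 3), coord s i) * wedge (ζ i) (ζ j),
    show 2 * (p + 2) - 1 - 1 = 2 * p + 2 by omega,
    show 2 * (p + 2) - 1 - (p + 1) = p + 2 by omega,
    show 2 * (p + 2) - 1 - (p + 2) = p + 1 by omega,
    show 2 * (p + 2) - 1 - (2 * p + 2) = 1 by omega]
  simp

/-- The tensor as a chain. -/
lemma chain_sum (p n : ℕ) (ζ E O : ℕ → ℂ × ℂ) (hE : ∀ m, E m = ζ m + ζ (p + 1 + m) - ζ (p + 1))
    (hO : ∀ m, O m = ζ m + ζ (p + 2 + m) - ζ (p + 1)) :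
    ∑ k ∈ Finset.range n, (wedge (E k) (O k) + wedge (O k) (E (k + 1)))
      = (∑ i ∈ Finset.range n, wedge (ζ i) (ζ (i + 1)))
        + (∑ i ∈ Finset.range n, wedge (ζ (p + 1 + i)) (ζ (p + 1 + i + 1)))
        - (∑ i ∈ Finset.range n, wedge (ζ i) (ζ (i + (p + 1))))
        - (∑ i ∈ Finset.range n, wedge (ζ (i + 1)) (ζ (i + 1 + (p + 1))))
        + 2 * (∑ i ∈ Finset.range n, wedge (ζ i) (ζ (i + (p + 2))))
        - wedge (ζ (p + 1)) (ζ n - ζ 0 + ζ (p + 1 + n) - ζ (p + 1)) := by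
  induction n with
  | zero => simp [wedge]
  | succ n ih =>
    simp only [Finset.sum_range_succ]
    rw [ih, hE, hO, hE, show n + (p + 1) = p + 1 + n by ring, show n + 1 + (p + 1) = p + 2 + n by ring,
      show n + (p + 2) = p + 2 + n by ring, show p + 1 + (n + 1) = p + 2 + n by ring,
      show p + 1 + n + 1 = p + 2 + n by ring]
    simp only [wedge, Prod.fst_add, Prod.snd_add, Prod.fst_sub, Prod.snd_sub]
    ring

/-- The part of the tensor that is constant in logarithmic coordinates becomes a chain of products
of neighbours `E_0, O_0, E_1, O_1, …`. These combinations are chosen because each involves only one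
of the differentials `dForm`. -/
lemma tensor_eq_chain (p : ℕ) (ζ E O : ℕ → ℂ × ℂ)
    (hE : ∀ m, E m = ζ m + ζ (p + 1 + m) - ζ (p + 1))
    (hO : ∀ m, O m = ζ m + ζ (p + 2 + m) - ζ (p + 1)) :
    (∑ i ∈ Finset.range (2 * p + 2), wedge (ζ i) (ζ (i + 1)))
        - 2 * (∑ i ∈ Finset.range (p + 2), wedge (ζ i) (ζ (i + (p + 1))))
        + 2 * (∑ i ∈ Finset.range (p + 1), wedge (ζ i) (ζ (i + (p + 2))))
    = ∑ k ∈ Finset.range (p + 1), (wedge (E k) (O k) + wedge (O k) (E (k + 1))) := by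
  rw [chain_sum p (p + 1) ζ E O hE hO, show 2 * p + 2 = (p + 1) + (p + 1) by ring,
    Finset.sum_range_add]
  have h1 := Finset.sum_range_succ (fun i => wedge (ζ i) (ζ (i + (p + 1)))) (p + 1)
  have h2 := Finset.sum_range_succ' (fun i => wedge (ζ i) (ζ (i + (p + 1)))) (p + 1)
  rw [zero_add] at h2
  have h3 : wedge (ζ (p + 1)) (ζ (p + 1) - ζ 0 + ζ (p + 1 + (p + 1)) - ζ (p + 1))
      = wedge (ζ (p + 1)) (ζ (p + 1 + (p + 1))) + wedge (ζ 0) (ζ (p + 1)) := by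
    simp only [wedge, Prod.fst_add, Prod.snd_add, Prod.fst_sub, Prod.snd_sub]; ring
  rw [h3]
  linear_combination -h1 - h2

/-- The chain in terms of coordinates for which the tensor is the form `rhoForm`. -/
lemma chain_eq_rho (n : ℕ) (A B : ℕ → ℂ) (x y E O : ℕ → ℂ × ℂ)
    (hE : ∀ m ≤ n, E m = (∑ k ∈ Finset.range m, x k) + A m • y m)
    (hO : ∀ m < n, O m = (∑ k ∈ Finset.range (m + 1), x k) + B m • y m) :
    ∑ k ∈ Finset.range n, (wedge (E k) (O k) + wedge (O k) (E (k + 1)))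
      = (∑ l ∈ Finset.range n, wedge (∑ k ∈ Finset.range l, x k) (x l))
        + (∑ k ∈ Finset.range n, (A k + B k) * wedge (y k) (x k))
        + (∑ k ∈ Finset.range n, A (k + 1) * B k * wedge (y k) (y (k + 1)))
        + A n * wedge (∑ k ∈ Finset.range n, x k) (y n) := by
  induction n with
  | zero => simp [wedge]
  | succ n ih =>
    have := ih (fun m hm => hE m (by omega)) fun m hm => hO m (by omega)
    rw [Finset.sum_range_succ, this, hE n (by omega), hO n (by omega), hE (n + 1) le_rfl]
    simp only [Finset.sum_range_succ]
    generalize ∑ k ∈ Finset.range n, x k = X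
    simp only [wedge, Prod.fst_add, Prod.snd_add, Prod.smul_fst, Prod.smul_snd, smul_eq_mul]
    ring

lemma sum_step_smul {N m : ℕ} (hm : m < N) (ζ : ℕ → ℂ × ℂ) :
    ∑ a ∈ Finset.range N,
      ((if a ≤ m then (1 : ℂ) else 0) - (if a + 1 ≤ m then 1 else 0)) • ζ a = ζ m := by
  rw [Finset.sum_eq_single_of_mem m (Finset.mem_range.2 hm)]
  · simp
  · intro b _ hb
    rcases lt_or_gt_of_ne hb with h | h
    · rw [if_pos h.le, if_pos (by omega)]; simp
    · rw [if_neg (by omega), if_neg (by omega)]; simp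

lemma sum_ite_lt {P m : ℕ} (hm : m ≤ P) (x : ℕ → ℂ × ℂ) :
    ∑ k ∈ Finset.range P, (if k < m then (1 : ℂ) else 0) • x k = ∑ k ∈ Finset.range m, x k := by
  rw [← Finset.sum_subset (Finset.range_subset_range.2 hm)]
  · exact Finset.sum_congr rfl fun k hk => by rw [if_pos (Finset.mem_range.1 hk), one_smul]
  · intro k _ hk
    rw [if_neg (by simpa using hk), zero_smul]

/-- For this step function the differences in the `bCoef` part all vanish, and those in the `aCoef`
part vanish except at `k = m`. -/
lemma sum_dForm_eq_a {s : Fin (2 * P - 1) → ℂ} {m : ℕ} (hm : m < P) {t : ℕ → ℂ}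
    (h1 : ∀ k < P, t k = if k ≤ m then 1 else 0) (h2 : ∀ k < P, t (P + k) = if k < m then 1 else 0)
    (y : ℕ → ℂ × ℂ) :
    ∑ k ∈ Finset.range P, dForm α P s t k • y k = aCoef P s m • y m := by
  have hb : ∀ k < P, bCoef α P s k * (t (P + k) - t (k + 1)) = 0 := by
    intro k hk
    rcases Nat.lt_or_ge (k + 1) P with h | h
    · rw [h2 k hk, h1 (k + 1) h]; simp only [Nat.succ_le_iff, sub_self, mul_zero]
    · rw [bCoef, if_neg (by omega), zero_mul]
  rw [Finset.sum_eq_single_of_mem m (Finset.mem_range.2 hm)]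
  · rw [dForm, hb m hm, h1 m hm, h2 m hm]; simp
  · intro k hk hkm
    have hk := Finset.mem_range.1 hk
    rw [dForm, hb k hk, h1 k hk, h2 k hk]
    rcases lt_or_gt_of_ne hkm with h | h
    · rw [if_pos h.le, if_pos h]; simp
    · rw [if_neg (by omega), if_neg (by omega)]; simp

lemma sum_dForm_eq_b {s : Fin (2 * P - 1) → ℂ} {m : ℕ} (hm : m + 1 < P) {t : ℕ → ℂ}
    (h1 : ∀ k < P, t k = if k ≤ m then 1 else 0) (h2 : ∀ k < P, t (P + k) = if k ≤ m then 1 else 0)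
    (y : ℕ → ℂ × ℂ) :
    ∑ k ∈ Finset.range P, dForm α P s t k • y k = bCoef α P s m • y m := by
  have ha : ∀ k < P, aCoef P s k * (t k - t (P + k)) = 0 := fun k hk => by
    rw [h2 k hk, h1 k hk, sub_self, mul_zero]
  rw [Finset.sum_eq_single_of_mem m (Finset.mem_range.2 (by omega))]
  · rw [dForm, ha m (by omega), h2 m (by omega), h1 (m + 1) hm]; simp
  · intro k hk hkm
    have hk := Finset.mem_range.1 hk
    rw [dForm, ha k hk, h2 k hk]
    rcases Nat.lt_or_ge (k + 1) P with h | h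
    · rw [h1 _ h]
      rcases lt_or_gt_of_ne hkm with h | h
      · rw [if_pos h.le, if_pos (by omega)]; simp
      · rw [if_neg (by omega), if_neg (by omega)]; simp
    · rw [bCoef, if_neg (by omega)]; simp

/-- The value of the Poisson tensor on two covectors, which are written in terms of the forms
`t_{P+k}` and `dForm k`. -/
theorem sum_poissonTensor_eq_rho (p : ℕ) (s ξ η : Fin (2 * (p + 2) - 1) → ℂ) (hs : ∀ i, s i ≠ 0)
    (x y : ℕ → ℂ × ℂ) (hx : ∑ k ∈ Finset.range (p + 2), x k = 0)
    (h : ∀ t : ℕ → ℂ, ∑ i : Fin (2 * (p + 2) - 1), (t i - t ((i : ℕ) + 1)) • (s i * ξ i, s i * η i)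
      = ∑ k ∈ Finset.range (p + 2), (t (p + 2 + k) • x k + dForm α (p + 2) s t k • y k)) :
    ∑ i, ∑ j, poissonTensor α (p + 2) s i j * ξ i * η j
      = rhoForm (p + 2) (aCoef (p + 2) s) (bCoef α (p + 2) s) (qCoef α (p + 2) s)
          (fun k => -y k) x := by
  set ζ : ℕ → ℂ × ℂ := fun n => (coord s n * coord ξ n, coord s n * coord η n) with hζ
  have hζ' : ∀ i : Fin (2 * (p + 2) - 1), ζ i = (s i * ξ i, s i * η i) := fun i => by
    simp only [hζ, coord_val]
  have h' : ∀ t : ℕ → ℂ, ∑ a ∈ Finset.range (2 * (p + 2) - 1), (t a - t (a + 1)) • ζ a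
      = ∑ k ∈ Finset.range (p + 2), (t (p + 2 + k) • x k + dForm α (p + 2) s t k • y k) := by
    intro t
    rw [← h t, ← Fin.sum_univ_eq_sum_range (fun a => (t a - t (a + 1)) • ζ a)]
    exact Finset.sum_congr rfl fun i _ => by rw [hζ']
  set E : ℕ → ℂ × ℂ := fun m => ζ m + ζ (p + 1 + m) - ζ (p + 1) with hE
  set O : ℕ → ℂ × ℂ := fun m => ζ m + ζ (p + 2 + m) - ζ (p + 1) with hO
  have hb : bCoef α (p + 2) s (p + 1) = 0 := by rw [bCoef, if_neg (by omega)]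
  -- A unit step that ends at `m` extracts the single term `ζ_m`; the combination of three steps
  -- extracts `E_m` or `O_m`, according to the choice of `l`.
  have step : ∀ m l : ℕ, m ≤ p + 1 → m + p + 1 ≤ l → l ≤ 2 * p + 2 → ∀ t : ℕ → ℂ,
      (∀ n, t n = (if n ≤ m then 1 else 0) + (if n ≤ l then 1 else 0)
        - (if n ≤ p + 1 then 1 else 0)) →
      ∑ a ∈ Finset.range (2 * (p + 2) - 1), (t a - t (a + 1)) • ζ a = ζ m + ζ l - ζ (p + 1) := by
    intro m l hm _ hl t ht
    rw [← sum_step_smul (N := 2 * (p + 2) - 1) (m := m) (by omega) ζ,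
      ← sum_step_smul (N := 2 * (p + 2) - 1) (m := l) (by omega) ζ,
      ← sum_step_smul (N := 2 * (p + 2) - 1) (m := p + 1) (by omega) ζ,
      ← Finset.sum_add_distrib, ← Finset.sum_sub_distrib]
    refine Finset.sum_congr rfl fun a _ => ?_
    rw [← add_smul, ← sub_smul, ht, ht]
    congr 1; ring
  have hE' : ∀ m ≤ p + 1, E m = (∑ k ∈ Finset.range m, x k) + aCoef (p + 2) s m • y m := by
    intro m hm
    set t : ℕ → ℂ := fun n => (if n ≤ m then 1 else 0) + (if n ≤ p + 1 + m then 1 else 0)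
        - (if n ≤ p + 1 then 1 else 0) with ht
    have t1 : ∀ k < p + 2, t k = if k ≤ m then 1 else 0 := fun k hk => by
      rw [ht]; dsimp only
      rw [if_pos (by omega : k ≤ p + 1 + m), if_pos (by omega : k ≤ p + 1), add_sub_cancel_right]
    have t2 : ∀ k < p + 2, t (p + 2 + k) = if k < m then 1 else 0 := fun k hk => by
      rw [ht]; dsimp only
      rw [if_neg (by omega : ¬ p + 2 + k ≤ m), if_neg (by omega : ¬ p + 2 + k ≤ p + 1), zero_add,
        sub_zero]
      simp only [show p + 2 + k ≤ p + 1 + m ↔ k < m by omega]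
    have h1 := h' t
    rw [step m (p + 1 + m) hm (by omega) (by omega) t fun n => rfl, Finset.sum_add_distrib,
      sum_dForm_eq_a (by omega) t1 t2, Finset.sum_congr rfl fun k hk => by
        rw [t2 k (Finset.mem_range.1 hk)], sum_ite_lt (by omega)] at h1
    exact h1
  have hO' : ∀ m < p + 1, O m = (∑ k ∈ Finset.range (m + 1), x k) + bCoef α (p + 2) s m • y m := by
    intro m hm
    set t : ℕ → ℂ := fun n => (if n ≤ m then 1 else 0) + (if n ≤ p + 2 + m then 1 else 0)
        - (if n ≤ p + 1 then 1 else 0) with ht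
    have t1 : ∀ k < p + 2, t k = if k ≤ m then 1 else 0 := fun k hk => by
      rw [ht]; dsimp only
      rw [if_pos (by omega : k ≤ p + 2 + m), if_pos (by omega : k ≤ p + 1), add_sub_cancel_right]
    have t2 : ∀ k < p + 2, t (p + 2 + k) = if k ≤ m then 1 else 0 := fun k hk => by
      rw [ht]; dsimp only
      rw [if_neg (by omega : ¬ p + 2 + k ≤ m), if_neg (by omega : ¬ p + 2 + k ≤ p + 1), zero_add,
        sub_zero]
      simp only [show p + 2 + k ≤ p + 2 + m ↔ k ≤ m by omega]
    have t3 : ∀ k < p + 2, t (p + 2 + k) = if k < m + 1 then 1 else 0 := fun k hk => by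
      simp only [t2 k hk, Nat.lt_succ_iff]
    have h1 := h' t
    rw [step m (p + 2 + m) hm.le (by omega) (by omega) t fun n => rfl, Finset.sum_add_distrib,
      sum_dForm_eq_b (by omega) t1 t2, Finset.sum_congr rfl fun k hk => by
        rw [t3 k (Finset.mem_range.1 hk)], sum_ite_lt (by omega)] at h1
    exact h1
  have hne : ∀ k < 2 * (p + 2) - 1, coord s k ≠ 0 := fun k hk => by
    rw [coord_of_lt _ hk]; exact hs _
  -- The exceptional entry of the tensor pairs `ζ_0 = E_0` with `ζ_{2p+2} = E_{p+1}`. The factor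
  -- `aCoef 0` in `E_0` turns its coefficient into `qCoef`, the source of the `Q` terms of
  -- `rhoForm`.
  have hν : α ^ 2 / (∏ i ∈ Finset.range (2 * p + 3), coord s i) * aCoef (p + 2) s 0
      = qCoef α (p + 2) s := by
    have h1 : ∏ i ∈ Finset.range (p + 2), coord s i ≠ 0 := Finset.prod_ne_zero_iff.2 fun i hi =>
      hne i (by have := Finset.mem_range.1 hi; omega)
    have h2 : ∏ i ∈ Finset.range (p + 1), coord s (p + 2 + i) ≠ 0 :=
      Finset.prod_ne_zero_iff.2 fun i hi =>
        hne _ (by have := Finset.mem_range.1 hi; omega)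
    rw [show 2 * p + 3 = p + 2 + (p + 1) by ring, Finset.prod_range_add, aCoef, qCoef,
      show p + 2 - 1 = p + 1 by omega]
    simp only [zero_add]
    field_simp
  have hE0 := hE' 0 (by omega)
  have hE1 := hE' (p + 1) le_rfl
  have hζ0 : ζ 0 = E 0 := by rw [hE]; simp
  have hζ1 : ζ (2 * p + 2) = E (p + 1) := by
    rw [hE]; dsimp only; rw [add_sub_cancel_left]; congr 1; ring
  have hx' := hx
  rw [Finset.sum_range_succ] at hx'
  have n1 : ∑ k ∈ Finset.range (p + 2),
        (aCoef (p + 2) s k + bCoef α (p + 2) s k) * wedge (-y k) (x k)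
      = -(∑ k ∈ Finset.range (p + 1),
        (aCoef (p + 2) s k + bCoef α (p + 2) s k) * wedge (y k) (x k))
        - aCoef (p + 2) s (p + 1) * wedge (y (p + 1)) (x (p + 1)) := by
    have e : ∀ k, (aCoef (p + 2) s k + bCoef α (p + 2) s k) * wedge (-y k) (x k)
        = -((aCoef (p + 2) s k + bCoef α (p + 2) s k) * wedge (y k) (x k)) := fun k => by
      simp only [wedge, Prod.fst_neg, Prod.snd_neg]; ring
    simp only [e, Finset.sum_neg_distrib]
    rw [Finset.sum_range_succ, hb]; ring
  have n2 : ∀ k, aCoef (p + 2) s (k + 1) * bCoef α (p + 2) s k * wedge (-y k) (-y (k + 1))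
      = aCoef (p + 2) s (k + 1) * bCoef α (p + 2) s k * wedge (y k) (y (k + 1)) := fun k => by
    simp only [wedge, Prod.fst_neg, Prod.snd_neg]; ring
  have n3 : ∑ l ∈ Finset.range (p + 2), wedge (∑ k ∈ Finset.range l, x k) (x l)
      = ∑ l ∈ Finset.range (p + 1), wedge (∑ k ∈ Finset.range l, x k) (x l) := by
    rw [Finset.sum_range_succ _ (p + 1), eq_neg_of_add_eq_zero_left hx']
    simp [wedge, mul_comm]
  rw [sum_poissonTensor p s ξ η hs ζ hζ', tensor_eq_chain p ζ E O (fun _ => rfl) fun _ => rfl,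
    chain_eq_rho (p + 1) _ _ x y E O hE' hO', hζ0, hζ1, hE0, hE1, rhoForm, ← hν,
    show p + 2 - 1 = p + 1 by omega, n1, n3, eq_neg_of_add_eq_zero_left hx']
  simp only [n2, Finset.range_zero, Finset.sum_empty, zero_add]
  simp only [wedge, Prod.fst_neg, Prod.snd_neg, Prod.fst_add, Prod.snd_add, Prod.smul_fst,
    Prod.smul_snd, smul_eq_mul]
  ring

end Tensor

/-! ## Differentials along a branch of the correspondence -/

section Analysis

/-- If the product of two functions is locally constant, then their differentials are
proportional. -/
lemma fderiv_mul_fderiv_comm {E : Type*} [NormedAddCommGroup E] [NormedSpace ℂ E] {f g : E → ℂ}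
    {s : E} (hf : DifferentiableAt ℂ f s) (hg : DifferentiableAt ℂ g s) {c : ℂ}
    (h : ∀ᶠ σ in 𝓝 s, f σ * g σ = c) (X Y : E) :
    fderiv ℂ f s X * fderiv ℂ g s Y = fderiv ℂ f s Y * fderiv ℂ g s X := by
  have h0 : f s * g s = c := h.self_of_nhds
  have hd : ∀ Z, f s * fderiv ℂ g s Z + fderiv ℂ f s Z * g s = 0 := by
    intro Z
    have e1 : fderiv ℂ (fun σ => f σ * g σ) s = 0 := by
      rw [Filter.EventuallyEq.fderiv_eq (h : (fun σ => f σ * g σ) =ᶠ[𝓝 s] fun _ => c)]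
      simp
    rw [fderiv_fun_mul hf hg] at e1
    have := congrArg (fun l : E →L[ℂ] ℂ => l Z) e1
    simp only [_root_.add_apply, _root_.smul_apply, smul_eq_mul,
      _root_.zero_apply] at this
    linear_combination this
  by_cases h1 : f s = 0
  · by_cases h2 : g s = 0
    -- If both functions vanish at `s`, the product rule gives nothing. The second-order term of `f
    -- g = 0` along lines shows that the product of the differentials vanishes on the diagonal;
    -- polarisation then shows that both sides vanish.
    · have key : ∀ Z, fderiv ℂ f s Z * fderiv ℂ g s Z = 0 := by
        intro Z
        have t1 := (hf.hasFDerivAt.hasLineDerivAt Z).tendsto_slope_zero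
        have t2 := (hg.hasFDerivAt.hasLineDerivAt Z).tendsto_slope_zero
        have t3 := t1.mul t2
        refine tendsto_nhds_unique (t3.congr' ?_) tendsto_const_nhds
        have hc : Filter.Tendsto (fun t : ℂ => s + t • Z) (𝓝[≠] 0) (𝓝 s) := by
          have : Continuous fun t : ℂ => s + t • Z := by fun_prop
          have := this.tendsto 0
          rw [zero_smul, add_zero] at this
          exact this.mono_left nhdsWithin_le_nhds
        filter_upwards [hc.eventually h] with t ht
        rw [h1, h2, zero_mul] at h0
        rw [← h0] at ht
        simp only [h1, h2, sub_zero, smul_eq_mul]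
        linear_combination t⁻¹ * t⁻¹ * ht
      have k1 := key X
      have k2 := key Y
      have k3 := key (X + Y)
      rw [map_add, map_add] at k3
      have k4 : fderiv ℂ f s X * fderiv ℂ g s Y = -(fderiv ℂ f s Y * fderiv ℂ g s X) := by
        linear_combination k3 - k1 - k2
      have k5 : (fderiv ℂ f s Y * fderiv ℂ g s X) ^ 2 = 0 := by
        linear_combination (fderiv ℂ f s Y * fderiv ℂ g s X) * k4
          - (fderiv ℂ f s Y * fderiv ℂ g s Y) * k1
      rw [k4, pow_eq_zero_iff two_ne_zero |>.1 k5, neg_zero]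
    · have e : ∀ Z, fderiv ℂ f s Z = 0 := fun Z => by
        have := hd Z
        rw [h1, zero_mul, zero_add] at this
        exact (mul_eq_zero.1 this).resolve_right h2
      rw [e, e]; ring
  · apply mul_left_cancel₀ h1
    linear_combination fderiv ℂ f s X * hd Y - fderiv ℂ f s Y * hd X

variable {α κ : ℂ} {P : ℕ} {s : Fin (2 * P - 1) → ℂ}

/-- The tangent vector at `s` given by the logarithmic derivatives `t_n` of numbers `v_n` with
`s_n = v_n / v_{n+1}`. -/
def tang (s : Fin (2 * P - 1) → ℂ) (t : ℕ → ℂ) : Fin (2 * P - 1) → ℂ :=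
  fun i => s i * (t i - t ((i : ℕ) + 1))

/-- The logarithmic differential of `f` at `s` is `ℓ`. -/
def LogD (s : Fin (2 * P - 1) → ℂ) (f : (Fin (2 * P - 1) → ℂ) → ℂ) (ℓ : (ℕ → ℂ) → ℂ) : Prop :=
  DifferentiableAt ℂ f s ∧ ∀ t, fderiv ℂ f s (tang s t) = f s * ℓ t

namespace LogD

variable {f g : (Fin (2 * P - 1) → ℂ) → ℂ} {ℓ m : (ℕ → ℂ) → ℂ}

lemma mul (hf : LogD s f ℓ) (hg : LogD s g m) :
    LogD s (fun σ => f σ * g σ) fun t => ℓ t + m t := by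
  refine ⟨hf.1.fun_mul hg.1, fun t => ?_⟩
  rw [fderiv_fun_mul hf.1 hg.1]
  simp only [_root_.add_apply, _root_.smul_apply, smul_eq_mul, hf.2, hg.2]
  ring

lemma const (c : ℂ) : LogD s (fun _ => c) fun _ => 0 :=
  ⟨differentiableAt_const c, fun t => by simp⟩

lemma congr (hf : LogD s f ℓ) (h : ∀ᶠ σ in 𝓝 s, g σ = f σ) (hℓ : ∀ t, m t = ℓ t) :
    LogD s g m := by
  refine ⟨hf.1.congr_of_eventuallyEq h, fun t => ?_⟩
  rw [Filter.EventuallyEq.fderiv_eq (h : g =ᶠ[𝓝 s] f), hf.2, h.self_of_nhds, hℓ]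

lemma inv (hf : LogD s f ℓ) (h0 : f s ≠ 0) : LogD s (fun σ => (f σ)⁻¹) fun t => -ℓ t := by
  have hd := hf.1.fun_inv h0
  refine ⟨hd, fun t => ?_⟩
  have h1 : fderiv ℂ (fun σ => f σ * (f σ)⁻¹) s (tang s t) = 0 := by
    have : (fun σ => f σ * (f σ)⁻¹) =ᶠ[𝓝 s] fun _ => 1 :=
      (hf.1.continuousAt.eventually_ne h0).mono fun σ hσ => mul_inv_cancel₀ hσ
    rw [this.fderiv_eq]; simp
  rw [fderiv_fun_mul hf.1 hd] at h1
  simp only [_root_.add_apply, _root_.smul_apply, smul_eq_mul, hf.2] at h1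
  apply mul_left_cancel₀ h0
  field_simp at h1 ⊢
  linear_combination h1

lemma coord {n : ℕ} (hn : n < 2 * P - 1) :
    LogD s (fun σ => TodaBT.coord σ n) fun t => t n - t (n + 1) := by
  simp only [coord_of_lt _ hn]
  refine ⟨by fun_prop, fun t => ?_⟩
  have : fderiv ℂ (fun σ : Fin (2 * P - 1) → ℂ => σ ⟨n, hn⟩) s
      = ContinuousLinearMap.proj ⟨n, hn⟩ :=
    (ContinuousLinearMap.proj (R := ℂ) (φ := fun _ : Fin (2 * P - 1) => ℂ) ⟨n, hn⟩).fderiv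
  rw [this]; rfl

lemma prod {F : ℕ → (Fin (2 * P - 1) → ℂ) → ℂ} {T : ℕ → (ℕ → ℂ) → ℂ} {N : ℕ}
    (h : ∀ n < N, LogD s (F n) fun t => T n t - T (n + 1) t) {k m : ℕ} (hkm : k + m ≤ N) :
    LogD s (fun σ => ∏ i ∈ Finset.range m, F (k + i) σ) fun t => T k t - T (k + m) t := by
  induction m with
  | zero => simpa using const 1
  | succ m ih =>
    simp only [Finset.prod_range_succ]
    exact ((ih (by omega)).mul (h (k + m) (by omega))).congr (Filter.Eventually.of_forall fun _ => rfl)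
      fun t => by rw [← add_assoc]; ring

end LogD

section Coefficients

variable {S : (Fin (2 * P - 1) → ℂ) → Fin (2 * P - 1) → ℂ} {T : ℕ → (ℕ → ℂ) → ℂ}

lemma logD_aCoef (h : ∀ n < 2 * P - 1, LogD s (fun σ => coord (S σ) n) fun t => T n t - T (n + 1) t)
    {k : ℕ} (hk : k < P) :
    LogD s (fun σ => aCoef P (S σ) k) fun t => T k t - T (P + k) t := by
  rw [add_comm P k]
  exact LogD.prod h (by omega)

lemma logD_bCoef (h : ∀ n < 2 * P - 1, LogD s (fun σ => coord (S σ) n) fun t => T n t - T (n + 1) t)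
    (hne : ∀ n, S s n ≠ 0) {k : ℕ} :
    LogD s (fun σ => bCoef α P (S σ) k) fun t => T (P + k) t - T (k + 1) t := by
  unfold bCoef
  split_ifs with h1
  · have h2 := LogD.prod h (k := k + 1) (m := P - 1) (by omega)
    refine ((LogD.const (α ^ 2)).mul (h2.inv ?_)).congr
      (Filter.Eventually.of_forall fun σ => div_eq_mul_inv _ _) fun t => ?_
    · refine Finset.prod_ne_zero_iff.2 fun i hi => ?_
      have := Finset.mem_range.1 hi
      rw [coord_of_lt _ (by omega)]; exact hne _
    · rw [show k + 1 + (P - 1) = P + k by omega]; ring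
  · refine ⟨differentiableAt_const _, fun t => by simp⟩

lemma fderiv_aCoef_add_bCoef
    (h : ∀ n < 2 * P - 1, LogD s (fun σ => coord (S σ) n) fun t => T n t - T (n + 1) t)
    (hne : ∀ n, S s n ≠ 0) {k : ℕ} (hk : k < P) (t : ℕ → ℂ) :
    fderiv ℂ (fun σ => aCoef P (S σ) k + bCoef α P (S σ) k) s (tang s t)
      = dForm α P (S s) (fun n => T n t) k := by
  have h1 := logD_aCoef h hk
  have h2 := logD_bCoef (α := α) (k := k) h hne
  rw [fderiv_fun_add h1.1 h2.1, _root_.add_apply, h1.2, h2.2, dForm]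

end Coefficients

/-! ### The relations along a chain -/

namespace IsChain

variable {x : ℂ} {s' : Fin (2 * P - 1) → ℂ} {w : ℤ → ℂ}

lemma prod_coord (h : IsChain α P κ x s s' w) {k m : ℕ} (hkm : k + m < 2 * P) :
    ∏ i ∈ Finset.range m, coord s (k + i) = wprod w (2 * k) (2 * m) := by
  induction m with
  | zero => simp
  | succ m ih =>
    rw [Finset.prod_range_succ, ih (by omega), coord_of_lt _ (by omega : k + m < 2 * P - 1), h.even,
      show 2 * (m + 1) = 2 * m + 1 + 1 by ring, wprod_succ, wprod_succ, mul_assoc]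
    push_cast
    rw [show 2 * ((k : ℤ) + m) = 2 * k + 2 * m by ring,
      show 2 * (k : ℤ) + 2 * m + 1 = 2 * k + (2 * m + 1) by ring]

lemma prod_coord' (h : IsChain α P κ x s s' w) {k m : ℕ} (hkm : k + m < 2 * P) :
    ∏ i ∈ Finset.range m, coord s' (k + i) = wprod w (2 * k + 1) (2 * m) := by
  induction m with
  | zero => simp
  | succ m ih =>
    rw [Finset.prod_range_succ, ih (by omega), coord_of_lt _ (by omega : k + m < 2 * P - 1), h.odd,
      show 2 * (m + 1) = 2 * m + 1 + 1 by ring, wprod_succ, wprod_succ, mul_assoc]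
    push_cast
    rw [show 2 * ((k : ℤ) + m) + 1 = 2 * k + 1 + 2 * m by ring,
      show 2 * ((k : ℤ) + m) + 2 = 2 * k + 1 + (2 * m + 1) by ring]

lemma aCoef_eq (h : IsChain α P κ x s s' w) {k : ℕ} (hk : k < P) :
    aCoef P s k = wprod w (2 * k) (2 * P) := h.prod_coord (by omega)

lemma aCoef_eq' (h : IsChain α P κ x s s' w) {k : ℕ} (hk : k < P) :
    aCoef P s' k = wprod w (2 * k + 1) (2 * P) := h.prod_coord' (by omega)

lemma bCoef_eq (h : IsChain α P κ x s s' w) {k : ℕ} (hk : k + 1 < P) :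
    bCoef α P s k = α ^ 2 / wprod w (2 * k + 2) (2 * P - 2) := by
  rw [bCoef, if_pos hk, h.prod_coord (by omega), show 2 * (P - 1) = 2 * P - 2 by omega,
    show 2 * ((k + 1 : ℕ) : ℤ) = 2 * k + 2 by push_cast; ring]

lemma bCoef_eq' (h : IsChain α P κ x s s' w) {k : ℕ} (hk : k + 1 < P) :
    bCoef α P s' k = α ^ 2 / wprod w (2 * k + 3) (2 * P - 2) := by
  rw [bCoef, if_pos hk, h.prod_coord' (by omega), show 2 * (P - 1) = 2 * P - 2 by omega,
    show 2 * ((k + 1 : ℕ) : ℤ) + 1 = 2 * k + 3 by push_cast; ring]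

lemma qCoef_eq (h : IsChain α P κ x s s' w) (hP : 2 ≤ P) :
    qCoef α P s = α ^ 2 / wprod w (2 * P) (2 * P - 2) := by
  rw [qCoef, h.prod_coord (by omega), show 2 * (P - 1) = 2 * P - 2 by omega]

lemma qCoef_eq' (h : IsChain α P κ x s s' w) (hP : 2 ≤ P) :
    qCoef α P s' = α ^ 2 / wprod w (2 * P + 1) (2 * P - 2) := by
  rw [qCoef, h.prod_coord' (by omega), show 2 * (P - 1) = 2 * P - 2 by omega]

lemma aCoef_zero_add (h : IsChain α P κ x s s' w) (hP : 2 ≤ P) :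
    aCoef P s 0 + bCoef α P s 0 = α * w (2 * P - 1) + α * w (2 * P) + (1 - α * κ) := by
  have := h.lamEq hP (k := 0) le_rfl (by omega)
  unfold LamEq at this
  rw [mul_wprod_mul hP] at this
  rw [h.aCoef_eq (by omega), h.bCoef_eq (by omega), Nat.cast_zero, mul_zero]
  simp only [zero_add] at this ⊢
  linear_combination -this

lemma aCoef_succ_add (h : IsChain α P κ x s s' w) (hP : 2 ≤ P) {k : ℕ} (hk : k + 2 < P) :
    aCoef P s (k + 1) + bCoef α P s (k + 1)
      = α * w (2 * P + 2 * k + 1) + α * w (2 * P + 2 * (k + 1 : ℕ)) + (1 - α * κ) := by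
  have := h.lamEq hP (k := 2 * k + 2) (by omega) (by omega)
  unfold LamEq at this
  rw [mul_wprod_mul hP] at this
  rw [h.aCoef_eq (by omega), h.bCoef_eq (by omega)]
  push_cast
  rw [show 2 * (k : ℤ) + 2 + 2 * P - 1 = 2 * P + 2 * k + 1 by ring,
    show 2 * (k : ℤ) + 2 + 2 * P = 2 * P + 2 * (k + 1) by ring] at this
  rw [show 2 * ((k : ℤ) + 1) = 2 * k + 2 by ring] at *
  linear_combination -this

lemma aCoef_last (h : IsChain α P κ x s s' w) {p : ℕ} (hp : P = p + 2) :
    aCoef P s (p + 1) = α * w (2 * P + 2 * p + 1) + α * w (2 * P + 2 * (p + 1 : ℕ)) + (1 - α * κ)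
      - qCoef α P s := by
  have := h.lamEq (by omega) (k := 2 * p + 2) (by omega) (by omega)
  unfold LamEq at this
  rw [mul_wprod_mul (by omega)] at this
  rw [h.aCoef_eq (by omega), h.qCoef_eq (by omega)]
  rw [show 2 * (p : ℤ) + 2 + 2 * P - 1 = 2 * P + 2 * p + 1 by ring,
    show 2 * (p : ℤ) + 2 + 2 * P = 2 * P + 2 * (p + 1 : ℕ) by push_cast; ring,
    show 2 * (p : ℤ) + 2 + 2 = 2 * P by omega,
    show 2 * (p : ℤ) + 2 = 2 * (p + 1 : ℕ) by push_cast; ring] at this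
  linear_combination -this

/-- The window in the denominator of `bCoef k` consists of all but the last two terms of `aCoef (k +
1)`. -/
lemma aCoef_mul_bCoef (h : IsChain α P κ x s s' w) (hP : 2 ≤ P) {k : ℕ} (hk : k + 1 < P) :
    aCoef P s (k + 1) * bCoef α P s k = α * w (2 * P + 2 * k) * (α * w (2 * P + 2 * k + 1)) := by
  have hne : wprod w (2 * k + 2) (2 * P - 2) ≠ 0 :=
    wprod_ne_zero fun j h1 h2 => h.ne j (by omega) (by omega)
  rw [h.aCoef_eq (by omega), h.bCoef_eq hk, show 2 * P = 2 * P - 2 + 1 + 1 by omega, wprod_succ,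
    wprod_succ, show 2 * P - 2 + 1 + 1 - 2 = 2 * P - 2 by omega,
    show 2 * ((k + 1 : ℕ) : ℤ) = 2 * k + 2 by push_cast; ring,
    show 2 * (k : ℤ) + 2 + ((2 * P - 2 : ℕ) : ℤ) = 2 * P + 2 * k by omega,
    show 2 * (k : ℤ) + 2 + ((2 * P - 2 + 1 : ℕ) : ℤ) = 2 * P + 2 * k + 1 by omega]
  field_simp

lemma aCoef_add_bCoef' (h : IsChain α P κ x s s' w) (hP : 2 ≤ P) {k : ℕ} (hk : k + 1 < P) :
    aCoef P s' k + bCoef α P s' k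
      = α * w (2 * P + 2 * k) + α * w (2 * P + 2 * k + 1) + (1 - α * κ) := by
  have := h.lamEq hP (k := 2 * k + 1) (by omega) (by omega)
  unfold LamEq at this
  rw [mul_wprod_mul hP] at this
  rw [h.aCoef_eq' (by omega), h.bCoef_eq' (by omega)]
  rw [show 2 * (k : ℤ) + 1 + 2 * P - 1 = 2 * P + 2 * k by ring,
    show 2 * (k : ℤ) + 1 + 2 * P = 2 * P + 2 * k + 1 by ring,
    show 2 * (k : ℤ) + 1 + 2 = 2 * k + 3 by ring] at this
  linear_combination -this

/-- At the end the relation is `GamEq` at `2P - 1` in place of a `LamEq`, because `LamEq` would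
bring in `w_{4P-1}`. The price is the boundary quantity `ε = qCoef - α w_{2P-1}`. -/
lemma aCoef_last' (h : IsChain α P κ x s s' w) {p : ℕ} (hp : P = p + 2) :
    aCoef P s' (p + 1) = α * w (2 * P + 2 * (p + 1 : ℕ)) + (1 - α * κ)
      - (qCoef α P s - α * w (2 * P - 1)) := by
  have := h.gam_all (by omega) (k := 2 * p + 3) (by omega) (by omega)
  unfold GamEq at this
  rw [mul_wprod_mul (by omega)] at this
  rw [h.aCoef_eq' (by omega), h.qCoef_eq (by omega)]
  rw [show 2 * (p : ℤ) + 3 + 2 * P - 1 = 2 * P + 2 * (p + 1 : ℕ) by push_cast; ring,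
    show 2 * (p : ℤ) + 3 + 1 = 2 * P by omega] at this
  rw [show 2 * (P : ℤ) - 1 = 2 * p + 3 by omega,
    show 2 * ((p + 1 : ℕ) : ℤ) + 1 = 2 * p + 3 by push_cast; ring]
  linear_combination -this

lemma aCoef_mul_bCoef' (h : IsChain α P κ x s s' w) (hP : 2 ≤ P) {k : ℕ} (hk : k + 1 < P) :
    aCoef P s' (k + 1) * bCoef α P s' k
      = α * w (2 * P + 2 * k + 1) * (α * w (2 * P + 2 * (k + 1 : ℕ))) := by
  have hne : wprod w (2 * k + 3) (2 * P - 2) ≠ 0 :=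
    wprod_ne_zero fun j h1 h2 => h.ne j (by omega) (by omega)
  rw [h.aCoef_eq' (by omega), h.bCoef_eq' hk, show 2 * P = 2 * P - 2 + 1 + 1 by omega, wprod_succ,
    wprod_succ, show 2 * P - 2 + 1 + 1 - 2 = 2 * P - 2 by omega,
    show 2 * ((k + 1 : ℕ) : ℤ) + 1 = 2 * k + 3 by push_cast; ring,
    show 2 * (k : ℤ) + 3 + ((2 * P - 2 : ℕ) : ℤ) = 2 * P + 2 * k + 1 by omega,
    show 2 * (k : ℤ) + 3 + ((2 * P - 2 + 1 : ℕ) : ℤ) = 2 * P + 2 * (k + 1 : ℕ) by omega]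
  field_simp

/-- The product `u_{2P} ⋯ u_{4P-2}`. -/
lemma wprod_top (h : IsChain α P κ x s s' w) (hP : 2 ≤ P) :
    wprod w (2 * P) (2 * P - 1)
      = (∏ i ∈ Finset.range (P - 1), coord s (P + i)) * w (4 * P - 2) := by
  rw [h.prod_coord (by omega), show 2 * P - 1 = 2 * (P - 1) + 1 by omega, wprod_succ,
    show 2 * (P : ℤ) + ((2 * (P - 1) : ℕ) : ℤ) = 4 * P - 2 by omega]

lemma wprod_top_ne_zero (h : IsChain α P κ x s s' w) : wprod w (2 * P) (2 * P - 1) ≠ 0 :=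
  wprod_ne_zero fun j h1 h2 => h.ne j (by omega) (by omega)

lemma qCoef_eq_mul (h : IsChain α P κ x s s' w) (hP : 2 ≤ P) :
    qCoef α P s = α / wprod w (2 * P) (2 * P - 1) * (α * w (4 * P - 2)) := by
  have h1 := h.wprod_top_ne_zero
  have h2 := h.ne (4 * P - 2) (by omega) (by omega)
  rw [h.wprod_top hP] at h1 ⊢
  have h3 := left_ne_zero_of_mul h1
  rw [qCoef]
  field_simp

lemma qCoef_eq_mul' (h : IsChain α P κ x s s' w) (hP : 2 ≤ P) :
    qCoef α P s' = α / wprod w (2 * P) (2 * P - 1) * (α * w (2 * P)) := by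
  have h1 := h.wprod_top_ne_zero
  have e : wprod w (2 * P) (2 * P - 1) = w (2 * P) * wprod w (2 * P + 1) (2 * P - 2) := by
    rw [show 2 * P - 1 = 2 * P - 2 + 1 by omega, wprod_succ']
  rw [e] at h1 ⊢
  have h2 := left_ne_zero_of_mul h1
  have h3 := right_ne_zero_of_mul h1
  rw [h.qCoef_eq' hP]
  field_simp

/-- This is `GamEq` at `2P - 1` in factored form, the factors being those of `γ_{2P-1} γ_{2P}` up to
normalisation. As the right side is constant, the differentials of the two factors are proportional.
-/
lemma eps_mul (h : IsChain α P κ x s s' w) (hP : 2 ≤ P) :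
    (qCoef α P s - α * w (2 * P - 1)) * (wprod w (2 * P) (2 * P - 1) - α) = -α * (1 - α * κ) := by
  have hG := h.gam_all hP (k := 2 * P - 1) (by omega) (by omega)
  unfold GamEq at hG
  have hq := h.qCoef_eq_mul hP
  have hq' := h.qCoef_eq hP
  have h1 := h.wprod_top_ne_zero
  have e : wprod w (2 * P) (2 * P - 1) = wprod w (2 * P) (2 * P - 2) * w (4 * P - 2) := by
    rw [show 2 * P - 1 = 2 * P - 2 + 1 by omega, wprod_succ,
      show 2 * (P : ℤ) + ((2 * P - 2 : ℕ) : ℤ) = 4 * P - 2 by omega]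
  rw [show 2 * (P : ℤ) - 1 + 1 = 2 * P by ring,
    show 2 * (P : ℤ) - 1 + 2 * P - 1 = 4 * P - 2 by ring, ← hq'] at hG
  have hq2 : qCoef α P s * wprod w (2 * P) (2 * P - 1) = α ^ 2 * w (4 * P - 2) := by
    rw [hq]; field_simp
  rw [hG]
  linear_combination hq2 - α * w (2 * P - 1) * e

end IsChain

end Analysis

/-! ## Branches of the correspondence -/

section Branch

variable {α κ : ℂ} {P : ℕ} {s : Fin (2 * P - 1) → ℂ}

lemma differentiable_coord (n : ℕ) :
    Differentiable ℂ fun σ : Fin (2 * P - 1) → ℂ => coord σ n := by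
  unfold coord
  split_ifs with h <;> fun_prop

lemma differentiableAt_sExt (hP : 2 ≤ P) (hs : ∀ n, s n ≠ 0) (n : ℕ) :
    DifferentiableAt ℂ (fun σ => sExt α P σ n) s := by
  have hprod : ∀ S : Finset ℕ, DifferentiableAt ℂ
      (fun σ : Fin (2 * P - 1) → ℂ => ∏ i ∈ S, coord σ i) s := fun S =>
    (HasFDerivAt.finsetProd fun i _ => (differentiable_coord i s).hasFDerivAt).differentiableAt
  have hne : ∀ a b, b < 2 * P - 1 → ∏ i ∈ Finset.Icc a b, coord s i ≠ 0 := fun a b hb =>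
    Finset.prod_ne_zero_iff.2 fun i hi => by
      rw [coord_of_lt _ (by have := (Finset.mem_Icc.1 hi).2; omega)]; exact hs _
  unfold sExt
  split_ifs with h
  · exact differentiable_coord n s
  · simp only [coord_of_lt _ (show 2 * P - 2 < 2 * P - 1 by omega), chiHat,
      if_neg (show ¬ 2 * P - 2 + 1 < 2 * P - 1 by omega), div_eq_mul_inv, one_mul]
    exact ((hprod _).fun_sub (((hprod _).fun_inv (hne _ _ (by omega))).fun_sub
      ((hprod _).fun_inv (hne _ _ (by omega))) |>.const_mul _)).fun_mul
      ((hprod _).fun_inv (hne _ _ (by omega)))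

lemma differentiableAt_pairSum (hP : 2 ≤ P) (hs : ∀ n < 2 * P, sExt α P s n ≠ 0) {n : ℕ}
    (hn : n < 2 * P) : DifferentiableAt ℂ (fun σ => pairSum α P κ σ n) s := by
  have hs' : ∀ n, s n ≠ 0 := fun n => by
    have := hs n (by omega); rwa [sExt_of_lt n.2] at this
  have hprod : ∀ a m, DifferentiableAt ℂ
      (fun σ => ∏ i ∈ Finset.range m, sExt α P σ (a + i)) s := fun a m =>
    (HasFDerivAt.finsetProd fun i _ =>
      (differentiableAt_sExt hP hs' (a + i)).hasFDerivAt).differentiableAt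
  have hne : ∀ a m, a + m ≤ 2 * P → ∏ i ∈ Finset.range m, sExt α P s (a + i) ≠ 0 := fun a m hm =>
    Finset.prod_ne_zero_iff.2 fun i hi => hs _ (by have := Finset.mem_range.1 hi; omega)
  unfold pairSum
  simp only [div_eq_mul_inv]
  split_ifs with h
  · exact (((hprod _ _).fun_add (((hprod _ _).fun_inv (hne _ _ (by omega))).const_mul _)).sub_const
      _).mul_const _
  · exact (((hprod _ _).fun_add (((hprod _ _).fun_inv (hne _ _ (by omega))).const_mul _)).sub_const
      _).mul_const _

variable {x : (Fin (2 * P - 1) → ℂ) → ℂ} {χ : (Fin (2 * P - 1) → ℂ) → Fin (2 * P - 1) → ℂ}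
  {w : (Fin (2 * P - 1) → ℂ) → ℤ → ℂ}

lemma IsChain.sExt_ne_zero {y : ℂ} {s' : Fin (2 * P - 1) → ℂ} {w : ℤ → ℂ}
    (h : IsChain α P κ y s s' w) (hP : 2 ≤ P) {n : ℕ} (hn : n < 2 * P) : sExt α P s n ≠ 0 := by
  rw [h.hasPairs hP n hn]
  exact mul_ne_zero (h.ne _ (by omega) (by omega)) (h.ne _ (by omega) (by omega))

/-- The terms of a chain depend differentiably on its initial point, if the last one does. -/
lemma differentiableAt_chain (hP : 2 ≤ P) (hα : α ≠ 0)
    (h : ∀ᶠ σ in 𝓝 s, IsChain α P κ (x σ) σ (χ σ) (w σ)) (hx : DifferentiableAt ℂ x s) {k : ℤ}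
    (h0 : 0 ≤ k) (hk : k < 4 * P) : DifferentiableAt ℂ (fun σ => w σ k) s := by
  have hs := h.self_of_nhds
  have hse : ∀ n < 2 * P, sExt α P s n ≠ 0 := fun n => hs.sExt_ne_zero hP
  have hs' : ∀ n, s n ≠ 0 := fun n => by
    have := hse n (by omega); rwa [sExt_of_lt n.2] at this
  -- The odd terms are computed downwards from `x` by the Riccati recursion, whose ingredients
  -- depend on `σ` alone, so no regularity of `χ` is presupposed.
  have key : ∀ m < 2 * P, DifferentiableAt ℂ (fun σ => w σ (4 * P - 2 * m - 1)) s := by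
    intro m hm
    induction m with
    | zero =>
      refine hx.congr_of_eventuallyEq (h.mono fun σ hσ => ?_)
      simp [hσ.last]
    | succ m ih =>
      have h1 := (differentiableAt_pairSum (κ := κ) hP hse (n := 2 * P - 1 - m) (by omega)).fun_sub
        ((differentiableAt_sExt (α := α) hP hs' (2 * P - 1 - m)).fun_mul
          ((ih (by omega)).fun_inv (hs.ne _ (by omega) (by omega))))
      refine h1.congr_of_eventuallyEq (h.mono fun σ hσ => ?_)
      dsimp only
      have h2 := hσ.ne (4 * P - 2 * m - 1) (by omega) (by omega)
      rw [hσ.hasPairs hP _ (by omega), hσ.pairSum_eq hP hα (by omega) (by omega),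
        show 2 * ((2 * P - 1 - m : ℕ) : ℤ) + 1 = 4 * P - 2 * m - 1 by omega,
        mul_inv_cancel_right₀ h2,
        show 2 * ((2 * P - 1 - m : ℕ) : ℤ) - 1 = 4 * P - 2 * (m + 1 : ℕ) - 1 by omega]
      ring
  obtain ⟨n, rfl | rfl⟩ := Int.even_or_odd' k
  · obtain ⟨n, rfl⟩ := Int.eq_ofNat_of_zero_le (show 0 ≤ n by omega)
    have h1 := key (2 * P - 1 - n) (by omega)
    rw [show 4 * (P : ℤ) - 2 * (2 * P - 1 - n : ℕ) - 1 = 2 * n + 1 by omega] at h1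
    refine ((differentiableAt_sExt (α := α) hP hs' n).fun_mul
      (h1.fun_inv (hs.ne _ (by omega) (by omega)))).congr_of_eventuallyEq (h.mono fun σ hσ => ?_)
    dsimp only
    rw [hσ.hasPairs hP _ (by omega), mul_inv_cancel_right₀ (hσ.ne _ (by omega) (by omega))]
  · obtain ⟨n, rfl⟩ := Int.eq_ofNat_of_zero_le (show 0 ≤ n by omega)
    have h1 := key (2 * P - 1 - n) (by omega)
    rwa [show 4 * (P : ℤ) - 2 * (2 * P - 1 - n : ℕ) - 1 = 2 * n + 1 by omega] at h1

lemma differentiableAt_branch (hP : 2 ≤ P) (hα : α ≠ 0)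
    (h : ∀ᶠ σ in 𝓝 s, IsChain α P κ (x σ) σ (χ σ) (w σ)) (hx : DifferentiableAt ℂ x s) :
    DifferentiableAt ℂ χ s := by
  refine differentiableAt_pi.2 fun i => ?_
  refine ((differentiableAt_chain hP hα h hx (k := 2 * (i : ℕ) + 1) (by omega) (by omega)).fun_mul
    (differentiableAt_chain hP hα h hx (k := 2 * (i : ℕ) + 2) (by omega)
      (by omega))).congr_of_eventuallyEq (h.mono fun σ hσ => hσ.odd i)

end Branch

/-! ### Differentials of the coefficients along a branch -/

section BranchForms

variable {α κ : ℂ} {P : ℕ} {s : Fin (2 * P - 1) → ℂ}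

/-- The differential of `f` at `s` is `ℓ`, in logarithmic coordinates. -/
def HasD (s : Fin (2 * P - 1) → ℂ) (f : (Fin (2 * P - 1) → ℂ) → ℂ) (ℓ : (ℕ → ℂ) → ℂ) : Prop :=
  DifferentiableAt ℂ f s ∧ ∀ t, fderiv ℂ f s (tang s t) = ℓ t

namespace HasD

variable {f g : (Fin (2 * P - 1) → ℂ) → ℂ} {ℓ m : (ℕ → ℂ) → ℂ}

lemma add (hf : HasD s f ℓ) (hg : HasD s g m) : HasD s (fun σ => f σ + g σ) fun t => ℓ t + m t :=
  ⟨hf.1.fun_add hg.1, fun t => by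
    rw [fderiv_fun_add hf.1 hg.1, _root_.add_apply, hf.2, hg.2]⟩

lemma sub (hf : HasD s f ℓ) (hg : HasD s g m) : HasD s (fun σ => f σ - g σ) fun t => ℓ t - m t :=
  ⟨hf.1.fun_sub hg.1, fun t => by
    rw [fderiv_fun_sub hf.1 hg.1, _root_.sub_apply, hf.2, hg.2]⟩

lemma add_const (hf : HasD s f ℓ) (c : ℂ) : HasD s (fun σ => f σ + c) ℓ :=
  ⟨hf.1.add_const c, fun t => by rw [fderiv_add_const, hf.2]⟩

lemma unique (hf : HasD s f ℓ) (hg : HasD s g m) (h : ∀ᶠ σ in 𝓝 s, f σ = g σ) (t : ℕ → ℂ) :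
    ℓ t = m t := by
  rw [← hf.2, ← hg.2, Filter.EventuallyEq.fderiv_eq (h : f =ᶠ[𝓝 s] g)]

end HasD

lemma LogD.hasD {f : (Fin (2 * P - 1) → ℂ) → ℂ} {ℓ : (ℕ → ℂ) → ℂ} (h : LogD s f ℓ) :
    HasD s f fun t => f s * ℓ t := h

lemma LogD.const_mul {f : (Fin (2 * P - 1) → ℂ) → ℂ} {ℓ : (ℕ → ℂ) → ℂ} (h : LogD s f ℓ) (c : ℂ) :
    LogD s (fun σ => c * f σ) ℓ :=
  ((LogD.const c).mul h).congr (Filter.Eventually.of_forall fun _ => rfl) fun _ => (zero_add _).symm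

lemma logD_topProd (hP : 2 ≤ P) :
    LogD s (fun σ => ∏ i ∈ Finset.range (P - 1), coord σ (P + i))
      fun t => t P - t (P + (P - 1)) :=
  LogD.prod (N := 2 * P - 1) (F := fun n σ => coord σ n) (T := fun n t => t n)
    (fun _ hn => LogD.coord hn) (by omega)

variable {χ : (Fin (2 * P - 1) → ℂ) → Fin (2 * P - 1) → ℂ}
  {w : (Fin (2 * P - 1) → ℂ) → ℤ → ℂ}

/-- The logarithmic derivatives of `v'_n`, where `v_n / v'_n` is the even term `w_{2n}`, in the
direction in which the logarithmic derivatives of `v_n` are `t_n`. -/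
def imageD (w : (Fin (2 * P - 1) → ℂ) → ℤ → ℂ) (s : Fin (2 * P - 1) → ℂ) (t : ℕ → ℂ) (n : ℕ) : ℂ :=
  t n - fderiv ℂ (fun σ => w σ (2 * n)) s (tang s t) / w s (2 * n)

/-- The differential of the difference of `α² / (s_P ⋯ s_{2P-2})` and `α u_{2P-1}`. -/
def epsD (α : ℂ) (w : (Fin (2 * P - 1) → ℂ) → ℤ → ℂ) (s : Fin (2 * P - 1) → ℂ) (t : ℕ → ℂ) : ℂ :=
  fderiv ℂ (fun σ => qCoef α P σ - α * w σ (2 * P - 1)) s (tang s t)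

/-- Near `s` the map `χ` is a branch of the correspondence, described by chains that depend
differentiably on the point. -/
structure IsBranch (α κ : ℂ) (P : ℕ) (s : Fin (2 * P - 1) → ℂ)
    (χ : (Fin (2 * P - 1) → ℂ) → Fin (2 * P - 1) → ℂ)
    (w : (Fin (2 * P - 1) → ℂ) → ℤ → ℂ) : Prop where
  chain : ∀ᶠ σ in 𝓝 s, IsChain α P κ (w σ (4 * P - 1)) σ (χ σ) (w σ)
  diff : ∀ k : ℤ, 0 ≤ k → k < 4 * P → DifferentiableAt ℂ (fun σ => w σ k) s

namespace IsBranch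

lemma atPoint (h : IsBranch α κ P s χ w) : IsChain α P κ (w s (4 * P - 1)) s (χ s) (w s) :=
  h.chain.self_of_nhds

lemma ne_zero (h : IsBranch α κ P s χ w) (n : Fin (2 * P - 1)) : s n ≠ 0 := by
  rw [h.atPoint.even]
  exact mul_ne_zero (h.atPoint.ne _ (by omega) (by omega)) (h.atPoint.ne _ (by omega) (by omega))

lemma ne_zero' (h : IsBranch α κ P s χ w) (n : Fin (2 * P - 1)) : χ s n ≠ 0 := by
  rw [h.atPoint.odd]
  exact mul_ne_zero (h.atPoint.ne _ (by omega) (by omega)) (h.atPoint.ne _ (by omega) (by omega))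

lemma logD_even (h : IsBranch α κ P s χ w) {n : ℕ} (hn : n < 2 * P) :
    LogD s (fun σ => w σ (2 * n)) fun t => t n - imageD w s t n := by
  refine ⟨h.diff _ (by omega) (by omega), fun t => ?_⟩
  have := h.atPoint.ne (2 * n) (by omega) (by omega)
  simp only [imageD]
  field_simp
  ring

lemma logD_odd (h : IsBranch α κ P s χ w) {n : ℕ} (hn : n < 2 * P - 1) :
    LogD s (fun σ => w σ (2 * n + 1)) fun t => imageD w s t n - t (n + 1) := by
  refine ((LogD.coord hn).mul ((h.logD_even (n := n) (by omega)).inv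
    (h.atPoint.ne _ (by omega) (by omega)))).congr (h.chain.mono fun σ hσ => ?_) fun t => by ring
  have := hσ.ne (2 * n) (by omega) (by omega)
  rw [coord_of_lt _ hn, hσ.even]
  field_simp

lemma logD_image (h : IsBranch α κ P s χ w) {n : ℕ} (hn : n < 2 * P - 1) :
    LogD s (fun σ => coord (χ σ) n) fun t => imageD w s t n - imageD w s t (n + 1) := by
  refine ((h.logD_odd hn).mul (h.logD_even (n := n + 1) (by omega))).congr
    (h.chain.mono fun σ hσ => ?_) fun t => by ring
  rw [coord_of_lt _ hn, hσ.odd]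
  push_cast
  rw [mul_add, mul_one]

lemma hasD_eps (h : IsBranch α κ P s χ w) (hP : 2 ≤ P) :
    HasD s (fun σ => qCoef α P σ - α * w σ (2 * P - 1)) (epsD α w s) := by
  refine ⟨?_, fun t => rfl⟩
  have h1 := logD_topProd (s := s) hP
  have h2 : ∏ i ∈ Finset.range (P - 1), coord s (P + i) ≠ 0 :=
    Finset.prod_ne_zero_iff.2 fun i hi => by
      rw [coord_of_lt _ (by have := Finset.mem_range.1 hi; omega)]; exact h.ne_zero _
  simp only [qCoef, div_eq_mul_inv]
  exact ((h1.1.fun_inv h2).const_mul _).fun_sub ((h.diff _ (by omega) (by omega)).const_mul _)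

lemma logD_qCoef (h : IsBranch α κ P s χ w) (hP : 2 ≤ P) :
    LogD s (fun σ => qCoef α P σ) fun t => t (2 * P - 1) - t P := by
  have h1 := logD_topProd (s := s) hP
  have h2 : ∏ i ∈ Finset.range (P - 1), coord s (P + i) ≠ 0 :=
    Finset.prod_ne_zero_iff.2 fun i hi => by
      rw [coord_of_lt _ (by have := Finset.mem_range.1 hi; omega)]; exact h.ne_zero _
  refine ((h1.inv h2).const_mul (α ^ 2)).congr
    (Filter.Eventually.of_forall fun σ => div_eq_mul_inv _ _) fun t => ?_
  rw [show P + (P - 1) = 2 * P - 1 by omega]; ring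

lemma logD_top (h : IsBranch α κ P s χ w) (hP : 2 ≤ P) :
    LogD s (fun σ => wprod (w σ) (2 * P) (2 * P - 1)) fun t => t P - imageD w s t (2 * P - 1) := by
  have h1 := logD_topProd (s := s) hP
  refine (h1.mul (h.logD_even (n := 2 * P - 1) (by omega))).congr
    (h.chain.mono fun σ hσ => ?_) fun t => ?_
  · rw [hσ.wprod_top hP, show 2 * ((2 * P - 1 : ℕ) : ℤ) = 4 * P - 2 by omega]
  · rw [show P + (P - 1) = 2 * P - 1 by omega]; ring

lemma hasD_sum (h : IsBranch α κ P s χ w) {k : ℕ} (hk : k < P) :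
    HasD s (fun σ => aCoef P σ k + bCoef α P σ k) fun t => dForm α P s t k := by
  have h0 : ∀ n < 2 * P - 1, LogD s (fun σ => coord σ n) fun t => t n - t (n + 1) :=
    fun n hn => LogD.coord hn
  exact ⟨(logD_aCoef h0 hk).1.fun_add (logD_bCoef h0 h.ne_zero).1, fun t =>
    fderiv_aCoef_add_bCoef h0 h.ne_zero hk t⟩

lemma hasD_sum' (h : IsBranch α κ P s χ w) {k : ℕ} (hk : k < P) :
    HasD s (fun σ => aCoef P (χ σ) k + bCoef α P (χ σ) k)
      fun t => dForm α P (χ s) (imageD w s t) k :=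
  ⟨(logD_aCoef (fun _ hn => h.logD_image hn) hk).1.fun_add
    (logD_bCoef (fun _ hn => h.logD_image hn) h.ne_zero').1, fun t =>
    fderiv_aCoef_add_bCoef (fun _ hn => h.logD_image hn) h.ne_zero' hk t⟩

lemma hasD_even (h : IsBranch α κ P s χ w) {k : ℕ} (hk : k < P) :
    HasD s (fun σ => α * w σ (2 * P + 2 * k)) fun t => α * w s (2 * P + 2 * k)
      * (t (P + k) - imageD w s t (P + k)) := by
  have := ((h.logD_even (n := P + k) (by omega)).const_mul α).hasD
  push_cast [mul_add] at this
  exact this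

lemma hasD_odd (h : IsBranch α κ P s χ w) {k : ℕ} (hk : k + 1 < P) :
    HasD s (fun σ => α * w σ (2 * P + 2 * k + 1)) fun t => α * w s (2 * P + 2 * k + 1)
      * (imageD w s t (P + k) - t (P + (k + 1))) := by
  have := ((h.logD_odd (n := P + k) (by omega)).const_mul α).hasD
  push_cast [mul_add] at this
  exact this

/-- The relation for `aCoef 0 + bCoef 0` is differentiated with `α w_{2P-1}` written as `qCoef - ε`;
at this end `ε` takes the place of a differential of an odd term. -/
lemma dForm_zero (h : IsBranch α κ P s χ w) (hP : 2 ≤ P) (t : ℕ → ℂ) :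
    dForm α P s t 0 = α * w s (2 * P + 2 * (0 : ℕ)) * (t (P + 0) - imageD w s t (P + 0))
      - epsD α w s t + qCoef α P s * (t (2 * P - 1) - t (P + 0)) := by
  refine (h.hasD_sum (by omega)).unique ((((h.hasD_even (k := 0) (by omega)).sub (h.hasD_eps hP)).add
    (h.logD_qCoef hP).hasD).add_const (1 - α * κ)) (h.chain.mono fun σ hσ => ?_) t
  rw [hσ.aCoef_zero_add hP, Nat.cast_zero, mul_zero, add_zero]
  ring

lemma dForm_succ (h : IsBranch α κ P s χ w) (hP : 2 ≤ P) {k : ℕ} (hk : k + 2 < P) (t : ℕ → ℂ) :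
    dForm α P s t (k + 1) = α * w s (2 * P + 2 * k + 1) * (imageD w s t (P + k) - t (P + (k + 1)))
      + α * w s (2 * P + 2 * (k + 1 : ℕ)) * (t (P + (k + 1)) - imageD w s t (P + (k + 1))) :=
  (h.hasD_sum (by omega)).unique (((h.hasD_odd (k := k) (by omega)).add
    (h.hasD_even (k := k + 1) (by omega))).add_const (1 - α * κ)) (h.chain.mono fun σ hσ =>
      hσ.aCoef_succ_add hP hk) t

lemma dForm_last (h : IsBranch α κ P s χ w) {p : ℕ} (hp : P = p + 2) (t : ℕ → ℂ) :
    dForm α P s t (p + 1) = α * w s (2 * P + 2 * p + 1) * (imageD w s t (P + p) - t (P + (p + 1)))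
      + α * w s (2 * P + 2 * (p + 1 : ℕ)) * (t (P + (p + 1)) - imageD w s t (P + (p + 1)))
      - qCoef α P s * (t (2 * P - 1) - t P) := by
  refine (h.hasD_sum (by omega)).unique ((((h.hasD_odd (k := p) (by omega)).add
    (h.hasD_even (k := p + 1) (by omega))).sub (h.logD_qCoef (by omega)).hasD).add_const (1 - α * κ))
    (h.chain.mono fun σ hσ => ?_) t
  rw [hσ.aCoef_last hp, bCoef, if_neg (by omega)]
  ring

lemma dForm_image (h : IsBranch α κ P s χ w) (hP : 2 ≤ P) {k : ℕ} (hk : k + 1 < P) (t : ℕ → ℂ) :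
    dForm α P (χ s) (imageD w s t) k
      = α * w s (2 * P + 2 * k) * (t (P + k) - imageD w s t (P + k))
        + α * w s (2 * P + 2 * k + 1) * (imageD w s t (P + k) - t (P + (k + 1))) :=
  (h.hasD_sum' (by omega)).unique (((h.hasD_even (k := k) (by omega)).add
    (h.hasD_odd (k := k) (by omega))).add_const (1 - α * κ)) (h.chain.mono fun σ hσ =>
      hσ.aCoef_add_bCoef' hP hk) t

lemma dForm_image_last (h : IsBranch α κ P s χ w) {p : ℕ} (hp : P = p + 2) (t : ℕ → ℂ) :
    dForm α P (χ s) (imageD w s t) (p + 1)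
      = α * w s (2 * P + 2 * (p + 1 : ℕ)) * (t (P + (p + 1)) - imageD w s t (P + (p + 1)))
        - epsD α w s t := by
  refine (h.hasD_sum' (by omega)).unique (((h.hasD_even (k := p + 1) (by omega)).sub
    (h.hasD_eps (by omega))).add_const (1 - α * κ)) (h.chain.mono fun σ hσ => ?_) t
  rw [hσ.aCoef_last' hp, bCoef, if_neg (by omega)]
  ring

/-- The relations between the differentials at `s` and at `χ s`, for two tangent vectors. -/
theorem formData (h : IsBranch α κ P s χ w) {p : ℕ} (hp : P = p + 2) (t₁ t₂ : ℕ → ℂ) :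
    FormData p (aCoef P s) (bCoef α P s) (aCoef P (χ s)) (bCoef α P (χ s))
      (fun k => α * w s (2 * P + 2 * k)) (fun k => α * w s (2 * P + 2 * k + 1))
      (qCoef α P s) (qCoef α P (χ s)) (qCoef α P s - α * w s (2 * P - 1))
      (α / wprod (w s) (2 * P) (2 * P - 1)) (1 - α * κ)
      (fun k => (t₁ (P + k), t₂ (P + k)))
      (fun k => (imageD w s t₁ (P + k), imageD w s t₂ (P + k)))
      (fun k => (dForm α P s t₁ k, dForm α P s t₂ k))
      (fun k => (dForm α P (χ s) (imageD w s t₁) k, dForm α P (χ s) (imageD w s t₂) k))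
      (epsD α w s t₁, epsD α w s t₂) := by
  have hP : 2 ≤ P := by omega
  have hs := h.atPoint
  have hG := hs.wprod_top_ne_zero
  have hl : 2 * P - 1 = P + (p + 1) := by omega
  have heps : ∀ᶠ σ in 𝓝 s, (qCoef α P σ - α * w σ (2 * P - 1))
      * (wprod (w σ) (2 * P) (2 * P - 1) - α) = -α * (1 - α * κ) :=
    h.chain.mono fun σ hσ => hσ.eps_mul hP
  have hGd : HasD s (fun σ => wprod (w σ) (2 * P) (2 * P - 1) - α) _ :=
    (h.logD_top hP).hasD.add_const (-α)
  have hεd := h.hasD_eps hP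
  have hmul : ∀ t, (α / wprod (w s) (2 * P) (2 * P - 1) - 1) * epsD α w s t
      = (qCoef α P s - α * w s (2 * P - 1)) * (t (P + 0) - imageD w s t (P + (p + 1))) := by
    intro t
    have h1 : fderiv ℂ (fun σ => (qCoef α P σ - α * w σ (2 * P - 1))
        * (wprod (w σ) (2 * P) (2 * P - 1) - α)) s = 0 := by
      rw [Filter.EventuallyEq.fderiv_eq (heps : _ =ᶠ[𝓝 s] fun _ => -α * (1 - α * κ))]
      simp
    rw [fderiv_fun_mul hεd.1 hGd.1] at h1
    have h2 := congrArg (fun l : (Fin (2 * P - 1) → ℂ) →L[ℂ] ℂ => l (tang s t)) h1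
    simp only [_root_.add_apply, _root_.smul_apply, smul_eq_mul, _root_.zero_apply, hεd.2,
      hGd.2] at h2
    rw [hl] at h2
    rw [hl] at hG ⊢
    rw [add_zero]
    field_simp
    linear_combination -h2
  have hwedge : wedge ((t₁ (P + 0), t₂ (P + 0)) - (imageD w s t₁ (P + (p + 1)),
      imageD w s t₂ (P + (p + 1)))) (epsD α w s t₁, epsD α w s t₂) = 0 := by
    -- The previous relation gives this only up to the factor `r - 1`. When `r = 1`, possible if `α
    -- κ = 1`, the local constancy of the product is needed.
    have h1 := fderiv_mul_fderiv_comm hεd.1 hGd.1 heps (tang s t₁) (tang s t₂)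
    rw [hεd.2, hεd.2, hGd.2, hGd.2] at h1
    apply mul_left_cancel₀ hG
    rw [hl] at h1
    rw [hl, add_zero]
    simp only [wedge, Prod.fst_sub, Prod.snd_sub]
    linear_combination -h1
  refine ⟨?_, fun k hk => ?_, ?_, ?_, fun k hk => ?_, ?_, fun k hk => ?_, ?_, fun k hk => ?_, ?_,
    ?_, fun k hk => ?_, fun k hk => ?_, ?_, ?_, ?_, ?_, ?_, hwedge⟩
  · rw [hs.aCoef_zero_add hP, Nat.cast_zero, mul_zero, add_zero]; ring
  · exact hs.aCoef_succ_add hP (by omega)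
  · exact hs.aCoef_last hp
  · rw [bCoef, if_neg (by omega)]
  · exact hs.aCoef_mul_bCoef hP (by omega)
  · have e := h.dForm_zero hP
    rw [hl] at e
    exact Prod.ext (e t₁) (e t₂)
  · exact Prod.ext (h.dForm_succ hP (by omega) t₁) (h.dForm_succ hP (by omega) t₂)
  · have e := h.dForm_last hp
    rw [hl] at e
    exact Prod.ext (e t₁) (e t₂)
  · exact hs.aCoef_add_bCoef' hP (by omega)
  · exact hs.aCoef_last' hp
  · rw [bCoef, if_neg (by omega)]
  · exact hs.aCoef_mul_bCoef' hP (by omega)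
  · exact Prod.ext (h.dForm_image hP (by omega) t₁) (h.dForm_image hP (by omega) t₂)
  · exact Prod.ext (h.dForm_image_last hp t₁) (h.dForm_image_last hp t₂)
  · rw [hs.qCoef_eq_mul hP, show 4 * (P : ℤ) - 2 = 2 * P + 2 * (p + 1 : ℕ) by omega]
  · rw [hs.qCoef_eq_mul' hP, Nat.cast_zero, mul_zero, add_zero]
  · have := hs.eps_mul hP
    field_simp
    linear_combination this
  · exact Prod.ext (hmul t₁) (hmul t₂)

end IsBranch

end BranchForms

/-! ## Branches of the correspondence are Poisson maps -/

section Symplectic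

variable {α κ : ℂ} {P : ℕ} {s : Fin (2 * P - 1) → ℂ}

/-- The symplectic form on the logarithmic derivatives of `v_0, …, v_{2P-1}`. -/
def symp (α : ℂ) (P : ℕ) (s : Fin (2 * P - 1) → ℂ) (t τ : ℕ → ℂ) : ℂ :=
  ∑ k ∈ Finset.range P, (dForm α P s t k * τ (P + k) - dForm α P s τ k * t (P + k))

lemma dForm_add (t τ : ℕ → ℂ) (k : ℕ) :
    dForm α P s (t + τ) k = dForm α P s t k + dForm α P s τ k := by
  simp only [dForm, Pi.add_apply]; ring

lemma dForm_smul (c : ℂ) (t : ℕ → ℂ) (k : ℕ) :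
    dForm α P s (c • t) k = c * dForm α P s t k := by
  simp only [dForm, Pi.smul_apply, smul_eq_mul]; ring

lemma dForm_congr {t τ : ℕ → ℂ} (h : ∀ n < 2 * P, t n = τ n) {k : ℕ} (hk : k < P) :
    dForm α P s t k = dForm α P s τ k := by
  rw [dForm, dForm, h k (by omega), h (P + k) (by omega), h (k + 1) (by omega)]

lemma symp_congr {t τ t' τ' : ℕ → ℂ} (h : ∀ n < 2 * P, t n = t' n) (h' : ∀ n < 2 * P, τ n = τ' n) :
    symp α P s t τ = symp α P s t' τ' :=
  Finset.sum_congr rfl fun k hk => by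
    have hk := Finset.mem_range.1 hk
    rw [dForm_congr h hk, dForm_congr h' hk, h _ (by omega), h' _ (by omega)]

/-- The symplectic form as a bilinear map. -/
def sympL (α : ℂ) (P : ℕ) (s : Fin (2 * P - 1) → ℂ) : (ℕ → ℂ) →ₗ[ℂ] (ℕ → ℂ) →ₗ[ℂ] ℂ :=
  LinearMap.mk₂ ℂ (symp α P s)
    (fun _ _ _ => by
      rw [symp, symp, symp, ← Finset.sum_add_distrib]
      exact Finset.sum_congr rfl fun k _ => by rw [dForm_add, Pi.add_apply]; ring)
    (fun _ _ _ => by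
      rw [symp, symp, smul_eq_mul, Finset.mul_sum]
      exact Finset.sum_congr rfl fun k _ => by rw [dForm_smul, Pi.smul_apply, smul_eq_mul]; ring)
    (fun _ _ _ => by
      rw [symp, symp, symp, ← Finset.sum_add_distrib]
      exact Finset.sum_congr rfl fun k _ => by rw [dForm_add, Pi.add_apply]; ring)
    (fun _ _ _ => by
      rw [symp, symp, smul_eq_mul, Finset.mul_sum]
      exact Finset.sum_congr rfl fun k _ => by rw [dForm_smul, Pi.smul_apply, smul_eq_mul]; ring)

lemma aCoef_ne_zero (hs : ∀ n, s n ≠ 0) {k : ℕ} (hk : k < P) : aCoef P s k ≠ 0 :=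
  Finset.prod_ne_zero_iff.2 fun i hi => by
    rw [coord_of_lt _ (by have := Finset.mem_range.1 hi; omega)]; exact hs _

lemma symp_single {t : ℕ → ℂ} {n : ℕ} (hn : n < P) : symp α P s t (Pi.single n 1)
    = (if n = 0 then 0 else bCoef α P s (n - 1) * t (P + n - 1)) - aCoef P s n * t (P + n) := by
  have h1 : ∀ k ∈ Finset.range P, dForm α P s t k * (Pi.single n 1 : ℕ → ℂ) (P + k)
      - dForm α P s (Pi.single n 1) k * t (P + k)
      = (if n = k + 1 then bCoef α P s k * t (P + k) else 0)
        - if n = k then aCoef P s k * t (P + k) else 0 := by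
    intro k hk
    have hk := Finset.mem_range.1 hk
    simp only [dForm, Pi.single_apply, if_neg (show ¬ n = P + k by omega), eq_comm (b := n)]
    split_ifs <;> ring
  rw [symp, Finset.sum_congr rfl h1, Finset.sum_sub_distrib, Finset.sum_ite_eq,
    if_pos (Finset.mem_range.2 hn)]
  congr 1
  rcases n with _ | n
  · simp
  · simp only [add_left_inj, Finset.sum_ite_eq, Finset.mem_range, if_pos (show n < P by omega),
      if_neg (Nat.succ_ne_zero n), Nat.add_sub_cancel, ← add_assoc]

lemma symp_single_add {t : ℕ → ℂ} (ht : ∀ k < P, t (P + k) = 0) {n : ℕ} (hn : n < P) :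
    symp α P s t (Pi.single (P + n) 1) = dForm α P s t n := by
  have h1 : ∀ k ∈ Finset.range P, dForm α P s t k * (Pi.single (P + n) 1 : ℕ → ℂ) (P + k)
      - dForm α P s (Pi.single (P + n) 1) k * t (P + k) = if n = k then dForm α P s t k else 0 := by
    intro k hk
    rw [ht k (Finset.mem_range.1 hk), Pi.single_apply]
    simp only [add_right_inj, eq_comm (b := n)]
    split_ifs <;> simp
  rw [symp, Finset.sum_congr rfl h1, Finset.sum_ite_eq, if_pos (Finset.mem_range.2 hn)]

/-- The symplectic form is nondegenerate. -/
lemma eq_zero_of_symp (hs : ∀ n, s n ≠ 0) {t : ℕ → ℂ} (h : ∀ τ, symp α P s t τ = 0) {n : ℕ}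
    (hn : n < 2 * P) : t n = 0 := by
  -- The pairing is triangular: the unit vectors at `0, …, P - 1` successively kill `t_P, …,
  -- t_{2P-1}`. Those at `P + k` then relate `t_k` to `t_{k+1}`, and the recursion starts from the
  -- top because `bCoef (P - 1) = 0`.
  have hi : ∀ k < P, t (P + k) = 0 := by
    intro k hk
    induction k with
    | zero =>
      have := h (Pi.single 0 1)
      rw [symp_single hk, if_pos rfl, zero_sub, neg_eq_zero] at this
      exact (mul_eq_zero.1 this).resolve_left (aCoef_ne_zero hs hk)
    | succ k ih =>
      have := h (Pi.single (k + 1) 1)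
      rw [symp_single hk, if_neg (by omega), ← add_assoc, Nat.add_sub_cancel, Nat.add_sub_cancel,
        ih (by omega), mul_zero, zero_sub, neg_eq_zero] at this
      exact (mul_eq_zero.1 this).resolve_left (aCoef_ne_zero hs hk)
  have hd : ∀ k < P, aCoef P s k * t k = bCoef α P s k * t (k + 1) := by
    intro k hk
    have := h (Pi.single (P + k) 1)
    rw [symp_single_add hi hk, dForm, hi k hk] at this
    linear_combination this
  have hj : ∀ j < P, t (P - 1 - j) = 0 := by
    intro j hj
    induction j with
    | zero =>
      have := hd (P - 1 - 0) (by omega)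
      rw [bCoef, if_neg (by omega), zero_mul] at this
      exact (mul_eq_zero.1 this).resolve_left (aCoef_ne_zero hs (by omega))
    | succ j ih =>
      have := hd (P - 1 - (j + 1)) (by omega)
      rw [show P - 1 - (j + 1) + 1 = P - 1 - j by omega, ih (by omega), mul_zero] at this
      exact (mul_eq_zero.1 this).resolve_left (aCoef_ne_zero hs (by omega))
  rcases Nat.lt_or_ge n P with h1 | h1
  · have := hj (P - 1 - n) (by omega)
    rwa [show P - 1 - (P - 1 - n) = n by omega] at this
  · have := hi (n - P) (by omega)
    rwa [show P + (n - P) = n by omega] at this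

/-- A vector, continued by zero. -/
def coordL (m : ℕ) : (Fin m → ℂ) →ₗ[ℂ] ℕ → ℂ where
  toFun := coord
  map_add' t τ := by
    ext n; simp only [coord, Pi.add_apply]; split_ifs <;> simp
  map_smul' c t := by
    ext n; simp only [coord, Pi.smul_apply, RingHom.id_apply]; split_ifs <;> simp

@[simp] lemma coordL_apply {m : ℕ} (t : Fin m → ℂ) : coordL m t = coord t := rfl

lemma coord_restrict {m n : ℕ} (t : ℕ → ℂ) (hn : n < m) : coord (fun i : Fin m => t i) n = t n := by
  rw [coord_of_lt _ hn]

lemma eq_zero_of_coord {m : ℕ} {t : Fin m → ℂ} (h : ∀ n < m, coord t n = 0) : t = 0 := by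
  ext i; rw [← coord_of_lt t i.2]; exact h i i.2

/-- Every linear form on logarithmic derivatives is represented by the symplectic form. -/
lemma exists_symp_eq (hs : ∀ n, s n ≠ 0) (f : (ℕ → ℂ) →ₗ[ℂ] ℂ)
    (hf : ∀ t τ : ℕ → ℂ, (∀ n < 2 * P, t n = τ n) → f t = f τ) :
    ∃ Z, ∀ t, f t = symp α P s Z t := by
  let Ω : (Fin (2 * P) → ℂ) →ₗ[ℂ] Module.Dual ℂ (Fin (2 * P) → ℂ) :=
    (sympL α P s).compl₁₂ (coordL _) (coordL _)
  have hΩ : ∀ t τ, Ω t τ = symp α P s (coord t) (coord τ) := fun t τ => rfl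
  have hinj : Function.Injective Ω := by
    refine (injective_iff_map_eq_zero Ω).2 fun t ht => eq_zero_of_coord fun n hn =>
      eq_zero_of_symp (α := α) hs (fun τ => ?_) hn
    rw [symp_congr (fun _ _ => rfl) fun n hn => (coord_restrict τ hn).symm, ← hΩ, ht]
    rfl
  have hsurj := (LinearMap.injective_iff_surjective_of_finrank_eq_finrank
    (Subspace.dual_finrank_eq (K := ℂ) (V := Fin (2 * P) → ℂ)).symm).1 hinj
  obtain ⟨Z, hZ⟩ := hsurj (f ∘ₗ coordL _)
  refine ⟨coord Z, fun t => ?_⟩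
  have hr : ∀ n < 2 * P, t n = coord (fun i : Fin (2 * P) => t i) n := fun n hn =>
    (coord_restrict t hn).symm
  rw [hf t _ hr, symp_congr (fun _ _ => rfl) hr, ← hΩ, hZ]
  rfl

/-- The Poisson tensor evaluated on two covectors that are represented by the symplectic form. -/
lemma sum_poissonTensor_of_symp (p : ℕ) {s ξ η : Fin (2 * (p + 2) - 1) → ℂ} (hs : ∀ i, s i ≠ 0)
    {Z Y : ℕ → ℂ}
    (hξ : ∀ t : ℕ → ℂ, ∑ i : Fin (2 * (p + 2) - 1), (t i - t ((i : ℕ) + 1)) * (s i * ξ i) = symp α (p + 2) s Z t)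
    (hη : ∀ t : ℕ → ℂ, ∑ i : Fin (2 * (p + 2) - 1), (t i - t ((i : ℕ) + 1)) * (s i * η i) = symp α (p + 2) s Y t) :
    ∑ k ∈ Finset.range (p + 2), (dForm α (p + 2) s Z k, dForm α (p + 2) s Y k) = 0 ∧
    ∑ i, ∑ j, poissonTensor α (p + 2) s i j * ξ i * η j
      = rhoForm (p + 2) (aCoef (p + 2) s) (bCoef α (p + 2) s) (qCoef α (p + 2) s)
          (fun k => (Z (p + 2 + k), Y (p + 2 + k)))
          (fun k => (dForm α (p + 2) s Z k, dForm α (p + 2) s Y k)) := by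
  have hsum : ∑ k ∈ Finset.range (p + 2), (dForm α (p + 2) s Z k, dForm α (p + 2) s Y k) = 0 := by
    have h1 := hξ fun _ => 1
    have h2 := hη fun _ => 1
    simp only [symp, dForm, sub_self, zero_mul, mul_zero, mul_one, add_zero, sub_zero,
      Finset.sum_const_zero] at h1 h2
    refine Prod.ext ?_ ?_
    · rw [Prod.fst_sum]; exact h1.symm
    · rw [Prod.snd_sum]; exact h2.symm
  refine ⟨hsum, ?_⟩
  rw [sum_poissonTensor_eq_rho p s ξ η hs _ (fun k => -(Z (p + 2 + k), Y (p + 2 + k))) hsum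
    fun t => ?_]
  · simp only [neg_neg]
  · refine Prod.ext ?_ ?_
    · rw [Prod.fst_sum, Prod.fst_sum]
      simp only [Prod.smul_fst, Prod.fst_add, Prod.fst_neg, smul_eq_mul]
      rw [hξ, symp]
      exact Finset.sum_congr rfl fun k _ => by ring
    · rw [Prod.snd_sum, Prod.snd_sum]
      simp only [Prod.smul_snd, Prod.snd_add, Prod.snd_neg, smul_eq_mul]
      rw [hη, symp]
      exact Finset.sum_congr rfl fun k _ => by ring

end Symplectic

/-! ### Transport of the symplectic form, and the Poisson property -/

section Poisson

variable {α κ : ℂ} {P : ℕ} {s : Fin (2 * P - 1) → ℂ}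
  {χ : (Fin (2 * P - 1) → ℂ) → Fin (2 * P - 1) → ℂ} {w : (Fin (2 * P - 1) → ℂ) → ℤ → ℂ}

/-- The tangent vector as a linear function of the logarithmic derivatives. -/
def tangL (s : Fin (2 * P - 1) → ℂ) : (ℕ → ℂ) →ₗ[ℂ] Fin (2 * P - 1) → ℂ where
  toFun := tang s
  map_add' t τ := by ext i; simp only [tang, Pi.add_apply]; ring
  map_smul' c t := by
    ext i; simp only [tang, Pi.smul_apply, smul_eq_mul, RingHom.id_apply]; ring

@[simp] lemma tangL_apply (t : ℕ → ℂ) : tangL s t = tang s t := rfl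

lemma tang_congr {t τ : ℕ → ℂ} (h : ∀ n < 2 * P, t n = τ n) : tang s t = tang s τ := by
  ext i
  rw [tang, tang, h i (by omega), h (i + 1) (by omega)]

lemma sum_mul_fderiv_single (f : (Fin (2 * P - 1) → ℂ) → ℂ) (t : ℕ → ℂ) :
    ∑ i : Fin (2 * P - 1), (t i - t ((i : ℕ) + 1)) * (s i * fderiv ℂ f s (Pi.single i 1))
      = fderiv ℂ f s (tang s t) := by
  conv_rhs => rw [pi_eq_sum_univ' (tang s t), map_sum]
  refine Finset.sum_congr rfl fun i _ => ?_
  rw [map_smul, smul_eq_mul, tang]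
  ring

namespace IsBranch

lemma symp_image (h : IsBranch α κ P s χ w) (hP : 2 ≤ P) (t τ : ℕ → ℂ) :
    symp α P s t τ = symp α P (χ s) (imageD w s t) (imageD w s τ) := by
  obtain ⟨p, rfl⟩ : ∃ p, P = p + 2 := ⟨P - 2, by omega⟩
  exact (h.formData rfl t τ).omega_eq

/-- The action of the differential of a branch on logarithmic derivatives. -/
def imageL (w : (Fin (2 * P - 1) → ℂ) → ℤ → ℂ) (s : Fin (2 * P - 1) → ℂ) :
    (Fin (2 * P) → ℂ) →ₗ[ℂ] Fin (2 * P) → ℂ where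
  toFun t i := imageD w s (coord t) i
  map_add' t τ := by
    ext i
    simp only [imageD, ← coordL_apply, ← tangL_apply, map_add, Pi.add_apply]
    ring
  map_smul' c t := by
    ext i
    simp only [imageD, ← coordL_apply, ← tangL_apply, map_smul, Pi.smul_apply, smul_eq_mul,
      RingHom.id_apply]
    ring

/-- A linear map that preserves a nondegenerate form is injective, hence surjective in finite
dimension. -/
lemma exists_imageD_eq (h : IsBranch α κ P s χ w) (hP : 2 ≤ P) (t : ℕ → ℂ) :
    ∃ τ, ∀ n < 2 * P, t n = imageD w s τ n := by
  have hc : ∀ (τ : Fin (2 * P) → ℂ), ∀ n < 2 * P, imageD w s (coord τ) n = coord (imageL w s τ) n :=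
    fun τ n hn => (coord_restrict (imageD w s (coord τ)) hn).symm
  have hinj : Function.Injective (imageL w s) := by
    refine (injective_iff_map_eq_zero _).2 fun t ht => eq_zero_of_coord fun n hn =>
      eq_zero_of_symp (α := α) h.ne_zero (fun τ => ?_) hn
    rw [h.symp_image hP, symp_congr (hc t) fun _ _ => rfl, ht, ← coordL_apply, map_zero]
    exact LinearMap.map_zero₂ (sympL α P (χ s)) _
  obtain ⟨τ, hτ⟩ := LinearMap.injective_iff_surjective.1 hinj fun i => t i
  refine ⟨coord τ, fun n hn => ?_⟩
  rw [hc τ n hn, hτ, coord_restrict t hn]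

/-- If `Z` represents the pulled-back coordinate differential at `s`, then its image represents the
coordinate differential at `χ s`. Both brackets are thus values of `rhoForm` on corresponding
vectors, and these values agree. -/
theorem isPoissonAt (h : IsBranch α κ P s χ w) (hP : 2 ≤ P) (hχ : DifferentiableAt ℂ χ s) :
    IsPoissonAt α P χ s := by
  refine ⟨hχ, fun i j => ?_⟩
  have hrep : ∀ i, ∃ Z, ∀ t, fderiv ℂ (fun σ => χ σ i) s (tang s t) = symp α P s Z t := fun i =>
    exists_symp_eq h.ne_zero ((fderiv ℂ (fun σ => χ σ i) s).toLinearMap ∘ₗ tangL s) fun t τ htτ => by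
      simp [tang_congr htτ]
  obtain ⟨Z, hZ⟩ := hrep i
  obtain ⟨Y, hY⟩ := hrep j
  -- It suffices to test on images of vectors at `s`, where invariance of the symplectic form
  -- reduces the claim to the definition of `Z`.
  have himg : ∀ i Z, (∀ t, fderiv ℂ (fun σ => χ σ i) s (tang s t) = symp α P s Z t) →
      ∀ t : ℕ → ℂ, ∑ a : Fin (2 * P - 1), (t a - t ((a : ℕ) + 1)) * (χ s a * (Pi.single i 1 : _ → ℂ) a)
        = symp α P (χ s) (imageD w s Z) t := by
    intro i Z hZ t
    obtain ⟨τ, hτ⟩ := h.exists_imageD_eq hP t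
    have h1 := (h.logD_image i.2).2 τ
    simp only [coord_of_lt _ i.2, Fin.eta] at h1
    rw [hZ, h.symp_image hP, ← hτ i (by omega), ← hτ (i + 1) (by omega)] at h1
    rw [symp_congr (fun _ _ => rfl) hτ, h1]
    simp only [Pi.single_apply, mul_ite, mul_one, mul_zero, Finset.sum_ite_eq', Finset.mem_univ,
      if_true]
    ring
  have hZ' := himg i Z hZ
  have hY' := himg j Y hY
  obtain ⟨p, rfl⟩ : ∃ p, P = p + 2 := ⟨P - 2, by omega⟩
  obtain ⟨hsum, e⟩ := sum_poissonTensor_of_symp (α := α) p h.ne_zero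
    (fun t => (sum_mul_fderiv_single _ t).trans (hZ t))
    (fun t => (sum_mul_fderiv_single _ t).trans (hY t))
  have e' := (sum_poissonTensor_of_symp (α := α) p h.ne_zero' hZ' hY').2
  rw [bracket, e, (h.formData rfl Z Y).rho_eq hsum, ← e']
  simp only [Pi.single_apply, mul_ite, mul_one, mul_zero, Finset.sum_ite_eq', Finset.mem_univ,
    if_true]

end IsBranch

/-- Every holomorphic branch of the correspondence is a Poisson map. -/
theorem isPoissonAt_of_isBT (hP : 2 ≤ P) (hα : α ≠ 0) {U : Set (Fin (2 * P - 1) → ℂ)}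
    {x : (Fin (2 * P - 1) → ℂ) → ℂ} (hU : IsOpen U) (hx : DifferentiableOn ℂ x U)
    (h : ∀ σ ∈ U, IsBT α P κ (x σ) σ (χ σ)) (hs : s ∈ U) : IsPoissonAt α P χ s := by
  -- The chains are chosen pointwise, without any continuity. Differentiability of their terms
  -- follows afterwards, since those with indices below `4P` are determined by `x σ` and `σ`.
  have hc : ∀ σ, ∃ w, σ ∈ U → IsChain α P κ (x σ) σ (χ σ) w := fun σ => by
    by_cases hσ : σ ∈ U
    · obtain ⟨w, hw⟩ := isChain_of_isBT hP hα (h σ hσ)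
      exact ⟨w, fun _ => hw⟩
    · exact ⟨0, fun h => (hσ h).elim⟩
  choose w hw using hc
  have hev : ∀ᶠ σ in 𝓝 s, IsChain α P κ (x σ) σ (χ σ) (w σ) :=
    (hU.eventually_mem hs).mono hw
  have hxs := hx.differentiableAt (hU.mem_nhds hs)
  have hb : IsBranch α κ P s χ w := ⟨hev.mono fun σ hσ => hσ.last ▸ hσ, fun k h0 hk =>
    differentiableAt_chain hP hα hev hxs h0 hk⟩
  exact hb.isPoissonAt hP (differentiableAt_branch hP hα hev hxs)

end Poisson

end TodaBT

end

theorem theorem7 (α : ℂ) (hα : α ≠ 0) (P : ℕ) (hP : 2 ≤ P) :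
    -- every solution `u` of the lifted equation gives two solutions of the reduced Toda equation
    -- related by the Bäcklund transformation with parameter `κ = (1 - γ_0 γ_1) / α`
    (∀ u τ : ℤ → ℂ, (∀ n, u n ≠ 0) → (∀ n, τ n ≠ 0) →
      (∀ n, TodaBT.LiftedDTKQAt α P u n) →
      (∀ n, u n = τ (n + 3) * τ n / (τ (n + 2) * τ (n + 1))) →
      (∀ n, TodaBT.gam α P u (n + 2) = TodaBT.gam α P u n) ∧
      (∀ n, TodaBT.TodaAt α P (fun m => τ (2 * m) / τ (2 * m + 2)) n) ∧
      (∀ n, TodaBT.TodaAt α P (fun m => τ (2 * m + 1) / τ (2 * m + 3)) n) ∧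
      TodaBT.SeqBT α P (TodaBT.kappa α P u)
        (fun m => τ (2 * m) / τ (2 * m + 2)) (fun m => τ (2 * m + 1) / τ (2 * m + 3))) ∧
    -- conversely, every pair of sequences related by the Bäcklund transformation arises in this
    -- way; the monodromy matrices are similar through the gauge matrix, and spectrality holds
    (∀ (κ : ℂ) (v v' u : ℤ → ℂ), TodaBT.SeqBT α P κ v v' →
      (∀ n, u (2 * n) = v n / v' n ∧ u (2 * n + 1) = v' n / v (n + 1)) →
      (∀ n, TodaBT.LiftedDTKQAt α P u n) ∧ κ = TodaBT.kappa α P u ∧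
      (∀ n, TodaBT.TodaAt α P v n) ∧ (∀ n, TodaBT.TodaAt α P v' n) ∧
      ∀ n,
        TodaBT.monodromy α P v n * TodaBT.gauge κ v v' n
          = TodaBT.gauge κ v v' n * TodaBT.monodromy α P v' n ∧
        (TodaBT.monodromy α P v n).trace = (TodaBT.monodromy α P v' n).trace ∧
        ∃ μ : ℂ,
          Matrix.vecMul ![(v (n + 1))⁻¹, u (2 * n + 1)]
              ((TodaBT.monodromy α P v n).map (Polynomial.eval κ))
            = μ • ![(v (n + 1))⁻¹, u (2 * n + 1)] ∧
          μ ^ 2 - (TodaBT.monodromy α P v n).trace.eval κ * μ + (1 - α * κ) = 0) ∧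
    -- the correspondence on `ℂ^N` is the graph of `φ` seen through `π̂₂`
    (∀ (κ x : ℂ) (s s' : Fin (2 * P - 1) → ℂ), TodaBT.IsBT α P κ x s s' ↔
      ∃ u : Fin (2 * P) → ℂ, TodaBT.Regular α P u ∧ κ = TodaBT.kappaPt α P u ∧
        x = TodaBT.uTerm α P u (4 * P - 1) ∧ s = TodaBT.piHat α P u ∧
        s' = TodaBT.piHat α P (TodaBT.phi α P u)) ∧
    -- it maps solutions of the equation for `s` to solutions
    (∀ (κ x : ℂ) (s s' : Fin (2 * P - 1) → ℂ), TodaBT.IsBT α P κ x s s' →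
      (∀ j, TodaBT.chiHat α P s' j ≠ 0) →
      (∀ j, TodaBT.chiHat α P (TodaBT.chiHat α P s) j ≠ 0) →
      ∃ x', TodaBT.IsBT α P κ x' (TodaBT.chiHat α P s) (TodaBT.chiHat α P s')) ∧
    -- it is generically two-valued
    (∃ Q : MvPolynomial (Option (Fin (2 * P - 1))) ℂ, Q ≠ 0 ∧
      ∀ (κ : ℂ) (s : Fin (2 * P - 1) → ℂ), MvPolynomial.eval (fun o => o.elim κ s) Q ≠ 0 →
        ∃ W x₁ x₂ χ₁ χ₂, (κ, s) ∈ W ∧ TodaBT.IsTwoValuedOn α P W x₁ x₂ χ₁ χ₂) ∧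
    -- every branch of it, for any fixed parameter, is a Poisson map
    (∀ (κ : ℂ) (U : Set (Fin (2 * P - 1) → ℂ)) (x : (Fin (2 * P - 1) → ℂ) → ℂ)
        (χ : (Fin (2 * P - 1) → ℂ) → Fin (2 * P - 1) → ℂ),
      IsOpen U → DifferentiableOn ℂ x U → (∀ s ∈ U, TodaBT.IsBT α P κ (x s) s (χ s)) →
      ∀ s ∈ U, TodaBT.IsPoissonAt α P χ s) ∧
    -- it preserves all the first integrals obtained from the trace of the monodromy matrix
    (∀ (κ x : ℂ) (s s' : Fin (2 * P - 1) → ℂ), TodaBT.IsBT α P κ x s s' →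
      ∀ k, TodaBT.traceIntegral α P k s' = TodaBT.traceIntegral α P k s) ∧
    -- near a generic point `φ` is carried by `π̂₂` to one of the two branches
    (∃ Q : MvPolynomial (Fin (2 * P)) ℂ, Q ≠ 0 ∧
      ∀ u₀ : Fin (2 * P) → ℂ, MvPolynomial.eval u₀ Q ≠ 0 →
        ∃ W x₁ x₂ χ₁ χ₂, TodaBT.IsTwoValuedOn α P W x₁ x₂ χ₁ χ₂ ∧
          ∃ V : Set (Fin (2 * P) → ℂ), IsOpen V ∧ u₀ ∈ V ∧ ∀ u ∈ V,
            TodaBT.Regular α P u ∧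
            (TodaBT.kappaPt α P u, TodaBT.piHat α P u) ∈ W ∧
            TodaBT.piHat α P (TodaBT.phi α P u)
              = χ₁ (TodaBT.kappaPt α P u, TodaBT.piHat α P u)) := by
  refine ⟨fun u τ hu hτ hE hut => TodaBT.seqBT_of_tau hP hα u τ hu hτ hE hut,
    fun κ v v' u hBT hu => TodaBT.lifted_of_seqBT hP hα hBT hu,
    fun κ x s s' => TodaBT.isBT_iff_exists_point hP hα,
    fun κ x s s' h h1 h2 => TodaBT.isBT_chiHat hP hα h h1 h2,
    TodaBT.exists_polynomial_isTwoValuedOn hP hα,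
    fun κ U x χ hU hx h s hs => TodaBT.isPoissonAt_of_isBT hP hα hU hx h hs,
    fun κ x s s' h k => TodaBT.traceIntegral_eq_of_isBT hP h k,
    TodaBT.exists_polynomial_branch hP hα⟩
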